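/- Let $\mathcal C$ be a symmetric monoidal category (tensor product $\otimes$, unit object $K$, symmetry $c$; associativity and unit constraints are suppressed below, and $\mathcal C$ need not be strict) with equalizers and coequalizers. An object is also used to denote its identity morphism. **Definitions.** A *unital magma* is an object $A$ with morphisms $\eta_A:K\to A$, $\mu_A:A\otimes A\to A$ such that $\mu_A\circ(A\otimes\eta_A)=id_A=\mu_A\circ(\eta_A\otimes A)$. For unital magmas $A,B$ put $\mu_{A\otimes B}=(\mu_A\otimes\mu_B)\circ(A\otimes c_{B,A}\otimes B)$; for a comonoid $D$ put $\delta_{D\otimes D}=(D\otimes c_{D,D}\otimes D)\circ(\delta_D\otimes\delta_D)$. For $f,g:D\to A$ with $D$ a comonoid and $A$ a unital magma, $f*g=\mu_A\circ(f\otimes g)\circ\delta_D$. A *weak Hopf quasigroup* is a unital magma $(H,\eta_H,\mu_H)$ that is also a comonoid $(H,\varepsilon_H,\delta_H)$ (coassociative, counital), such that - (a1) $\delta_H\circ\mu_H=(\mu_H\otimes\mu_H)\circ\delta_{H\otimes H}$; - (a2) $\varepsilon_H\circ\mu_H\circ(\mu_H\otimes H)=\varepsilon_H\circ\mu_H\circ(H\otimes\mu_H)=((\varepsilon_H\circ\mu_H)\otimes(\varepsilon_H\circ\mu_H))\circ(H\otimes\delta_H\otimes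 H)=((\varepsilon_H\circ\mu_H)\otimes(\varepsilon_H\circ\mu_H))\circ(H\otimes(c_{H,H}\circ\delta_H)\otimes H)$; - (a3) $(\delta_H\otimes H)\circ\delta_H\circ\eta_H=(H\otimes\mu_H\otimes H)\circ((\delta_H\circ\eta_H)\otimes(\delta_H\circ\eta_H))=(H\otimes(\mu_H\circ c_{H,H})\otimes H)\circ((\delta_H\circ\eta_H)\otimes(\delta_H\circ\eta_H))$; - (a4) there is $\lambda_H:H\to H$ (the antipode) such that, with $\Pi_H^L=id_H*\lambda_H$ and $\Pi_H^R=\lambda_H*id_H$: - $\Pi_H^L=((\varepsilon_H\circ\mu_H)\otimes H)\circ(H\otimes c_{H,H})\circ((\delta_H\circ\eta_H)\otimes H)$, - $\Pi_H^R=(H\otimes(\varepsilon_H\circ\mu_H))\circ(c_{H,H}\otimes H)\circ(H\otimes(\delta_H\circ\eta_H))$, - $\lambda_H*\Pi_H^L=\Pi_H^R*\lambda_H=\lambda_H$, - $\mu_H\circ(\lambda_H\otimes\mu_H)\circ(\delta_H\otimes H)=\mu_H\circ(\Pi_H^R\otimes H)$, - $\mu_H\circ(H\otimes\mu_H)\circ(H\otimes\lambda_H\otimes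 H)\circ(\delta_H\otimes H)=\mu_H\circ(\Pi_H^L\otimes H)$, - $\mu_H\circ(\mu_H\otimes\lambda_H)\circ(H\otimes\delta_H)=\mu_H\circ(H\otimes\Pi_H^L)$, - $\mu_H\circ(\mu_H\otimes H)\circ(H\otimes\lambda_H\otimes H)\circ(H\otimes\delta_H)=\mu_H\circ(H\otimes\Pi_H^R)$. Put $\overline\Pi_H^R=((\varepsilon_H\circ\mu_H)\otimes H)\circ(H\otimes(\delta_H\circ\eta_H))$. A *right $H$-comodule magma* is a unital magma $A$ with $\rho_A:A\to A\otimes H$ such that $(A\otimes\varepsilon_H)\circ\rho_A=id_A$, $(\rho_A\otimes H)\circ\rho_A=(A\otimes\delta_H)\circ\rho_A$, $\mu_{A\otimes H}\circ(\rho_A\otimes\rho_A)=\rho_A\circ\mu_A$ and $(A\otimes\Pi_H^L)\circ\rho_A\circ\eta_A=\rho_A\circ\eta_A$. Let $i_A:A^{coH}\to A$ be the equalizer of $\rho_A$ and $(A\otimes\Pi_H^L)\circ\rho_A$. It is a unital magma, $\eta_{A^{coH}}$ and $\mu_{A^{coH}}$ being the factorizations of $\eta_A$ and $\mu_A\circ(i_A\otimes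 i_A)$ through $i_A$. **Theorem.** Let $H$ be a weak Hopf quasigroup in $\mathcal C$ and let $(A,\rho_A)$ be a right $H$-comodule magma such that $$\mu_A\circ(A\otimes(\mu_A\circ(i_A\otimes A)))=\mu_A\circ((\mu_A\circ(A\otimes i_A))\otimes A),\qquad \mu_A\circ(A\otimes(\mu_A\circ(A\otimes i_A)))=\mu_A\circ(\mu_A\otimes i_A),$$ and such that the functor $A\otimes-$ preserves coequalizers. Then $\nabla_A=\mu_{A\otimes H}\circ(A\otimes H\otimes(\rho_A\circ\eta_A)):A\otimes H\to A\otimes H$ is a split idempotent. For every splitting $p_{A\otimes H}:A\otimes H\to A\square H$, $i_{A\otimes H}:A\square H\to A\otimes H$ (that is, $\nabla_A=i_{A\otimes H}\circ p_{A\otimes H}$ and $p_{A\otimes H}\circ i_{A\otimes H}=id_{A\square H}$), the following assertions are equivalent. (i) $A^{coH}\hookrightarrow A$ is a weak $H$-Galois extension with normal basis and $\gamma_A^{-1}$ is almost lineal. (ii) $A^{coH}\hookrightarrow A$ is a weak $H$-cleft extension. The terms in (i) and (ii) mean the following. Let $n_A:A\otimes A\to A\otimes_{A^{coH}}A$ be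 the coequalizer of $(\mu_A\circ(A\otimes i_A))\otimes A$ and $A\otimes(\mu_A\circ(i_A\otimes A))$. Let $\gamma_A:A\otimes_{A^{coH}}A\to A\square H$ be the unique morphism with $\gamma_A\circ n_A=p_{A\otimes H}\circ(\mu_A\otimes H)\circ(A\otimes\rho_A)$, and let $\varphi:A\otimes(A\otimes_{A^{coH}}A)\to A\otimes_{A^{coH}}A$ be the unique morphism with $\varphi\circ(A\otimes n_A)=n_A\circ(\mu_A\otimes A)$ (both exist under the hypotheses). - *Weak $H$-Galois*: $\gamma_A$ is an isomorphism. - *$\gamma_A^{-1}$ is almost lineal*: $\gamma_A^{-1}\circ p_{A\otimes H}=\varphi\circ\big(A\otimes(\gamma_A^{-1}\circ p_{A\otimes H}\circ(\eta_A\otimes H))\big)$. - *Normal basis*: there are an idempotent $\Omega_A$ of $A^{coH}\otimes H$ that is a morphism of left $A^{coH}$-modules (action $\mu_{A^{coH}}\otimes H$) and of right $H$-comodules (coaction $A^{coH}\otimes\delta_H$), with a splitting $\Omega_A=s_A\circ r_A$, $r_A\circ s_A=id_{A^{coH}\times H}$ through an object $A^{coH}\times H$, and an isomorphism $b_A:A\to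 A^{coH}\times H$ of left $A^{coH}$-modules and right $H$-comodules. Here $A$ carries the action $\mu_A\circ(i_A\otimes A)$ and the coaction $\rho_A$, and $A^{coH}\times H$ carries the action $r_A\circ(\mu_{A^{coH}}\otimes H)\circ(A^{coH}\otimes s_A)$ and the coaction $(r_A\otimes H)\circ(A^{coH}\otimes\delta_H)\circ s_A$. - *Weak $H$-cleft*: there are morphisms $h,h^{-1}:H\to A$ with $\rho_A\circ h=(h\otimes H)\circ\delta_H$ and - (c1) $h^{-1}*h=(A\otimes(\varepsilon_H\circ\mu_H))\circ(c_{H,A}\otimes H)\circ(H\otimes(\rho_A\circ\eta_A))$, - (c2) $(A\otimes\mu_H)\circ(c_{H,A}\otimes H)\circ(H\otimes(\rho_A\circ h^{-1}))\circ\delta_H=(A\otimes\overline\Pi_H^R)\circ\rho_A\circ h^{-1}$, - (c3) $\mu_A\circ(\mu_A\otimes A)\circ(A\otimes h^{-1}\otimes h)\circ(A\otimes\delta_H)=\mu_A\circ(A\otimes(h^{-1}*h))$, - (c4) $\mu_A\circ(\mu_A\otimes A)\circ(A\otimes h\otimes h^{-1})\circ(A\otimes\delta_H)=\mu_A\circ(A\otimes(h*h^{-1}))$.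 -/

import Mathlib

open CategoryTheory MonoidalCategory Limits
open scoped ComonObj

set_option linter.unusedSectionVars false

noncomputable section

namespace WeakHopfQuasi

universe v u

variable {C : Type u} [Category.{v} C] [MonoidalCategory C]

/-! ### Unital magmas, convolution -/

/-- A unital magma in a monoidal category: a (not necessarily associative) product with unit. -/
class UnitalMagmaObj (A : C) where
  one : 𝟙_ C ⟶ A
  mul : A ⊗ A ⟶ A
  one_mul : one ▷ A ≫ mul = (λ_ A).hom
  mul_one : A ◁ one ≫ mul = (ρ_ A).hom

/-- The unit of a unital magma. -/
abbrev un (A : C) [UnitalMagmaObj A] : 𝟙_ C ⟶ A := UnitalMagmaObj.one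

/-- The product of a unital magma. -/
abbrev mu (A : C) [UnitalMagmaObj A] : A ⊗ A ⟶ A := UnitalMagmaObj.mul

/-- The convolution product `f * g = μ ∘ (f ⊗ g) ∘ δ`. -/
def conv {D A : C} [ComonObj D] [UnitalMagmaObj A] (f g : D ⟶ A) : D ⟶ A :=
  Δ[D] ≫ (f ⊗ₘ g) ≫ mu A

/-- The associativity constraint `(X ⊗ Y) ⊗ (Z ⊗ W) ⟶ (X ⊗ (Y ⊗ Z)) ⊗ W`. -/
abbrev regroup (X Y Z W : C) : (X ⊗ Y) ⊗ (Z ⊗ W) ⟶ (X ⊗ (Y ⊗ Z)) ⊗ W :=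
  (α_ (X ⊗ Y) Z W).inv ≫ (α_ X Y Z).hom ▷ W

/-- The associativity constraint `(X ⊗ (Y ⊗ Z)) ⊗ W ⟶ (X ⊗ Y) ⊗ (Z ⊗ W)`. -/
abbrev ungroup (X Y Z W : C) : (X ⊗ (Y ⊗ Z)) ⊗ W ⟶ (X ⊗ Y) ⊗ (Z ⊗ W) :=
  (α_ X Y Z).inv ▷ W ≫ (α_ (X ⊗ Y) Z W).hom

/-- A splitting of an endomorphism: `f = i ∘ p` and `p ∘ i = id`. -/
structure Splitting {X : C} (f : X ⟶ X) where
  /-- the image object -/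
  obj : C
  i : obj ⟶ X
  p : X ⟶ obj
  p_i : p ≫ i = f
  i_p : i ≫ p = 𝟙 obj

variable [SymmetricCategory C]

/-! ### Weak Hopf quasigroups -/

/-- A weak Hopf quasigroup: a unital magma and a comonoid with an antipode `λ`. The comonoid
axioms are those of Mathlib's `ComonObj`; `tensorμ H H H H` is `H ⊗ c ⊗ H`. -/
class WeakHopfQuasigroup (H : C) extends UnitalMagmaObj H, ComonObj H where
  /-- `δ ∘ μ = (μ ⊗ μ) ∘ δ_{H ⊗ H}` -/
  mul_comul : mu H ≫ Δ[H] = (Δ[H] ⊗ₘ Δ[H]) ≫ tensorμ H H H H ≫ (mu H ⊗ₘ mu H)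
  /-- `ε ∘ μ ∘ (μ ⊗ H) = ε ∘ μ ∘ (H ⊗ μ)` -/
  counit_assoc : mu H ▷ H ≫ mu H ≫ ε[H] = (α_ H H H).hom ≫ H ◁ mu H ≫ mu H ≫ ε[H]
  /-- `ε ∘ μ ∘ (μ ⊗ H) = ((ε ∘ μ) ⊗ (ε ∘ μ)) ∘ (H ⊗ δ ⊗ H)` -/
  counit_split : mu H ▷ H ≫ mu H ≫ ε[H] =
    (H ◁ Δ[H]) ▷ H ≫ ungroup H H H H ≫ ((mu H ≫ ε[H]) ⊗ₘ (mu H ≫ ε[H])) ≫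
      (λ_ (𝟙_ C)).hom
  /-- `ε ∘ μ ∘ (μ ⊗ H) = ((ε ∘ μ) ⊗ (ε ∘ μ)) ∘ (H ⊗ (c ∘ δ) ⊗ H)` -/
  counit_split' : mu H ▷ H ≫ mu H ≫ ε[H] =
    (H ◁ (Δ[H] ≫ (β_ H H).hom)) ▷ H ≫ ungroup H H H H ≫
      ((mu H ≫ ε[H]) ⊗ₘ (mu H ≫ ε[H])) ≫ (λ_ (𝟙_ C)).hom
  /-- `(δ ⊗ H) ∘ δ ∘ η = (H ⊗ μ ⊗ H) ∘ ((δ ∘ η) ⊗ (δ ∘ η))` -/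
  unit_split : un H ≫ Δ[H] ≫ Δ[H] ▷ H =
    (λ_ (𝟙_ C)).inv ≫ ((un H ≫ Δ[H]) ⊗ₘ (un H ≫ Δ[H])) ≫ regroup H H H H ≫
      (H ◁ mu H) ▷ H
  /-- `(δ ⊗ H) ∘ δ ∘ η = (H ⊗ (μ ∘ c) ⊗ H) ∘ ((δ ∘ η) ⊗ (δ ∘ η))` -/
  unit_split' : un H ≫ Δ[H] ≫ Δ[H] ▷ H =
    (λ_ (𝟙_ C)).inv ≫ ((un H ≫ Δ[H]) ⊗ₘ (un H ≫ Δ[H])) ≫ regroup H H H H ≫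
      (H ◁ ((β_ H H).hom ≫ mu H)) ▷ H
  /-- the antipode `λ` -/
  antipode : H ⟶ H
  /-- `id * λ = ((ε ∘ μ) ⊗ H) ∘ (H ⊗ c) ∘ ((δ ∘ η) ⊗ H)` -/
  target_eq : conv (𝟙 H) antipode =
    (λ_ H).inv ≫ (un H ≫ Δ[H]) ▷ H ≫ (α_ H H H).hom ≫ H ◁ (β_ H H).hom ≫ (α_ H H H).inv ≫
      (mu H ≫ ε[H]) ▷ H ≫ (λ_ H).hom
  /-- `λ * id = (H ⊗ (ε ∘ μ)) ∘ (c ⊗ H) ∘ (H ⊗ (δ ∘ η))` -/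
  source_eq : conv antipode (𝟙 H) =
    (ρ_ H).inv ≫ H ◁ (un H ≫ Δ[H]) ≫ (α_ H H H).inv ≫ (β_ H H).hom ▷ H ≫ (α_ H H H).hom ≫
      H ◁ (mu H ≫ ε[H]) ≫ (ρ_ H).hom
  antipode_conv_target : conv antipode (conv (𝟙 H) antipode) = antipode
  source_conv_antipode : conv (conv antipode (𝟙 H)) antipode = antipode
  /-- `μ ∘ (λ ⊗ μ) ∘ (δ ⊗ H) = μ ∘ (Π^R ⊗ H)` -/
  antipode_mul : Δ[H] ▷ H ≫ (α_ H H H).hom ≫ (antipode ⊗ₘ mu H) ≫ mu H =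
    conv antipode (𝟙 H) ▷ H ≫ mu H
  /-- `μ ∘ (H ⊗ μ) ∘ (H ⊗ λ ⊗ H) ∘ (δ ⊗ H) = μ ∘ (Π^L ⊗ H)` -/
  mul_antipode_mul : Δ[H] ▷ H ≫ (α_ H H H).hom ≫ H ◁ (antipode ▷ H) ≫ H ◁ mu H ≫ mu H =
    conv (𝟙 H) antipode ▷ H ≫ mu H
  /-- `μ ∘ (μ ⊗ λ) ∘ (H ⊗ δ) = μ ∘ (H ⊗ Π^L)` -/
  mul_mul_antipode : H ◁ Δ[H] ≫ (α_ H H H).inv ≫ (mu H ⊗ₘ antipode) ≫ mu H =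
    H ◁ conv (𝟙 H) antipode ≫ mu H
  /-- `μ ∘ (μ ⊗ H) ∘ (H ⊗ λ ⊗ H) ∘ (H ⊗ δ) = μ ∘ (H ⊗ Π^R)` -/
  mul_antipode_mul' : H ◁ Δ[H] ≫ (α_ H H H).inv ≫ (H ◁ antipode) ▷ H ≫ mu H ▷ H ≫ mu H =
    H ◁ conv antipode (𝟙 H) ≫ mu H

section Target

variable (H : C) [WeakHopfQuasigroup H]

/-- The target morphism `Π^L = id * λ`. -/
def target : H ⟶ H := conv (𝟙 H) WeakHopfQuasigroup.antipode

/-- The morphism `((ε ∘ μ) ⊗ H) ∘ (H ⊗ (δ ∘ η))`, i.e. `Π^R` with a bar. -/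
def barSource : H ⟶ H :=
  (ρ_ H).inv ≫ H ◁ (un H ≫ Δ[H]) ≫ (α_ H H H).inv ≫ (mu H ≫ ε[H]) ▷ H ≫ (λ_ H).hom

lemma unit_barSource : un H ≫ Δ[H] ≫ H ◁ barSource H = un H ≫ Δ[H] := by
  have h := congrArg (fun t => t ≫ (H ◁ ε[H]) ▷ H ≫ (ρ_ H).hom ▷ H)
    (WeakHopfQuasigroup.unit_split (H := H))
  have h1 : (un H ≫ Δ[H] ≫ Δ[H] ▷ H) ≫ (H ◁ ε[H]) ▷ H ≫ (ρ_ H).hom ▷ H = un H ≫ Δ[H] := by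
    simp only [Category.assoc, ← comp_whiskerRight]
    simp
  refine Eq.trans ?_ (h.symm.trans h1)
  simp only [barSource, regroup, MonoidalCategory.tensorHom_def]
  monoidal

lemma target_barSource : target H ≫ barSource H = target H := by
  rw [target, WeakHopfQuasigroup.target_eq]
  have hb : (barSource H ▷ H) ≫ (β_ H H).hom = (β_ H H).hom ≫ H ◁ barSource H :=
    BraidedCategory.braiding_naturality_left _ _
  have h : (H ◁ barSource H) ▷ H ≫ (α_ H H H).hom ≫ H ◁ (β_ H H).hom =
      (α_ H H H).hom ≫ H ◁ (β_ H H).hom ≫ H ◁ (H ◁ barSource H) := by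
    rw [associator_naturality_middle_assoc, ← whiskerLeft_comp, hb, whiskerLeft_comp]
  have h2 : (un H ≫ Δ[H]) ▷ H ≫ (H ◁ barSource H) ▷ H = (un H ≫ Δ[H]) ▷ H := by
    rw [← comp_whiskerRight, Category.assoc, unit_barSource]
  conv_rhs => rw [← h2]
  simp only [Category.assoc]
  rw [reassoc_of% h]
  have h3 : H ◁ H ◁ barSource H ≫ (α_ H H H).inv ≫ (mu H ≫ ε[H]) ▷ H ≫ (λ_ H).hom =
      (α_ H H H).inv ≫ (mu H ≫ ε[H]) ▷ H ≫ (λ_ H).hom ≫ barSource H := by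
    rw [← leftUnitor_naturality, ← whisker_exchange_assoc]
    monoidal
  rw [h3]

lemma tensorMu_tail (X Y Z W V : C) :
    tensorμ X Y Z (W ⊗ V) ≫ (X ⊗ Z) ◁ (α_ Y W V).inv =
      (X ⊗ Y) ◁ (α_ Z W V).inv ≫ (α_ (X ⊗ Y) (Z ⊗ W) V).inv ≫ tensorμ X Y Z W ▷ V ≫
        (α_ (X ⊗ Z) (Y ⊗ W) V).hom := by
  simp only [tensorμ]
  monoidal

lemma tensorMu_head (X Y Z W V : C) :
    tensorμ (X ⊗ Y) Z W V =
      (α_ X Y Z).hom ▷ (W ⊗ V) ≫ (α_ X (Y ⊗ Z) (W ⊗ V)).hom ≫ X ◁ tensorμ Y Z W V ≫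
        (α_ X (Y ⊗ W) (Z ⊗ V)).inv ≫ (α_ X Y W).inv ▷ (Z ⊗ V) := by
  simp only [tensorμ]
  monoidal

lemma counit_mul_mul : H ◁ mu H ≫ mu H ≫ ε[H] =
    (α_ H H H).inv ≫ (H ◁ Δ[H]) ▷ H ≫ ungroup H H H H ≫
      ((mu H ≫ ε[H]) ⊗ₘ (mu H ≫ ε[H])) ≫ (λ_ (𝟙_ C)).hom := by
  rw [← WeakHopfQuasigroup.counit_split, WeakHopfQuasigroup.counit_assoc, Iso.inv_hom_id_assoc]

lemma tensor_scalar {X Y Z W : C} (f : X ⟶ Y) (g : Z ⟶ W)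
    (e : Y ⟶ 𝟙_ C) :
    (f ⊗ₘ g) ≫ e ▷ W ≫ (λ_ W).hom = ((f ≫ e) ⊗ₘ g) ≫ (λ_ W).hom := by
  rw [tensorHom_def', tensorHom_def']
  monoidal

lemma scalar_exchange {X Y Z W : C} (e : X ⟶ 𝟙_ C) (f : Y ⊗ Z ⟶ W) :
    (e ▷ Y ≫ (λ_ Y).hom) ▷ Z ≫ f = (α_ X Y Z).hom ≫ X ◁ f ≫ e ▷ W ≫ (λ_ W).hom := by
  rw [whisker_exchange_assoc]
  monoidal

lemma scalar_tensor {X Y Z W V : C} (a : V ⟶ X ⊗ Y) (e : X ⟶ 𝟙_ C) (d : Y ⟶ 𝟙_ C)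
    (m : Z ⟶ W) : ((a ≫ (e ⊗ₘ d) ≫ (λ_ (𝟙_ C)).hom) ⊗ₘ m) ≫ (λ_ W).hom =
      a ▷ Z ≫ (α_ X Y Z).hom ≫ X ◁ ((d ⊗ₘ m) ≫ (λ_ W).hom) ≫ e ▷ W ≫ (λ_ W).hom := by
  have h : (e ⊗ₘ d) ≫ (λ_ (𝟙_ C)).hom = (X ◁ d ≫ (ρ_ X).hom) ≫ e := by
    rw [tensorHom_def']
    monoidal
  rw [h, ← Category.assoc a, ← tensor_scalar, MonoidalCategory.tensorHom_def,
    MonoidalCategory.tensorHom_def]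
  monoidal

lemma mul_eq : (Δ[H] ⊗ₘ Δ[H]) ≫ tensorμ H H H H ≫ ((mu H ≫ ε[H]) ⊗ₘ mu H) ≫ (λ_ H).hom =
    mu H := by
  have h := congrArg (fun t => t ≫ ε[H] ▷ H ≫ (λ_ H).hom)
    (WeakHopfQuasigroup.mul_comul (H := H))
  have h1 : (mu H ≫ Δ[H]) ≫ ε[H] ▷ H ≫ (λ_ H).hom = mu H := by simp
  refine Eq.trans ?_ (h.symm.trans h1)
  rw [← tensor_scalar]
  simp only [Category.assoc]

/-- `x ⊗ y ↦ ε(x y₁) y₂` -/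
def theta : H ⊗ H ⟶ H :=
  H ◁ Δ[H] ≫ (α_ H H H).inv ≫ (mu H ≫ ε[H]) ▷ H ≫ (λ_ H).hom

lemma mul_theta : H ◁ mu H ≫ theta H = (α_ H H H).inv ≫ theta H ▷ H ≫ mu H := by
  have hL : H ◁ mu H ≫ theta H = H ◁ (Δ[H] ⊗ₘ Δ[H]) ≫ H ◁ tensorμ H H H H ≫
      (α_ H (H ⊗ H) (H ⊗ H)).inv ≫ ((H ◁ mu H ≫ mu H ≫ ε[H]) ⊗ₘ mu H) ≫ (λ_ H).hom := by
    rw [theta, ← whiskerLeft_comp_assoc, WeakHopfQuasigroup.mul_comul,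
      ← Category.assoc (H ◁ mu H), ← tensor_scalar, ← tensorHom_comp_whiskerRight,
      MonoidalCategory.tensorHom_def (H ◁ mu H),
      MonoidalCategory.tensorHom_def (mu H) (mu H)]
    monoidal
  have hnat : Δ[H] ▷ H ▷ (H ⊗ H) ≫ tensorμ (H ⊗ H) H H H =
      tensorμ H H H H ≫ Δ[H] ▷ H ▷ (H ⊗ H) := by
    have h := tensorμ_natural_left Δ[H] (𝟙 H) H H
    simpa using h
  have hR : theta H ▷ H ≫ mu H = theta H ▷ H ≫ (Δ[H] ⊗ₘ Δ[H]) ≫ tensorμ H H H H ≫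
      ((mu H ≫ ε[H]) ⊗ₘ mu H) ≫ (λ_ H).hom := by
    rw [mul_eq]
  have hK : (Δ[H] ⊗ₘ Δ[H]) ≫ tensorμ H H H H ≫ Δ[H] ▷ H ▷ (H ⊗ H) =
      (Δ[H] ≫ H ◁ Δ[H]) ▷ H ≫ (H ⊗ (H ⊗ H)) ◁ Δ[H] ≫ (α_ H (H ⊗ H) (H ⊗ H)).hom ≫
        H ◁ tensorμ H H H H ≫ (α_ H (H ⊗ H) (H ⊗ H)).inv ≫ (α_ H H H).inv ▷ (H ⊗ H) := by
    rw [← hnat, tensorMu_head, ComonObj.comul_assoc, MonoidalCategory.tensorHom_def,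
      Category.assoc, whisker_exchange_assoc]
    monoidal
  have hM : H ◁ (Δ[H] ⊗ₘ Δ[H]) ≫ H ◁ tensorμ H H H H ≫ (α_ H (H ⊗ H) (H ⊗ H)).inv ≫
      ((α_ H H H).inv ≫ (H ◁ Δ[H]) ▷ H ≫ ungroup H H H H) ▷ (H ⊗ H) ≫ (α_ _ _ _).hom =
      (α_ H H H).inv ≫ (H ◁ Δ[H] ≫ (α_ H H H).inv) ▷ H ≫ (α_ _ _ _).hom ≫
      (H ⊗ H) ◁ ((Δ[H] ⊗ₘ Δ[H]) ≫ tensorμ H H H H) := by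
    have hK' := congrArg (fun t => H ◁ t ≫ (α_ H ((H ⊗ H) ⊗ H) (H ⊗ H)).inv ≫
      ((α_ H (H ⊗ H) H).inv ≫ ungroup H H H H) ▷ (H ⊗ H) ≫ (α_ _ _ _).hom) hK
    refine Eq.trans ?_ (hK'.trans ?_)
    · monoidal
    · rw [MonoidalCategory.tensorHom_def]
      monoidal
  have hA : (α_ H H H).inv ≫ (H ◁ Δ[H]) ▷ H ≫ ungroup H H H H ≫
      ((mu H ≫ ε[H]) ⊗ₘ (mu H ≫ ε[H])) ≫ (λ_ (𝟙_ C)).hom =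
      ((α_ H H H).inv ≫ (H ◁ Δ[H]) ▷ H ≫ ungroup H H H H) ≫
      ((mu H ≫ ε[H]) ⊗ₘ (mu H ≫ ε[H])) ≫ (λ_ (𝟙_ C)).hom := by
    simp only [Category.assoc]
  have hB : theta H ▷ H = (H ◁ Δ[H] ≫ (α_ H H H).inv) ▷ H ≫
      ((mu H ≫ ε[H]) ▷ H ≫ (λ_ H).hom) ▷ H := by
    rw [theta, ← comp_whiskerRight, Category.assoc]
  rw [hL, hR, counit_mul_mul, hA, scalar_tensor, hB, Category.assoc, scalar_exchange]
  have hM' := congrArg (fun t => t ≫ (H ⊗ H) ◁ (((mu H ≫ ε[H]) ⊗ₘ mu H) ≫ (λ_ H).hom) ≫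
    (mu H ≫ ε[H]) ▷ H ≫ (λ_ H).hom) hM
  refine Eq.trans ?_ (hM'.trans ?_)
  · simp only [Category.assoc]
  · simp only [Category.assoc, whiskerLeft_comp]

lemma barSource_mul : barSource H ▷ H ≫ mu H = theta H := by
  have h1 : barSource H = (ρ_ H).inv ≫ H ◁ un H ≫ theta H := by
    simp [barSource, theta]
  have h2 := congrArg (fun t => (α_ _ _ _).hom ≫ t) (mul_theta H)
  simp only [Iso.hom_inv_id_assoc] at h2
  rw [h1]
  simp only [comp_whiskerRight, Category.assoc]
  rw [← h2]
  rw [associator_naturality_middle_assoc, ← whiskerLeft_comp_assoc, UnitalMagmaObj.one_mul]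
  monoidal

end Target

/-! ### Right comodule magmas -/

/-- A right `H`-comodule magma `(A, ρ_A)`. Here `tensorμ A H A H` is `A ⊗ c ⊗ H`, and the last
axiom is `(A ⊗ Π^L) ∘ ρ_A ∘ η_A = ρ_A ∘ η_A`. -/
class RightComoduleMagma (H A : C) [WeakHopfQuasigroup H] [UnitalMagmaObj A] where
  /-- the coaction `ρ_A` -/
  coact : A ⟶ A ⊗ H
  coact_counit : coact ≫ A ◁ ε[H] = (ρ_ A).inv
  coact_coassoc : coact ≫ coact ▷ H ≫ (α_ A H H).hom = coact ≫ A ◁ Δ[H]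
  mul_coact : mu A ≫ coact = (coact ⊗ₘ coact) ≫ tensorμ A H A H ≫ (mu A ⊗ₘ mu H)
  unit_coact : un A ≫ coact ≫ A ◁ target H = un A ≫ coact

section Coinvariants

variable (H A : C) [WeakHopfQuasigroup H] [UnitalMagmaObj A] [RightComoduleMagma H A]

/-- The coaction `ρ_A : A ⟶ A ⊗ H`. -/
abbrev rho : A ⟶ A ⊗ H := RightComoduleMagma.coact

/-- The morphism `∇_A = μ_{A ⊗ H} ∘ (A ⊗ H ⊗ (ρ_A ∘ η_A))`. -/
def nabla : A ⊗ H ⟶ A ⊗ H :=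
  (ρ_ (A ⊗ H)).inv ≫ (A ⊗ H) ◁ (un A ≫ rho H A) ≫ tensorμ A H A H ≫ (mu A ⊗ₘ mu H)

variable [HasEqualizers C]

/-- The coinvariants `A^{co H}`: the equalizer of `ρ_A` and `(A ⊗ Π^L) ∘ ρ_A`. -/
def coinv : C := equalizer (rho H A) (rho H A ≫ A ◁ target H)

/-- The inclusion `i_A : A^{co H} ⟶ A`. -/
def incl : coinv H A ⟶ A := equalizer.ι (rho H A) (rho H A ≫ A ◁ target H)

instance : Mono (incl H A) := equalizer.ι_mono

lemma incl_rho : incl H A ≫ rho H A = incl H A ≫ rho H A ≫ A ◁ target H :=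
  equalizer.condition _ _

lemma incl_rho_bar : incl H A ≫ rho H A ≫ A ◁ barSource H = incl H A ≫ rho H A := by
  rw [← Category.assoc, incl_rho, Category.assoc, Category.assoc, ← whiskerLeft_comp,
    target_barSource]

lemma mu_eq : rho H A ▷ A ≫ (A ⊗ H) ◁ rho H A ≫ tensorμ A H A H ≫
    (A ⊗ A) ◁ (mu H ≫ ε[H]) ≫ (ρ_ (A ⊗ A)).hom ≫ mu A = mu A := by
  have h := congrArg (fun t => t ≫ A ◁ ε[H] ≫ (ρ_ A).hom)
    (RightComoduleMagma.mul_coact (H := H) (A := A))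
  have h1 : (mu A ≫ rho H A) ≫ A ◁ ε[H] ≫ (ρ_ A).hom = mu A := by
    rw [Category.assoc, reassoc_of% RightComoduleMagma.coact_counit (H := H) (A := A)]
    simp
  refine Eq.trans ?_ (h.symm.trans h1)
  rw [MonoidalCategory.tensorHom_def, tensorHom_def']
  have hx : mu A ▷ H ≫ A ◁ ε[H] = (A ⊗ A) ◁ ε[H] ≫ mu A ▷ 𝟙_ C := (whisker_exchange _ _).symm
  simp only [Category.assoc]
  rw [reassoc_of% hx]
  dsimp only [rho]
  monoidal

/-- `ρ_A ∘ μ_A ∘ (i_A ⊗ A) = (μ_A ⊗ H) ∘ (i_A ⊗ ρ_A)` -/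
lemma incl_mul_rho : incl H A ▷ A ≫ mu A ≫ rho H A =
    coinv H A ◁ rho H A ≫ (α_ _ _ _).inv ≫ (incl H A ▷ A ≫ mu A) ▷ H := by
  have hnat : (A ◁ barSource H) ▷ (A ⊗ H) ≫ tensorμ A H A H =
      tensorμ A H A H ≫ (A ⊗ A) ◁ (barSource H ▷ H) := by
    simpa using tensorμ_natural_left (𝟙 A) (barSource H) A H
  have hnat2 : tensorμ A H A H ≫ (A ⊗ A) ◁ (H ◁ Δ[H]) =
      (A ⊗ H) ◁ (A ◁ Δ[H]) ≫ tensorμ A H A (H ⊗ H) := by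
    simpa using (tensorμ_natural_right A H (𝟙 A) Δ[H]).symm
  have h1 : incl H A ▷ A ≫ mu A ≫ rho H A = incl H A ▷ A ≫ rho H A ▷ A ≫ (A ⊗ H) ◁ rho H A ≫
      tensorμ A H A H ≫ (A ⊗ A) ◁ theta H ≫ mu A ▷ H := by
    rw [RightComoduleMagma.mul_coact, MonoidalCategory.tensorHom_def, tensorHom_def',
      Category.assoc, ← comp_whiskerRight_assoc, ← incl_rho_bar]
    simp only [comp_whiskerRight, Category.assoc]
    rw [← whisker_exchange_assoc, reassoc_of% hnat, ← whiskerLeft_comp_assoc, barSource_mul]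
  have h2 : (A ⊗ H) ◁ rho H A ≫ tensorμ A H A H ≫ (A ⊗ A) ◁ theta H ≫ mu A ▷ H =
      (A ⊗ H) ◁ rho H A ≫ (α_ _ _ _).inv ≫ ((A ⊗ H) ◁ rho H A ≫ tensorμ A H A H ≫
        (A ⊗ A) ◁ (mu H ≫ ε[H]) ≫ (ρ_ (A ⊗ A)).hom ≫ mu A) ▷ H := by
    rw [theta, whiskerLeft_comp, Category.assoc, reassoc_of% hnat2, whiskerLeft_comp,
      Category.assoc, reassoc_of% tensorMu_tail, ← whiskerLeft_comp_assoc,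
      ← RightComoduleMagma.coact_coassoc]
    monoidal
  have e1 : rho H A ▷ A ≫ (A ⊗ H) ◁ rho H A = A ◁ rho H A ≫ rho H A ▷ (A ⊗ H) :=
    (whisker_exchange _ _).symm
  have e2 : incl H A ▷ A ≫ A ◁ rho H A = coinv H A ◁ rho H A ≫ incl H A ▷ (A ⊗ H) :=
    (whisker_exchange _ _).symm
  rw [h1, h2, reassoc_of% e1, reassoc_of% e2]
  conv_rhs => rw [← mu_eq H A]
  monoidal

/-- The unit of `A^{co H}`: the factorization of `η_A` through `i_A`. -/
def coinvUnit : 𝟙_ C ⟶ coinv H A :=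
  equalizer.lift (un A) RightComoduleMagma.unit_coact.symm

/-- The product of `A^{co H}`: the factorization of `μ_A ∘ (i_A ⊗ i_A)` through `i_A`. -/
def coinvMul : coinv H A ⊗ coinv H A ⟶ coinv H A :=
  equalizer.lift ((incl H A ⊗ₘ incl H A) ≫ mu A) (by
    have h : ((incl H A ⊗ₘ incl H A) ≫ mu A) ≫ rho H A =
        coinv H A ◁ (incl H A ≫ rho H A) ≫ (α_ _ _ _).inv ≫ (incl H A ▷ A ≫ mu A) ▷ H := by
      rw [tensorHom_def', Category.assoc, Category.assoc, incl_mul_rho, whiskerLeft_comp,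
        Category.assoc]
    rw [← Category.assoc, h]
    have e : coinv H A ◁ (A ◁ target H) ≫ (α_ _ _ _).inv ≫ (incl H A ▷ A ≫ mu A) ▷ H =
        (α_ _ _ _).inv ≫ (incl H A ▷ A ≫ mu A) ▷ H ≫ A ◁ target H := by
      rw [← whisker_exchange]
      monoidal
    simp only [Category.assoc]
    rw [← e, ← whiskerLeft_comp_assoc, Category.assoc, ← incl_rho])

/-- `μ_A ∘ (A ⊗ (μ_A ∘ (i_A ⊗ A))) = μ_A ∘ ((μ_A ∘ (A ⊗ i_A)) ⊗ A)`, i.e. `a(xb) = (ax)b` for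
`x` coinvariant. -/
def AssocMiddle : Prop :=
  A ◁ (incl H A ▷ A ≫ mu A) ≫ mu A =
    (α_ A (coinv H A) A).inv ≫ (A ◁ incl H A ≫ mu A) ▷ A ≫ mu A

/-- `μ_A ∘ (A ⊗ (μ_A ∘ (A ⊗ i_A))) = μ_A ∘ (μ_A ⊗ i_A)`, i.e. `a(bx) = (ab)x` for `x`
coinvariant. -/
def AssocRight : Prop :=
  A ◁ (A ◁ incl H A ≫ mu A) ≫ mu A = (α_ A A (coinv H A)).inv ≫ (mu A ⊗ₘ incl H A) ≫ mu A

variable [HasCoequalizers C]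

/-- The object `A ⊗_{A^{co H}} A`. -/
def relTensor : C :=
  coequalizer ((A ◁ incl H A ≫ mu A) ▷ A)
    ((α_ A (coinv H A) A).hom ≫ A ◁ (incl H A ▷ A ≫ mu A))

/-- The projection `n_A : A ⊗ A ⟶ A ⊗_{A^{co H}} A`. -/
def relProj : A ⊗ A ⟶ relTensor H A := coequalizer.π _ _

lemma relProj_condition : (A ◁ incl H A ≫ mu A) ▷ A ≫ relProj H A =
    (α_ A (coinv H A) A).hom ≫ A ◁ (incl H A ▷ A ≫ mu A) ≫ relProj H A :=
  (coequalizer.condition _ _).trans (Category.assoc _ _ _)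

variable {H A}

/-- The canonical morphism `γ_A : A ⊗_{A^{co H}} A ⟶ A □ H`: the factorization through `n_A` of
`p ∘ (μ_A ⊗ H) ∘ (A ⊗ ρ_A)`, where `(A □ H, i, p)` is a splitting `S` of `∇_A`. -/
def gamma (hm : AssocMiddle H A) (S : Splitting (nabla H A)) : relTensor H A ⟶ S.obj :=
  coequalizer.desc (A ◁ rho H A ≫ (α_ A A H).inv ≫ mu A ▷ H ≫ S.p) (by
    have h1 : A ◁ (incl H A ▷ A ≫ mu A) ≫ A ◁ rho H A =
        A ◁ (coinv H A ◁ rho H A ≫ (α_ _ _ _).inv ≫ (incl H A ▷ A ≫ mu A) ▷ H) := by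
      rw [← whiskerLeft_comp, Category.assoc, incl_mul_rho]
    have h2 := congrArg (fun t => (α_ A (coinv H A) A).hom ▷ H ≫ t ▷ H) hm
    have e : (A ◁ incl H A ≫ mu A) ▷ A ≫ A ◁ rho H A =
        (A ⊗ coinv H A) ◁ rho H A ≫ (A ◁ incl H A ≫ mu A) ▷ (A ⊗ H) :=
      (whisker_exchange _ _).symm
    rw [reassoc_of% e, Category.assoc, reassoc_of% h1]
    have h3 := congrArg (fun t => (A ⊗ coinv H A) ◁ rho H A ≫ (α_ _ _ _).inv ≫ t ≫ S.p) h2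
    refine Eq.trans ?_ (h3.symm.trans ?_) <;> monoidal)

/-- The action `φ : A ⊗ (A ⊗_{A^{co H}} A) ⟶ A ⊗_{A^{co H}} A`: the factorization of
`n_A ∘ (μ_A ⊗ A)` through the coequalizer `A ⊗ n_A`. -/
def relAct [PreservesColimitsOfShape WalkingParallelPair (tensorLeft A)]
    (hr : AssocRight H A) : A ⊗ relTensor H A ⟶ relTensor H A :=
  Cofork.IsColimit.desc (isColimitOfHasCoequalizerOfPreservesColimit (tensorLeft A)
    ((A ◁ incl H A ≫ mu A) ▷ A) ((α_ A (coinv H A) A).hom ≫ A ◁ (incl H A ▷ A ≫ mu A)))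
    ((α_ A A A).inv ≫ mu A ▷ A ≫ relProj H A) (by
      have hr' : A ◁ (A ◁ incl H A ≫ mu A) ≫ mu A =
          (α_ A A (coinv H A)).inv ≫ (mu A ⊗ₘ incl H A) ≫ mu A := hr
      have h2 := congrArg (fun t => (α_ A (A ⊗ coinv H A) A).inv ≫ t ▷ A ≫ relProj H A) hr'
      have h3 := congrArg (fun t => (α_ A (A ⊗ coinv H A) A).inv ≫
        (α_ A A (coinv H A)).inv ▷ A ≫ (mu A ▷ coinv H A) ▷ A ≫ t) (relProj_condition H A)
      have e : (A ⊗ A) ◁ (incl H A ▷ A ≫ mu A) ≫ mu A ▷ A =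
          mu A ▷ (coinv H A ⊗ A) ≫ A ◁ (incl H A ▷ A ≫ mu A) := whisker_exchange _ _
      change A ◁ ((A ◁ incl H A ≫ mu A) ▷ A) ≫ (α_ A A A).inv ≫ mu A ▷ A ≫ relProj H A =
        A ◁ ((α_ A (coinv H A) A).hom ≫ A ◁ (incl H A ▷ A ≫ mu A)) ≫
          (α_ A A A).inv ≫ mu A ▷ A ≫ relProj H A
      refine Eq.trans ?_ (h2.trans (Eq.trans ?_ (h3.trans ?_)))
      · monoidal
      · rw [MonoidalCategory.tensorHom_def]
        monoidal
      · have h4 := congrArg (fun t => A ◁ (α_ A (coinv H A) A).hom ≫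
          (α_ A A (coinv H A ⊗ A)).inv ≫ t ≫ relProj H A) e
        refine Eq.trans ?_ (h4.symm.trans ?_) <;> monoidal)

lemma proj_relAct [PreservesColimitsOfShape WalkingParallelPair (tensorLeft A)]
    (hr : AssocRight H A) :
    A ◁ relProj H A ≫ relAct hr = (α_ A A A).inv ≫ mu A ▷ A ≫ relProj H A :=
  Cofork.IsColimit.π_desc' (isColimitOfHasCoequalizerOfPreservesColimit (tensorLeft A)
    ((A ◁ incl H A ≫ mu A) ▷ A) ((α_ A (coinv H A) A).hom ≫ A ◁ (incl H A ▷ A ≫ mu A))) _ _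

lemma proj_gamma (hm : AssocMiddle H A) (S : Splitting (nabla H A)) :
    relProj H A ≫ gamma hm S = A ◁ rho H A ≫ (α_ A A H).inv ≫ mu A ▷ H ≫ S.p :=
  coequalizer.π_desc _ _

/-! ### Galois extensions, normal bases and cleft extensions -/

/-- `A^{co H} ↪ A` is a weak `H`-Galois extension: `γ_A` is an isomorphism. -/
def IsWeakGalois (hm : AssocMiddle H A) (S : Splitting (nabla H A)) : Prop :=
  IsIso (gamma hm S)

/-- The inverse of `γ_A` is almost lineal:
`γ_A⁻¹ ∘ p = φ ∘ (A ⊗ (γ_A⁻¹ ∘ p ∘ (η_A ⊗ H)))`. -/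
def InverseAlmostLineal [PreservesColimitsOfShape WalkingParallelPair (tensorLeft A)]
    (hm : AssocMiddle H A) (hr : AssocRight H A) (S : Splitting (nabla H A))
    (hG : IsWeakGalois hm S) : Prop :=
  haveI : IsIso (gamma hm S) := hG
  S.p ≫ inv (gamma hm S) =
    A ◁ ((λ_ H).inv ≫ un A ▷ H ≫ S.p ≫ inv (gamma hm S)) ≫ relAct hr

variable (H A)

/-- The left `A^{co H}`-action on `A`. -/
def actA : coinv H A ⊗ A ⟶ A := incl H A ▷ A ≫ mu A

/-- The left `A^{co H}`-action `μ_{A^{co H}} ⊗ H` on `A^{co H} ⊗ H`. -/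
def actFree : coinv H A ⊗ (coinv H A ⊗ H) ⟶ coinv H A ⊗ H :=
  (α_ (coinv H A) (coinv H A) H).inv ≫ coinvMul H A ▷ H

/-- The right `H`-coaction `A^{co H} ⊗ δ_H` on `A^{co H} ⊗ H`. -/
def coactFree : coinv H A ⊗ H ⟶ (coinv H A ⊗ H) ⊗ H :=
  coinv H A ◁ Δ[H] ≫ (α_ (coinv H A) H H).inv

/-- The normal basis property: there are an idempotent `Ω` of `A^{co H} ⊗ H`, left
`A^{co H}`-linear and right `H`-colinear, with image `(A^{co H} × H, s, r)`, and an isomorphism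
`b : A ≅ A^{co H} × H`, left `A^{co H}`-linear and right `H`-colinear for the structures on the
image induced by those of `A^{co H} ⊗ H`. -/
def HasNormalBasis : Prop :=
  ∃ Ω : coinv H A ⊗ H ⟶ coinv H A ⊗ H,
    Ω ≫ Ω = Ω ∧
    actFree H A ≫ Ω = coinv H A ◁ Ω ≫ actFree H A ∧
    Ω ≫ coactFree H A = coactFree H A ≫ Ω ▷ H ∧
    ∃ (T : Splitting Ω) (b : A ≅ T.obj),
      actA H A ≫ b.hom = coinv H A ◁ b.hom ≫ (coinv H A ◁ T.i ≫ actFree H A ≫ T.p) ∧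
      b.hom ≫ (T.i ≫ coactFree H A ≫ T.p ▷ H) = rho H A ≫ b.hom ▷ H

/-- `A^{co H} ↪ A` is a weak `H`-cleft extension, with cleaving morphism `h` and `k = h⁻¹`. -/
def IsWeakCleft : Prop :=
  ∃ h k : H ⟶ A,
    h ≫ rho H A = Δ[H] ≫ h ▷ H ∧
    conv k h = (ρ_ H).inv ≫ H ◁ (un A ≫ rho H A) ≫ (α_ H A H).inv ≫ (β_ H A).hom ▷ H ≫
      (α_ A H H).hom ≫ A ◁ (mu H ≫ ε[H]) ≫ (ρ_ A).hom ∧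
    Δ[H] ≫ H ◁ (k ≫ rho H A) ≫ (α_ H A H).inv ≫ (β_ H A).hom ▷ H ≫ (α_ A H H).hom ≫
      A ◁ mu H = k ≫ rho H A ≫ A ◁ barSource H ∧
    A ◁ Δ[H] ≫ (α_ A H H).inv ≫ (A ◁ k ⊗ₘ h) ≫ mu A ▷ A ≫ mu A = A ◁ conv k h ≫ mu A ∧
    A ◁ Δ[H] ≫ (α_ A H H).inv ≫ (A ◁ h ⊗ₘ k) ≫ mu A ▷ A ≫ mu A = A ◁ conv h k ≫ mu A

end Coinvariants

end WeakHopfQuasi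

end

open WeakHopfQuasi

/-! Notation: δ(x) = x₁ ⊗ x₂, ρ(a) = a₀ ⊗ a₁, can(a ⊗ b) = a b₀ ⊗ b₁, B = A^coH, Π = Π^L, Π̄ for
`barSource`, and u(x) = 1₀ ε(x 1₁) for the right-hand side of (c1), called `cleftUnit`.

Neither H nor A is associative, and two identities take the place of associativity. In H, products
rebracket around the image of Π (`eq_mul_tgt_mul`). In A, (a b₀) u(b₁) = a b (`eq_mul_clu`). Since
∇(a ⊗ x) = a u(x₁) ⊗ x₂, the second identity gives ∇ ∘ can = can, and with `eq_clu_clu` the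
idempotence of ∇.

Cleft implies Galois. By (c2) the element a₀ k(a₁) is coinvariant and so defines q : A → B; by (c3),
q(a₀) h(a₁) = a. The maps a ↦ q(a₀) ⊗ a₁ and c ⊗ x ↦ c h(x) therefore make A a linear and colinear
retract of B ⊗ H, which is a normal basis. The identity (a b₀) k(b₁) = a q(b) (`eq_can_snd`) shows
that a ⊗ x ↦ a k(x₁) ⊗ h(x₂) induces the inverse of γ. This formula is the multiple by a of its
value at 1 ⊗ x, whence almost lineality.

Galois implies cleft. A normal basis gives a section s and a retraction r between A and B ⊗ H; put q
= (B ⊗ ε) s and h = r(1 ⊗ -). By linearity of q, a ⊗ b ↦ a q(b) descends to m on the relative tensor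
product, and k(x) = m γ⁻¹ p(1 ⊗ x). Almost lineality yields m γ⁻¹ p(a ⊗ x) = a k(x), hence again (a
b₀) k(b₁) = a q(b). Morphisms out of A ⊗ H that absorb ∇ are determined by their composites with can
(`nabla_ext`). In this way one proves (c3), whose case a = 1 is (c1), and two formulas for ρ(a
k(x)), whose cases a = 1 combine to (c2). Condition (c4) follows from colinearity of h.

The diagrammatic computations take place in a category that is not strict, so they are carried out
on straight-line programs with named wires. Coherence (`Can.unique`) gives a program at most one
meaning (`Sem.unique`); independent steps commute (`Sem.swap`), wires may be renamed (`Sem.rename`),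
and an identity may be applied inside a larger program (`imp_rule`). All side conditions of such a
rewriting are decidable. -/

open CategoryTheory MonoidalCategory Limits
open scoped ComonObj

set_option linter.unusedSectionVars false

noncomputable section

namespace WirePrograms

universe v u

/-! ### Canonical permutations of named wires: coherence. -/

section

variable {C : Type u} [Category.{v} C] [MonoidalCategory C]

/-- The tensor product of the objects named by a list. -/
def ten {τ : Type} (ty : τ → C) : List τ → C
  | [] => 𝟙_ C
  | t :: L => ty t ⊗ ten ty L

/-- A wire: its type and its name. -/
abbrev Wire (τ : Type) := τ × ℕ

variable {τ : Type} (ty : τ → C)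

/-- The tensor product of the types of a list of wires. -/
abbrev tw (L : List (Wire τ)) : C := ten ty (L.map Prod.fst)

/-- The constraint `T (I ++ R) ≅ T I ⊗ T R`. -/
def spl : (I R : List (Wire τ)) → (tw ty (I ++ R) ≅ tw ty I ⊗ tw ty R)
  | [], R => (λ_ (tw ty R)).symm
  | w :: I, R => whiskerLeftIso (ty w.1) (spl I R) ≪≫ (α_ (ty w.1) (tw ty I) (tw ty R)).symm

lemma spl_nil (R : List (Wire τ)) : spl ty [] R = (λ_ (tw ty R)).symm := rfl

lemma spl_cons (w : Wire τ) (I R : List (Wire τ)) : spl ty (w :: I) R =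
    whiskerLeftIso (ty w.1) (spl ty I R) ≪≫ (α_ (ty w.1) (tw ty I) (tw ty R)).symm := rfl

/-- The reassociation `T ((I ++ J) ++ R) ⟶ T (I ++ (J ++ R))`. -/
def reassocTw (I J R : List (Wire τ)) : tw ty ((I ++ J) ++ R) ⟶ tw ty (I ++ (J ++ R)) :=
  (spl ty (I ++ J) R).hom ≫ (spl ty I J).hom ▷ tw ty R ≫ (α_ _ _ _).hom ≫
    tw ty I ◁ (spl ty J R).inv ≫ (spl ty I (J ++ R)).inv

lemma reassocTw_nil (J R : List (Wire τ)) : reassocTw ty [] J R = 𝟙 (tw ty (J ++ R)) := by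
  simp only [reassocTw, spl_nil]
  change (spl ty J R).hom ≫ (λ_ _).inv ▷ _ ≫ (α_ _ _ _).hom ≫ (𝟙_ C) ◁ (spl ty J R).inv ≫
    (λ_ _).hom = 𝟙 (tw ty (J ++ R))
  simp

lemma reassocTw_cons (w : Wire τ) (I J R : List (Wire τ)) :
    reassocTw ty (w :: I) J R = ty w.1 ◁ reassocTw ty I J R := by
  simp only [reassocTw, spl_cons]
  change (ty w.1 ◁ (spl ty (I ++ J) R).hom ≫ (α_ _ _ _).inv) ≫
    (ty w.1 ◁ (spl ty I J).hom ≫ (α_ _ _ _).inv) ▷ _ ≫ (α_ _ _ _).hom ≫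
    (ty w.1 ⊗ tw ty I) ◁ (spl ty J R).inv ≫
      ((α_ _ _ _).hom ≫ ty w.1 ◁ (spl ty I (J ++ R)).inv) = _
  simp only [MonoidalCategory.whiskerLeft_comp]
  monoidal

variable [SymmetricCategory C]

/-- The transposition `X ⊗ (Y ⊗ Z) ⟶ Y ⊗ (X ⊗ Z)`. -/
def swp (X Y Z : C) : X ⊗ (Y ⊗ Z) ⟶ Y ⊗ (X ⊗ Z) :=
  (α_ X Y Z).inv ≫ (β_ X Y).hom ▷ Z ≫ (α_ Y X Z).hom

lemma swp_swp (X Y Z : C) : swp X Y Z ≫ swp Y X Z = 𝟙 _ := by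
  simp only [swp, Category.assoc, Iso.hom_inv_id_assoc]
  rw [← comp_whiskerRight_assoc, SymmetricCategory.symmetry]
  simp

lemma swp_natural {X Y Z Z' : C} (f : Z ⟶ Z') :
    swp X Y Z ≫ Y ◁ X ◁ f = X ◁ Y ◁ f ≫ swp X Y Z' := by
  simp only [swp, Category.assoc]
  rw [← associator_naturality_right, ← whisker_exchange_assoc]
  simp

lemma swp_yang_baxter (X Y Z V : C) :
    swp X Y (Z ⊗ V) ≫ Y ◁ swp X Z V ≫ swp Y Z (X ⊗ V) =
      X ◁ swp Y Z V ≫ swp X Z (Y ⊗ V) ≫ Z ◁ swp X Y V := by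
  have h0 := BraidedCategory.yang_baxter X Y Z
  have h := congrArg (fun t => (α_ X Y (Z ⊗ V)).inv ≫ (α_ (X ⊗ Y) Z V).inv ≫
    (α_ X Y Z).hom ▷ V ≫ t ▷ V ≫
    (α_ Z (Y ⊗ X) V).hom ≫ Z ◁ (α_ Y X V).hom) h0
  simp only [swp]
  refine Eq.trans ?_ (h.trans ?_) <;> monoidal

/-- The case of `Ext.swap` in which both extracted wires have to pass the same wire W; the three
transpositions satisfy the Yang–Baxter equation. -/
lemma swp_tail {W Y Z L L₁ L₁' L₂ : C} {e : L ⟶ Y ⊗ L₁} {f : L₁ ⟶ Z ⊗ L₂} {e' : L ⟶ Z ⊗ L₁'}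
    {f' : L₁' ⟶ Y ⊗ L₂} (h : e ≫ Y ◁ f ≫ swp Y Z L₂ = e' ≫ Z ◁ f') :
    (W ◁ e ≫ swp W Y L₁) ≫ Y ◁ (W ◁ f ≫ swp W Z L₂) ≫ swp Y Z (W ⊗ L₂) =
      (W ◁ e' ≫ swp W Z L₁') ≫ Z ◁ (W ◁ f' ≫ swp W Y L₂) := by
  have h' := congrArg (fun t => W ◁ t ≫ swp W Z _ ≫ Z ◁ swp W Y _) h
  have n1 := swp_natural (X := W) (Y := Y) f
  have n2 := swp_natural (X := W) (Y := Z) f'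
  have yb := swp_yang_baxter W Y Z L₂
  simp only [MonoidalCategory.whiskerLeft_comp, Category.assoc] at h' ⊢
  rw [← yb, ← reassoc_of% n1, ← reassoc_of% n2] at h'
  exact h'

lemma swp_cons {Y Z L L₁ L₂ L₃ M N : C} {e₁ : L ⟶ Y ⊗ L₁} {f₁ : L₁ ⟶ M} {g : M ⟶ Z ⊗ N}
    {e₂ : L₁ ⟶ Z ⊗ L₂} {f₂ : L₂ ⟶ N} {e₃ : L ⟶ Z ⊗ L₃} {f₃ : L₃ ⟶ Y ⊗ L₂}
    (h : f₁ ≫ g = e₂ ≫ Z ◁ f₂) (h' : e₁ ≫ Y ◁ e₂ ≫ swp Y Z L₂ = e₃ ≫ Z ◁ f₃) :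
    (e₁ ≫ Y ◁ f₁) ≫ Y ◁ g ≫ swp Y Z N = e₃ ≫ Z ◁ (f₃ ≫ Y ◁ f₂) := by
  have n := swp_natural (X := Y) (Y := Z) f₂
  rw [MonoidalCategory.whiskerLeft_comp, ← reassoc_of% h', n, Category.assoc,
    ← whiskerLeft_comp_assoc, h]
  simp

lemma swp_append {Y Z L L' L'' R LR : C} (s : LR ⟶ L ⊗ R) (s' : L' ⊗ R ⟶ L'')
    (f : L ⟶ Z ⊗ L') :
    Y ◁ (s ≫ f ▷ R ≫ (α_ _ _ _).hom ≫ Z ◁ s') ≫ swp Y Z L'' =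
      (Y ◁ s ≫ (α_ _ _ _).inv) ≫ (Y ◁ f ≫ swp Y Z L') ▷ R ≫ (α_ _ _ _).hom ≫
        Z ◁ ((α_ _ _ _).hom ≫ Y ◁ s') := by
  have n := swp_natural (X := Y) (Y := Z) s'
  simp only [MonoidalCategory.whiskerLeft_comp, Category.assoc]
  rw [← n]
  simp only [swp]
  monoidal

lemma comp_append {Z L L' M R LR LR' MR : C} (s : LR ⟶ L ⊗ R) (s' : LR' ≅ L' ⊗ R)
    (s'' : M ⊗ R ⟶ MR) (e : L ⟶ Z ⊗ L') (f : L' ⟶ M) :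
    (s ≫ e ▷ R ≫ (α_ _ _ _).hom ≫ Z ◁ s'.inv) ≫ Z ◁ (s'.hom ≫ f ▷ R ≫ s'') =
      s ≫ (e ≫ Z ◁ f) ▷ R ≫ (α_ _ _ _).hom ≫ Z ◁ s'' := by
  simp

lemma swp_middle {W Z I R IR J : C} (s : J ⟶ I ⊗ (Z ⊗ R)) (s' : I ⊗ R ⟶ IR) :
    W ◁ (s ≫ swp I Z R ≫ Z ◁ s') ≫ swp W Z IR =
      (W ◁ s ≫ (α_ _ _ _).inv) ≫ swp (W ⊗ I) Z R ≫ Z ◁ ((α_ _ _ _).hom ≫ W ◁ s') := by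
  have n := swp_natural (X := W) (Y := Z) s'
  simp only [MonoidalCategory.whiskerLeft_comp, Category.assoc]
  rw [← n]
  simp only [swp, BraidedCategory.braiding_tensor_left_hom]
  monoidal

lemma swp_block_cons {I Z J R IJR JIR L JR IR : C} (s : L ⟶ I ⊗ (Z ⊗ JR)) (s' : IJR ≅ I ⊗ JR)
    (t : JR ⟶ J ⊗ R) (t' : I ⊗ R ⟶ IR) (t'' : J ⊗ IR ⟶ JIR) :
    (s ≫ swp I Z JR ≫ Z ◁ s'.inv) ≫ Z ◁ (s'.hom ≫ I ◁ t ≫ swp I J R ≫ J ◁ t' ≫ t'') =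
      s ≫ I ◁ (Z ◁ t ≫ (α_ _ _ _).inv) ≫ swp I (Z ⊗ J) R ≫ (Z ⊗ J) ◁ t' ≫
        (α_ _ _ _).hom ≫ Z ◁ t'' := by
  have n := swp_natural (X := I) (Y := Z) t
  simp only [MonoidalCategory.whiskerLeft_comp, Category.assoc]
  rw [← whiskerLeft_comp_assoc Z s'.inv, Iso.inv_hom_id, MonoidalCategory.whiskerLeft_id,
    Category.id_comp, reassoc_of% n]
  simp only [swp, BraidedCategory.braiding_tensor_right_hom]
  monoidal

lemma swp_unit_middle {I R IR : C} (s : IR ≅ I ⊗ R) :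
    s.hom ≫ I ◁ (λ_ R).inv ≫ swp I (𝟙_ C) R ≫ (𝟙_ C) ◁ s.inv ≫ (λ_ IR).hom = 𝟙 _ := by
  simp [swp, braiding_tensorUnit_right]

lemma swp_unit (Z R : C) : (λ_ (Z ⊗ R)).inv ≫ swp (𝟙_ C) Z R ≫ Z ◁ (λ_ R).hom = 𝟙 _ := by
  simp [swp, braiding_tensorUnit_left]

lemma braiding_unit_cons {W I J : C} (s : J ⟶ I ⊗ 𝟙_ C) :
    W ◁ (s ≫ (β_ I (𝟙_ C)).hom ≫ (λ_ I).hom) =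
      (W ◁ s ≫ (α_ _ _ _).inv) ≫ (β_ (W ⊗ I) (𝟙_ C)).hom ≫ (λ_ (W ⊗ I)).hom := by
  simp only [braiding_tensorUnit_right]
  monoidal

lemma braiding_cons {I J Z IJ JI L : C} (s : L ⟶ I ⊗ (Z ⊗ J)) (s' : IJ ≅ I ⊗ J)
    (s'' : J ⊗ I ⟶ JI) :
    (s ≫ swp I Z J ≫ Z ◁ s'.inv) ≫ Z ◁ (s'.hom ≫ (β_ I J).hom ≫ s'') =
      s ≫ (β_ I (Z ⊗ J)).hom ≫ (α_ _ _ _).hom ≫ Z ◁ s'' := by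
  simp only [swp, BraidedCategory.braiding_tensor_right_hom]
  simp

/-- Extraction of a wire from a list, as the canonical permutation morphism. -/
inductive Ext (z : Wire τ) : (L L' : List (Wire τ)) → (tw ty L ⟶ tw ty (z :: L')) → Prop
  | head (L : List (Wire τ)) : Ext z (z :: L) L (𝟙 _)
  | tail (y : Wire τ) (L L' : List (Wire τ)) (f : tw ty L ⟶ tw ty (z :: L')) (h : Ext z L L' f) :
      Ext z (y :: L) (y :: L')
        ((ty y.1 ◁ f ≫ swp (ty y.1) (ty z.1) (tw ty L') :
          ty y.1 ⊗ tw ty L ⟶ ty z.1 ⊗ (ty y.1 ⊗ tw ty L')))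

/-- `Can L M f`: the morphism `f` is a canonical permutation of wires from `L` to `M`. -/
inductive Can : (L M : List (Wire τ)) → (tw ty L ⟶ tw ty M) → Prop
  | nil : Can [] [] (𝟙 _)
  | cons (z : Wire τ) (L L' M : List (Wire τ)) (e : tw ty L ⟶ tw ty (z :: L'))
      (f : tw ty L' ⟶ tw ty M) (he : Ext ty z L L' e) (hf : Can L' M f) :
      Can L (z :: M) ((e : tw ty L ⟶ ty z.1 ⊗ tw ty L') ≫ ty z.1 ◁ f : tw ty L ⟶ ty z.1 ⊗ tw ty M)

variable {ty}

/-- Induction on the position of y. If y is first, nothing has to be moved. If z is first, two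
transpositions cancel by symmetry. If both lie behind a common wire, `swp_tail` moves that wire past
them. -/
lemma Ext.swap {y : Wire τ} {L L₁ : List (Wire τ)} {e : tw ty L ⟶ tw ty (y :: L₁)}
    (he : Ext ty y L L₁ e) : ∀ {z : Wire τ} {L₂ : List (Wire τ)} {f : tw ty L₁ ⟶ tw ty (z :: L₂)},
    Ext ty z L₁ L₂ f → ∃ (L₁' : List (Wire τ)) (e' : tw ty L ⟶ tw ty (z :: L₁'))
      (f' : tw ty L₁' ⟶ tw ty (y :: L₂)), Ext ty z L L₁' e' ∧ Ext ty y L₁' L₂ f' ∧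
      (e : tw ty L ⟶ ty y.1 ⊗ tw ty L₁) ≫ ty y.1 ◁ (f : tw ty L₁ ⟶ ty z.1 ⊗ tw ty L₂) ≫
        swp (ty y.1) (ty z.1) (tw ty L₂) =
      (e' : tw ty L ⟶ ty z.1 ⊗ tw ty L₁') ≫ ty z.1 ◁ (f' : tw ty L₁' ⟶ ty y.1 ⊗ tw ty L₂) := by
  induction he with
  | head L =>
    intro z L₂ f hf
    refine ⟨y :: L₂, _, 𝟙 _, Ext.tail y _ _ f hf, Ext.head _, ?_⟩
    erw [Category.id_comp, MonoidalCategory.whiskerLeft_id, Category.comp_id]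
    rfl
  | tail w L L₁ e he ih =>
    intro z L₂ f hf
    cases hf with
    | head =>
      refine ⟨L, 𝟙 _, e, Ext.head _, he, ?_⟩
      erw [MonoidalCategory.whiskerLeft_id, Category.id_comp, Category.id_comp, Category.assoc,
        swp_swp, Category.comp_id]
    | tail _ _ L₂ f hf =>
      obtain ⟨L₁', e', f', he', hf', h⟩ := ih hf
      exact ⟨w :: L₁', _, _, Ext.tail w _ _ _ he', Ext.tail w _ _ _ hf', swp_tail h⟩

/-- Prepares composition: an extraction made after a canonical permutation is carried out before it,
so that the composite again begins with an extraction, as the constructor `Can.cons` demands. -/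
lemma Can.ext {M M' : List (Wire τ)} {z : Wire τ} {g : tw ty M ⟶ tw ty (z :: M')}
    (hg : Ext ty z M M' g) : ∀ {L : List (Wire τ)} {f : tw ty L ⟶ tw ty M}, Can ty L M f →
    ∃ (L' : List (Wire τ)) (e : tw ty L ⟶ tw ty (z :: L')) (f' : tw ty L' ⟶ tw ty M'),
      Ext ty z L L' e ∧ Can ty L' M' f' ∧
      f ≫ g = (e : tw ty L ⟶ ty z.1 ⊗ tw ty L') ≫ ty z.1 ◁ f' := by
  induction hg with
  | head M =>
    intro L f hf
    cases hf with
    | cons _ _ L' _ e f he hf => exact ⟨L', e, f, he, hf, Category.comp_id _⟩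
  | tail y M M' g hg ih =>
    intro L f hf
    cases hf with
    | cons _ _ L₁ _ e₁ f₁ he₁ hf₁ =>
      obtain ⟨L₂, e₂, f₂, he₂, hf₂, h⟩ := ih hf₁
      obtain ⟨L₃, e₃, f₃, he₃, hf₃, h'⟩ := he₁.swap he₂
      exact ⟨L₃, e₃, _, he₃, Can.cons y _ _ _ _ _ hf₃ hf₂, swp_cons h h'⟩

theorem Can.comp {M N : List (Wire τ)} {g : tw ty M ⟶ tw ty N} (hg : Can ty M N g) :
    ∀ {L : List (Wire τ)} {f : tw ty L ⟶ tw ty M}, Can ty L M f → Can ty L N (f ≫ g) := by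
  induction hg with
  | nil => intro L f hf; simpa using hf
  | cons z M M' N e g he _ ih =>
    intro L f hf
    obtain ⟨L', e', f', he', hf', h⟩ := Can.ext he hf
    have h2 : f ≫ (e : tw ty M ⟶ ty z.1 ⊗ tw ty M') ≫ ty z.1 ◁ g =
        (e' : tw ty L ⟶ ty z.1 ⊗ tw ty L') ≫ ty z.1 ◁ (f' ≫ g) := by
      rw [MonoidalCategory.whiskerLeft_comp]
      exact ((Category.assoc _ _ _).symm.trans (congrArg (fun t => t ≫ ty z.1 ◁ g) h)).trans
        (Category.assoc _ _ _)
    exact h2 ▸ Can.cons z _ _ _ _ _ he' (ih hf')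

lemma Ext.mem {z : Wire τ} {L L' : List (Wire τ)} {f : tw ty L ⟶ tw ty (z :: L')}
    (h : Ext ty z L L' f) : L.Perm (z :: L') := by
  induction h with
  | head L => exact List.Perm.refl _
  | tail y L L' f h ih => exact (ih.cons y).trans (List.Perm.swap _ _ _)

lemma Can.perm {L M : List (Wire τ)} {f : tw ty L ⟶ tw ty M} (h : Can ty L M f) :
    L.Perm M := by
  induction h with
  | nil => exact List.Perm.refl _
  | cons z L L' M e f he _ ih => exact he.mem.trans (ih.cons z)

lemma Ext.unique {z : Wire τ} {L L₁ : List (Wire τ)} {e : tw ty L ⟶ tw ty (z :: L₁)}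
    (he : Ext ty z L L₁ e) : ∀ {L₂ : List (Wire τ)} {f : tw ty L ⟶ tw ty (z :: L₂)},
    Ext ty z L L₂ f → L.Nodup → L₁ = L₂ ∧ HEq e f := by
  induction he with
  | head L =>
    intro L₂ f hf hn
    cases hf with
    | head => exact ⟨rfl, HEq.rfl⟩
    | tail _ _ L₂ f hf =>
      exact absurd (hf.mem.symm.subset List.mem_cons_self) (List.nodup_cons.1 hn).1
  | tail y L L₁ e he ih =>
    intro L₂ f hf hn
    cases hf with
    | head => exact absurd (he.mem.symm.subset List.mem_cons_self) (List.nodup_cons.1 hn).1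
    | tail _ _ L₂ f hf =>
      obtain ⟨rfl, h⟩ := ih hf (List.nodup_cons.1 hn).2
      obtain rfl := eq_of_heq h
      exact ⟨rfl, HEq.rfl⟩

/-- Coherence in the form needed here. Distinctness of the names enters through `Ext.unique`: a wire
found at the head cannot be found again in the tail. With a repeated wire, the transposition of its
two copies would be a second canonical morphism. -/
theorem Can.unique {L M : List (Wire τ)} {f : tw ty L ⟶ tw ty M} (hf : Can ty L M f) :
    ∀ {g : tw ty L ⟶ tw ty M}, Can ty L M g → L.Nodup → f = g := by
  induction hf with
  | nil => intro g hg _; cases hg; rfl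
  | cons z L L' M e f he _ ih =>
    intro g hg hn
    cases hg with
    | cons _ _ L₂ _ e₂ f₂ he₂ hf₂ =>
      obtain ⟨rfl, h⟩ := he.unique he₂ hn
      obtain rfl := eq_of_heq h
      rw [ih hf₂ (List.nodup_cons.1 (he.mem.nodup_iff.1 hn)).2]

lemma Can.whisker {L M : List (Wire τ)} {f : tw ty L ⟶ tw ty M} (h : Can ty L M f)
    (w : Wire τ) : Can ty (w :: L) (w :: M) (ty w.1 ◁ f : ty w.1 ⊗ _ ⟶ ty w.1 ⊗ _) := by
  have := Can.cons w _ _ _ _ _ (Ext.head L) h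
  erw [Category.id_comp] at this
  exact this

lemma Can.refl (L : List (Wire τ)) : Can ty L L (𝟙 _) := by
  induction L with
  | nil => exact Can.nil
  | cons w L ih =>
    have := ih.whisker w
    rw [MonoidalCategory.whiskerLeft_id] at this
    exact this

lemma exists_can {L M : List (Wire τ)} (h : L.Perm M) : ∃ f, Can ty L M f := by
  induction h with
  | nil => exact ⟨_, Can.nil⟩
  | cons x _ ih => exact ih.imp' _ fun _ h => h.whisker x
  | swap x y L => exact ⟨_, Can.cons x _ _ _ _ _ (Ext.tail y _ _ _ (Ext.head L)) (Can.refl _)⟩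
  | trans _ _ ih₁ ih₂ =>
    obtain ⟨f, hf⟩ := ih₁
    obtain ⟨g, hg⟩ := ih₂
    exact ⟨_, hg.comp hf⟩

lemma Can.whiskerList {L M : List (Wire τ)} {f : tw ty L ⟶ tw ty M} (h : Can ty L M f)
    (I : List (Wire τ)) : Can ty (I ++ L) (I ++ M)
      ((spl ty I L).hom ≫ tw ty I ◁ f ≫ (spl ty I M).inv) := by
  induction I with
  | nil =>
    have e : (spl ty [] L).hom ≫ tw ty [] ◁ f ≫ (spl ty [] M).inv = f := by
      change (λ_ _).inv ≫ 𝟙_ C ◁ f ≫ (λ_ _).hom = f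
      simp
    rw [e]; exact h
  | cons w I ih =>
    have e : (spl ty (w :: I) L).hom ≫ tw ty (w :: I) ◁ f ≫ (spl ty (w :: I) M).inv =
        ty w.1 ◁ ((spl ty I L).hom ≫ tw ty I ◁ f ≫ (spl ty I M).inv) := by
      change (ty w.1 ◁ (spl ty I L).hom ≫ (α_ _ _ _).inv) ≫ (ty w.1 ⊗ tw ty I) ◁ f ≫
        (α_ _ _ _).hom ≫ ty w.1 ◁ (spl ty I M).inv = _
      simp
    rw [e]; exact ih.whisker w

lemma Ext.append {z : Wire τ} {L L' : List (Wire τ)} {f : tw ty L ⟶ tw ty (z :: L')}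
    (h : Ext ty z L L' f) (R : List (Wire τ)) : Ext ty z (L ++ R) (L' ++ R)
      ((spl ty L R).hom ≫ f ▷ tw ty R ≫ (spl ty (z :: L') R).inv) := by
  induction h with
  | head L =>
    rw [id_whiskerRight, Category.id_comp, Iso.hom_inv_id]
    exact Ext.head _
  | tail y L L' f _ ih =>
    have := Ext.tail y _ _ _ ih
    refine cast ?_ this
    congr 1
    exact swp_append (spl ty L R).hom (spl ty L' R).inv f

lemma Can.append {L M : List (Wire τ)} {f : tw ty L ⟶ tw ty M} (h : Can ty L M f)
    (R : List (Wire τ)) : Can ty (L ++ R) (M ++ R)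
      ((spl ty L R).hom ≫ f ▷ tw ty R ≫ (spl ty M R).inv) := by
  induction h with
  | nil =>
    rw [id_whiskerRight, Category.id_comp, Iso.hom_inv_id]
    exact Can.refl _
  | cons z L L' M e f he _ ih =>
    have := Can.cons z _ _ _ _ _ (he.append R) ih
    refine cast ?_ this
    congr 1
    exact comp_append (spl ty L R).hom (spl ty L' R) (spl ty M R).inv e f

lemma can_reassocTw (I J R : List (Wire τ)) :
    Can ty ((I ++ J) ++ R) (I ++ (J ++ R)) (reassocTw ty I J R) := by
  induction I with
  | nil => rw [reassocTw_nil]; exact Can.refl _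
  | cons w I ih => rw [reassocTw_cons]; exact ih.whisker w

lemma ext_middle (z : Wire τ) (I R : List (Wire τ)) : Ext ty z (I ++ z :: R) (I ++ R)
    ((spl ty I (z :: R)).hom ≫ swp (tw ty I) (ty z.1) (tw ty R) ≫
      ty z.1 ◁ (spl ty I R).inv) := by
  induction I with
  | nil =>
    refine cast ?_ (Ext.head (ty := ty) (z := z) R)
    congr 1
    exact (swp_unit (ty z.1) (tw ty R)).symm
  | cons w I ih =>
    refine cast ?_ (Ext.tail w _ _ _ ih)
    congr 1
    exact swp_middle (spl ty I (z :: R)).hom (spl ty I R).inv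

/-- By the hexagon axiom, braiding I past J extracts the wires of J one at a time through I.
Together with `can_reassocTw` this makes braidings and associators invisible to programs. -/
lemma can_braid (I J : List (Wire τ)) : Can ty (I ++ J) (J ++ I)
    ((spl ty I J).hom ≫ (β_ _ _).hom ≫ (spl ty J I).inv) := by
  induction J with
  | nil =>
    induction I with
    | nil =>
      refine cast ?_ (Can.nil (ty := ty))
      congr 1
      change 𝟙 _ = (λ_ (𝟙_ C)).inv ≫ (β_ (𝟙_ C) (𝟙_ C)).hom ≫ (λ_ (𝟙_ C)).hom
      rw [braiding_tensorUnit_left]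
      simp only [Category.assoc, Iso.inv_hom_id_assoc]
      rw [unitors_equal, Iso.inv_hom_id]
    | cons w I ih =>
      refine cast ?_ (ih.whisker w)
      congr 1
      exact braiding_unit_cons (spl ty I []).hom
  | cons z J ih =>
    refine cast ?_ (Can.cons z _ _ _ _ _ (ext_middle z I J) ih)
    congr 1
    exact braiding_cons (spl ty I (z :: J)).hom (spl ty I J) (spl ty J I).inv

/-- The transposition of two blocks of wires. -/
def blockSwap (ty : τ → C) (I J R : List (Wire τ)) :
    tw ty (I ++ (J ++ R)) ⟶ tw ty (J ++ (I ++ R)) :=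
  (spl ty I (J ++ R)).hom ≫ tw ty I ◁ (spl ty J R).hom ≫ swp _ _ _ ≫
    tw ty J ◁ (spl ty I R).inv ≫ (spl ty J (I ++ R)).inv

lemma can_blockSwap (I J R : List (Wire τ)) :
    Can ty (I ++ (J ++ R)) (J ++ (I ++ R)) (blockSwap ty I J R) := by
  induction J with
  | nil =>
    refine cast ?_ (Can.refl (ty := ty) (I ++ R))
    congr 1
    exact (swp_unit_middle (spl ty I R)).symm
  | cons z J ih =>
    refine cast ?_ (Can.cons z _ _ _ _ _ (ext_middle z I (J ++ R)) ih)
    congr 1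
    exact swp_block_cons (spl ty I (z :: (J ++ R))).hom (spl ty I (J ++ R)) (spl ty J R).hom
      (spl ty I R).inv (spl ty J (I ++ R)).inv

end

/-! ### Programs and their meaning. -/

section

variable {C : Type u} [Category.{v} C] [MonoidalCategory C] [SymmetricCategory C]

/-- One application of an operation to the wires `ins`, with results named `outs`. -/
structure Step (τ κ : Type) where
  op : κ
  ins : List (Wire τ)
  outs : List (Wire τ)
  deriving DecidableEq

variable {τ κ : Type}

variable {ty : τ → C}

lemma Can.inv {L M : List (Wire τ)} {f : tw ty L ⟶ tw ty M} (h : Can ty L M f) (hn : L.Nodup) :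
    ∃ g, Can ty M L g ∧ f ≫ g = 𝟙 _ ∧ g ≫ f = 𝟙 _ := by
  obtain ⟨g, hg⟩ := exists_can (ty := ty) h.perm.symm
  exact ⟨g, hg, (hg.comp h).unique (Can.refl _) hn,
    (h.comp hg).unique (Can.refl _) (h.perm.nodup_iff.1 hn)⟩

/-- The morphism `f` applied to the first wires, leaving the wires `R` unchanged. -/
def frame {I O : List (Wire τ)} (f : tw ty I ⟶ tw ty O) (R : List (Wire τ)) :
    tw ty (I ++ R) ⟶ tw ty (O ++ R) :=
  (spl ty I R).hom ≫ f ▷ tw ty R ≫ (spl ty O R).inv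

lemma frame_comp {I J K : List (Wire τ)} (f : tw ty I ⟶ tw ty J) (g : tw ty J ⟶ tw ty K)
    (R : List (Wire τ)) : frame (f ≫ g) R = frame f R ≫ frame g R := by
  simp [frame]

lemma frame_exchange {I O R R' : List (Wire τ)} (f : tw ty I ⟶ tw ty O)
    (g : tw ty R ⟶ tw ty R') :
    frame f R ≫ (spl ty O R).hom ≫ tw ty O ◁ g ≫ (spl ty O R').inv =
      ((spl ty I R).hom ≫ tw ty I ◁ g ≫ (spl ty I R').inv) ≫ frame f R' := by
  simp [frame, whisker_exchange_assoc]

lemma frame_frame {I O : List (Wire τ)} (f : tw ty I ⟶ tw ty O) (R R' : List (Wire τ)) :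
    frame (frame f R) R' ≫ reassocTw ty O R R' = reassocTw ty I R R' ≫ frame f (R ++ R') := by
  simp only [frame, reassocTw, comp_whiskerRight, Category.assoc, Iso.inv_hom_id_assoc]
  have h : (spl ty O R).inv ▷ tw ty R' ≫ (spl ty O R).hom ▷ tw ty R' = 𝟙 _ := by
    rw [← comp_whiskerRight, Iso.inv_hom_id, id_whiskerRight]
  rw [reassoc_of% h, whisker_exchange_assoc]
  simp

/-- Naturality moves f and g across the transpositions, and `swp_swp` removes the doubled one. The
two sides have the shape of two runs, one performing f first and the other g first. -/
lemma swp_naturality {X X' Y Y' Z : C} (f : X ⟶ X') (g : Y ⟶ Y') :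
    f ▷ (Y ⊗ Z) ≫ swp X' Y Z ≫ g ▷ (X' ⊗ Z) =
      swp X Y Z ≫ g ▷ (X ⊗ Z) ≫ swp Y' X Z ≫ f ▷ (Y' ⊗ Z) ≫ swp X' Y' Z := by
  have h1 : f ▷ (Y ⊗ Z) ≫ swp X' Y Z = swp X Y Z ≫ Y ◁ f ▷ Z := by
    simp [swp]
    rw [← associator_naturality_middle, ← comp_whiskerRight_assoc,
      BraidedCategory.braiding_naturality_left, comp_whiskerRight_assoc]
  have h2 : f ▷ (Y' ⊗ Z) ≫ swp X' Y' Z = swp X Y' Z ≫ Y' ◁ f ▷ Z := by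
    simp [swp]
    rw [← associator_naturality_middle, ← comp_whiskerRight_assoc,
      BraidedCategory.braiding_naturality_left, comp_whiskerRight_assoc]
  rw [h2, reassoc_of% h1, whisker_exchange, ← Category.assoc (swp Y' X Z), swp_swp,
    Category.id_comp]

lemma frame_blockSwap {I O I' O' : List (Wire τ)} (f : tw ty I ⟶ tw ty O)
    (g : tw ty I' ⟶ tw ty O') (R : List (Wire τ)) :
    frame f (I' ++ R) ≫ blockSwap ty O I' R ≫ frame g (O ++ R) =
      blockSwap ty I I' R ≫ frame g (I ++ R) ≫ blockSwap ty O' I R ≫ frame f (O' ++ R) ≫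
        blockSwap ty O O' R := by
  have h := congrArg (fun t => (spl ty I (I' ++ R)).hom ≫ tw ty I ◁ (spl ty I' R).hom ≫ t ≫
    tw ty O' ◁ (spl ty O R).inv ≫ (spl ty O' (O ++ R)).inv) (swp_naturality (Z := tw ty R) f g)
  simp only [frame, blockSwap, Category.assoc, Iso.inv_hom_id_assoc]
  simp only [Category.assoc, whisker_exchange_assoc] at h ⊢
  rw [h]
  simp

variable [DecidableEq τ]

/-- The wires of `L` not in `I`. -/
def rest (I L : List (Wire τ)) : List (Wire τ) := L.filter fun w => decide (w ∉ I)

lemma perm_rest {I L R : List (Wire τ)} (h : L.Perm (I ++ R)) (hn : L.Nodup) :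
    (rest I L).Perm R := by
  have hd := List.nodup_append.1 (h.nodup_iff.1 hn)
  refine (h.filter _).trans ?_
  rw [List.filter_append, List.filter_eq_nil_iff.2 (by simp), List.filter_eq_self.2]
  · exact List.Perm.refl _
  · intro w hw
    simpa using fun hI => hd.2.2 w hI w hw rfl

lemma perm_append_rest {I L : List (Wire τ)} (hI : I.Nodup) (hs : I ⊆ L) (hL : L.Nodup) :
    L.Perm (I ++ rest I L) := by
  obtain ⟨l, hl, hl'⟩ := List.subperm_of_subset hI hs
  obtain ⟨R, hR⟩ := hl'.exists_perm_append
  have h : L.Perm (I ++ R) := hR.trans (hl.append_right R)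
  exact h.trans ((perm_rest h hL).symm.append_left I)

/-- The wires after running a program. -/
def final : List (Step τ κ) → List (Wire τ) → List (Wire τ)
  | [], L => L
  | s :: P, L => final P (s.outs ++ rest s.ins L)

variable (dom cod : κ → List τ) (sem : ∀ k, ten ty (dom k) ⟶ ten ty (cod k))

/-- `Den s f`: the step `s` is well typed and denotes the morphism `f`. -/
def Den (s : Step τ κ) (f : tw ty s.ins ⟶ tw ty s.outs) : Prop :=
  ∃ (h₁ : s.ins.map Prod.fst = dom s.op) (h₂ : s.outs.map Prod.fst = cod s.op),
    f = eqToHom (congrArg (ten ty) h₁) ≫ sem s.op ≫ eqToHom (congrArg (ten ty) h₂.symm)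

/-- `Sem P L M f`: the program `P` runs from the wires `L` to the wires `M` with meaning `f`. -/
inductive Sem : List (Step τ κ) → (L M : List (Wire τ)) → (tw ty L ⟶ tw ty M) → Prop
  | nil (L M : List (Wire τ)) (f : tw ty L ⟶ tw ty M) (hn : L.Nodup) (hf : Can ty L M f) :
      Sem [] L M f
  | cons (s : Step τ κ) (P : List (Step τ κ)) (L M R : List (Wire τ))
      (e : tw ty L ⟶ tw ty (s.ins ++ R)) (f : tw ty s.ins ⟶ tw ty s.outs)
      (g : tw ty (s.outs ++ R) ⟶ tw ty M) (hn : L.Nodup) (he : Can ty L (s.ins ++ R) e)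
      (hf : Den dom cod sem s f) (hg : Sem P (s.outs ++ R) M g) :
      Sem (s :: P) L M (e ≫ frame f R ≫ g)

variable {dom cod sem}

lemma Sem.nodup {P : List (Step τ κ)} {L M : List (Wire τ)} {f : tw ty L ⟶ tw ty M}
    (h : Sem dom cod sem P L M f) : L.Nodup := by
  cases h <;> assumption

lemma Sem.pre {P : List (Step τ κ)} {L L' M : List (Wire τ)} {g : tw ty L' ⟶ tw ty M}
    (h : Sem dom cod sem P L' M g) {e : tw ty L ⟶ tw ty L'} (he : Can ty L L' e) :
    Sem dom cod sem P L M (e ≫ g) := by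
  have hn := he.perm.nodup_iff.2 h.nodup
  cases h with
  | nil _ _ _ _ hf => exact Sem.nil _ _ _ hn (hf.comp he)
  | cons s P _ _ R e' f g _ he' hf hg =>
    rw [← Category.assoc]
    exact Sem.cons s P _ _ R _ _ _ hn (he'.comp he) hf hg

lemma Sem.post {P : List (Step τ κ)} {L M N : List (Wire τ)} {f : tw ty L ⟶ tw ty M}
    (h : Sem dom cod sem P L M f) {e : tw ty M ⟶ tw ty N} (he : Can ty M N e) :
    Sem dom cod sem P L N (f ≫ e) := by
  induction h with
  | nil _ _ _ hn hf => exact Sem.nil _ _ _ hn (he.comp hf)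
  | cons s P _ _ R e' f g hn he' hf _ ih =>
    simp only [Category.assoc]
    exact Sem.cons s P _ _ R _ _ _ hn he' hf (ih he)

lemma Sem.append {P Q : List (Step τ κ)} {L M N : List (Wire τ)} {f : tw ty L ⟶ tw ty M}
    {g : tw ty M ⟶ tw ty N} (h : Sem dom cod sem P L M f) (h' : Sem dom cod sem Q M N g) :
    Sem dom cod sem (P ++ Q) L N (f ≫ g) := by
  induction h with
  | nil _ _ _ hn hf => exact h'.pre hf
  | cons s P _ _ R e' f g hn he' hf _ ih =>
    simp only [Category.assoc]
    exact Sem.cons s _ _ _ R _ _ _ hn he' hf (ih h')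

lemma Sem.of_append {P Q : List (Step τ κ)} : ∀ {L N : List (Wire τ)} {f : tw ty L ⟶ tw ty N},
    Sem dom cod sem (P ++ Q) L N f → ∃ (M : List (Wire τ)) (g : tw ty L ⟶ tw ty M)
      (h : tw ty M ⟶ tw ty N), Sem dom cod sem P L M g ∧ Sem dom cod sem Q M N h ∧ f = g ≫ h := by
  induction P with
  | nil =>
    intro L N f h
    exact ⟨L, 𝟙 _, f, Sem.nil _ _ _ h.nodup (Can.refl _), h, (Category.id_comp _).symm⟩
  | cons s P ih =>
    intro L N f h
    cases h with
    | cons _ _ _ _ R e f g hn he hf hg =>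
      obtain ⟨M, g₁, g₂, h₁, h₂, rfl⟩ := ih hg
      exact ⟨M, _, g₂, Sem.cons s P _ _ R _ _ _ hn he hf h₁, h₂, by simp⟩

lemma Den.unique {s : Step τ κ} {f g : tw ty s.ins ⟶ tw ty s.outs} (hf : Den dom cod sem s f)
    (hg : Den dom cod sem s g) : f = g := by
  obtain ⟨_, _, rfl⟩ := hf
  obtain ⟨_, _, rfl⟩ := hg
  rfl

lemma perm_of_perm_append {L I R R' : List (Wire τ)} (h : L.Perm (I ++ R))
    (h' : L.Perm (I ++ R')) : R.Perm R' :=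
  (List.perm_append_left_iff I).1 (h.symm.trans h')

/-- A run may list the idle wires R in any order. Two such choices differ by a canonical permutation
of R, which coherence identifies and which slides past the step by interchange. -/
theorem Sem.unique {P : List (Step τ κ)} {L M : List (Wire τ)} {f : tw ty L ⟶ tw ty M}
    (h : Sem dom cod sem P L M f) :
    ∀ {g : tw ty L ⟶ tw ty M}, Sem dom cod sem P L M g → f = g := by
  induction h with
  | nil L M f hn hf =>
    intro g hg
    cases hg with
    | nil _ _ _ _ hg => exact hf.unique hg hn
  | cons s P L M R e f g hn he hf _ ih =>
    intro k hk
    cases hk with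
    | cons _ _ _ _ R' e' f' g' _ he' hf' hg' =>
      obtain rfl := hf.unique hf'
      obtain ⟨c, hc⟩ := exists_can (ty := ty) (perm_of_perm_append he.perm he'.perm)
      have h₁ := ((hc.whiskerList s.ins).comp he).unique he' hn
      rw [← h₁, ih (hg'.pre (hc.whiskerList s.outs)), ← Category.assoc (frame f R),
        frame_exchange]
      simp only [Category.assoc]

/-- A run fixes its lists of wires only up to order, whereas `final` computes a definite list;
comparison up to permutation lets a computed check speak about every run. -/
lemma Sem.perm_final {P : List (Step τ κ)} {L M : List (Wire τ)} {f : tw ty L ⟶ tw ty M}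
    (h : Sem dom cod sem P L M f) : ∀ {L' : List (Wire τ)}, L.Perm L' → M.Perm (final P L') := by
  induction h with
  | nil L M f hn hf => intro L' hL; exact hf.perm.symm.trans hL
  | cons s P L M R e f g hn he hf _ ih =>
    intro L' hL
    exact ih ((perm_rest (hL.symm.trans he.perm) (hL.nodup_iff.1 hn)).symm.append_left _)

/-- Needed to apply an identity inside a larger program, whose other wires R are carried along. No
step may create a name already in R, since lists of wires must stay free of repetitions. -/
lemma Sem.frame {P : List (Step τ κ)} {L M : List (Wire τ)} {f : tw ty L ⟶ tw ty M}
    (h : Sem dom cod sem P L M f) : ∀ {R : List (Wire τ)}, (L ++ R).Nodup →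
    (∀ s ∈ P, s.outs.Disjoint R) → Sem dom cod sem P (L ++ R) (M ++ R) (frame f R) := by
  induction h with
  | nil L M f hn hf => intro R hR _; exact Sem.nil _ _ _ hR (hf.append R)
  | cons s P L M R₀ e f g hn he hf hg ih =>
    intro R hR hd
    have hR' := List.nodup_append'.1 hR
    have h₁ : R₀.Disjoint R := fun w hw => hR'.2.2 (he.perm.mem_iff.2 (by simp [hw]))
    have h₂ : ((s.outs ++ R₀) ++ R).Nodup := by
      refine List.nodup_append'.2 ⟨hg.nodup, hR'.2.1, ?_⟩
      exact List.disjoint_append_left.2 ⟨hd s (by simp), h₁⟩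
    have hr := can_reassocTw (ty := ty) s.outs R₀ R
    obtain ⟨c, hc, hc₁, hc₂⟩ := hr.inv h₂
    have := Sem.cons s P _ _ (R₀ ++ R) _ _ _ hR ((can_reassocTw s.ins R₀ R).comp (he.append R))
      hf ((ih h₂ fun t ht => hd t (by simp [ht])).pre hc)
    refine cast ?_ this
    congr 1
    rw [frame_comp, frame_comp, Category.assoc, ← reassoc_of% frame_frame, reassoc_of% hc₁]
    rfl

/-- Both orders are run over one common list of idle wires, where they agree by interchange;
`Sem.unique` carries this over to the given run. While `h₃` says that t uses no result of s, `h₂`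
keeps t from creating a name that s has yet to consume. -/
lemma Sem.swap {s t : Step τ κ} {P : List (Step τ κ)} {L M : List (Wire τ)}
    {φ : tw ty L ⟶ tw ty M} (h : Sem dom cod sem (s :: t :: P) L M φ)
    (h₂ : s.ins.Disjoint t.outs) (h₃ : s.outs.Disjoint t.ins) : Sem dom cod sem (t :: s :: P) L M φ := by
  have h0 := h
  cases h with
  | cons _ _ _ _ R₁ e₁ f g₁ hn he₁ hf hg₁ =>
    cases hg₁ with
    | cons _ _ _ _ R₂ e₂ f' g hn' he₂ hf' hg =>
      have hi := List.nodup_append'.1 (he₂.perm.nodup_iff.1 hn')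
      have ho := List.nodup_append'.1 hn'
      have ha := List.nodup_append'.1 (he₁.perm.nodup_iff.1 hn)
      have hsub : t.ins ⊆ R₁ := fun w hw => by
        have : w ∈ s.outs ++ R₁ := he₂.perm.mem_iff.2 (by simp [hw])
        exact (List.mem_append.1 this).resolve_left fun hs => h₃ hs hw
      have hR₁ := perm_append_rest hi.1 hsub ho.2.1
      -- The wires used by neither of the two steps.
      set R := rest t.ins R₁
      have hR₂ : R₂.Perm (s.outs ++ R) := by
        refine perm_of_perm_append he₂.perm ((hR₁.append_left s.outs).trans ?_)
        rw [← List.append_assoc, ← List.append_assoc]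
        exact List.perm_append_comm.append_right R
      obtain ⟨a, hca⟩ := exists_can (ty := ty) (he₁.perm.trans (hR₁.append_left s.ins))
      obtain ⟨b, hcb⟩ := exists_can (ty := ty) (hR₂.append_left t.outs).symm
      have hg' := hg.pre hcb
      have hb := can_blockSwap (ty := ty) s.outs t.ins R
      have n₁ : (s.outs ++ (t.ins ++ R)).Nodup := (hR₁.append_left s.outs).nodup_iff.1 hn'
      have d₁ := Sem.cons s _ _ _ (t.ins ++ R) _ _ _ hn hca hf
        (Sem.cons t _ _ _ (s.outs ++ R) _ _ _ n₁ hb hf' hg')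
      have n₂ : (s.outs ++ (t.outs ++ R)).Nodup := by
        refine (List.Perm.nodup_iff ?_).1 hg'.nodup
        exact (can_blockSwap (ty := ty) t.outs s.outs R).perm
      have n₃ : (t.outs ++ (s.ins ++ R)).Nodup := by
        have m₁ := (hR₁.append_left s.ins).nodup_iff.1 (he₁.perm.nodup_iff.1 hn)
        have m₂ := List.nodup_append'.1 ((can_blockSwap (ty := ty) s.ins t.ins R).perm.nodup_iff.1 m₁)
        have m₃ := List.nodup_append'.1 (List.nodup_append'.1 n₂).2.1
        exact List.nodup_append'.2 ⟨m₃.1, m₂.2.1, List.disjoint_append_right.2 ⟨h₂.symm, m₃.2.2⟩⟩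
      have d₂ := Sem.cons t _ _ _ (s.ins ++ R) _ _ _ hn ((can_blockSwap s.ins t.ins R).comp hca) hf'
        (Sem.cons s _ _ _ (t.outs ++ R) _ _ _ n₃ (can_blockSwap t.outs s.ins R) hf
          (hg'.pre (can_blockSwap s.outs t.outs R)))
      have e := h0.unique d₁
      rw [e]
      refine cast ?_ d₂
      congr 1
      have := congrArg (fun x => a ≫ x ≫ b ≫ g) (frame_blockSwap f f' R)
      simpa only [Category.assoc] using this.symm

end

/-! ### Renaming of wires and rewriting of programs. -/

section

variable {C : Type u} [Category.{v} C] [MonoidalCategory C] [SymmetricCategory C]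

variable {τ κ : Type} [DecidableEq τ] [DecidableEq κ] {ty : τ → C}

/-- Renaming of a wire. -/
def Wire.rename (σ : ℕ → ℕ) (w : Wire τ) : Wire τ := (w.1, σ w.2)

/-- Renaming of the wires of a list. -/
abbrev renameList (σ : ℕ → ℕ) (L : List (Wire τ)) : List (Wire τ) := L.map (Wire.rename σ)

/-- Renaming of the wires of a step. -/
def Step.rename (σ : ℕ → ℕ) (s : Step τ κ) : Step τ κ :=
  ⟨s.op, renameList σ s.ins, renameList σ s.outs⟩

lemma types_renameList (σ : ℕ → ℕ) (L : List (Wire τ)) :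
    (renameList σ L).map Prod.fst = L.map Prod.fst := by
  simp [renameList, Wire.rename, Function.comp_def]

lemma tw_renameList (σ : ℕ → ℕ) (L : List (Wire τ)) :
    tw ty (renameList σ L) = tw ty L :=
  congrArg (ten ty) (types_renameList σ L)

/-- Transport of a morphism along a renaming. -/
def transport {X Y X' Y' : C} (hX : X' = X) (hY : Y' = Y) (f : X ⟶ Y) : X' ⟶ Y' :=
  eqToHom hX ≫ f ≫ eqToHom hY.symm

lemma transport_tail {W Z L L' K K' : C} (hL : K = L) (hK : K' = L') (f : L ⟶ Z ⊗ L')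
    (h₁ : Z ⊗ K' = Z ⊗ L') (h₂ : W ⊗ K = W ⊗ L) (h₃ : Z ⊗ (W ⊗ K') = Z ⊗ (W ⊗ L')) :
    W ◁ transport hL h₁ f ≫ swp W Z K' = transport h₂ h₃ (W ◁ f ≫ swp W Z L') := by
  subst hL hK
  simp [transport]

lemma transport_cons {Z L L' K K' M N : C} (hL : K = L) (hK : K' = L') (hM : N = M)
    (e : L ⟶ Z ⊗ L') (f : L' ⟶ M) (h₁ : Z ⊗ K' = Z ⊗ L') (h₂ : Z ⊗ N = Z ⊗ M) :
    transport hL h₁ e ≫ Z ◁ transport hK hM f = transport hL h₂ (e ≫ Z ◁ f) := by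
  subst hL hK hM
  simp [transport]

lemma transport_comp {X Y Z X' Y' Z' : C} (hX : X' = X) (hY : Y' = Y) (hZ : Z' = Z)
    (f : X ⟶ Y) (g : Y ⟶ Z) :
    transport hX hY f ≫ transport hY hZ g = transport hX hZ (f ≫ g) := by
  subst hX hY hZ
  simp [transport]

lemma transport_eqToHom {X X' Y Y' D E : C} (hX : X' = X) (hY : Y' = Y) (hD : X = D) (hE : Y = E)
    (f : D ⟶ E) : transport hX hY (eqToHom hD ≫ f ≫ eqToHom hE.symm) =
      eqToHom (hX.trans hD) ≫ f ≫ eqToHom (hY.trans hE).symm := by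
  subst hX hY hD hE
  simp [transport]

lemma Ext.rename (σ : ℕ → ℕ) {z : Wire τ} {L L' : List (Wire τ)} {e : tw ty L ⟶ tw ty (z :: L')}
    (h : Ext ty z L L' e) : Ext ty (z.rename σ) (renameList σ L) (renameList σ L')
      (transport (tw_renameList σ L) (tw_renameList σ (z :: L')) e) := by
  induction h with
  | head L =>
    refine cast ?_ (Ext.head (ty := ty) (z := z.rename σ) (renameList σ L))
    congr 1
    simp [transport]
    rfl
  | tail y L L' f _ ih =>
    refine cast ?_ (Ext.tail (y.rename σ) _ _ _ ih)
    congr 1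
    exact transport_tail (tw_renameList σ L) (tw_renameList σ L') f _ _ _

lemma Can.rename (σ : ℕ → ℕ) {L M : List (Wire τ)} {f : tw ty L ⟶ tw ty M} (h : Can ty L M f) :
    Can ty (renameList σ L) (renameList σ M)
      (transport (tw_renameList σ L) (tw_renameList σ M) f) := by
  induction h with
  | nil =>
    refine cast ?_ (Can.nil (ty := ty))
    congr 1
    change 𝟙 (𝟙_ C) = transport rfl rfl (𝟙 (𝟙_ C))
    simp [transport]
  | cons z L L' M e f he _ ih =>
    refine cast ?_ (Can.cons (z.rename σ) _ _ _ _ _ (he.rename σ) ih)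
    congr 1
    exact transport_cons (tw_renameList σ L) (tw_renameList σ L') (tw_renameList σ M) e f _ _

lemma transport_spl_cons {W S I R S' I' R' : C} (hS : S' = S) (hI : I' = I) (hR : R' = R)
    (f : S ⟶ I ⊗ R) (g : S' ⟶ I' ⊗ R') (h : I' ⊗ R' = I ⊗ R) (h₁ : W ⊗ S' = W ⊗ S)
    (h₂ : (W ⊗ I') ⊗ R' = (W ⊗ I) ⊗ R) (hg : g = transport hS h f) :
    W ◁ g ≫ (α_ W I' R').inv = transport h₁ h₂ (W ◁ f ≫ (α_ W I R).inv) := by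
  subst hS hI hR hg
  simp [transport]

lemma transport_unit {R R' : C} (hR : R' = R) (h : 𝟙_ C ⊗ R' = 𝟙_ C ⊗ R) :
    (λ_ R').inv = transport hR h (λ_ R).inv := by
  subst hR
  simp [transport]

lemma tw_renameList_append (σ : ℕ → ℕ) (I R : List (Wire τ)) :
    tw ty (renameList σ I ++ renameList σ R) = tw ty (I ++ R) := by
  rw [← List.map_append]
  exact tw_renameList σ (I ++ R)

lemma spl_renameList (σ : ℕ → ℕ) (I R : List (Wire τ)) :
    (spl ty (renameList σ I) (renameList σ R)).hom = transport (tw_renameList_append σ I R)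
      (congrArg₂ (· ⊗ ·) (tw_renameList σ I) (tw_renameList σ R)) (spl ty I R).hom := by
  induction I with
  | nil => exact transport_unit (tw_renameList σ R) _
  | cons w I ih =>
    exact transport_spl_cons (tw_renameList_append σ I R) (tw_renameList σ I)
      (tw_renameList σ R) (spl ty I R).hom _ _ _ _ ih

lemma transport_frame {I O R S U I' O' R' S' U' : C} (hI : I' = I) (hO : O' = O) (hR : R' = R)
    (hS : S' = S) (hU : U' = U) (s : S ⟶ I ⊗ R) (t : U ≅ O ⊗ R) (s' : S' ⟶ I' ⊗ R')
    (t' : U' ≅ O' ⊗ R') (h₁ : I' ⊗ R' = I ⊗ R) (h₂ : O' ⊗ R' = O ⊗ R)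
    (hs : s' = transport hS h₁ s) (ht : t'.hom = transport hU h₂ t.hom) (f : I ⟶ O) :
    s' ≫ transport hI hO f ▷ R' ≫ t'.inv = transport hS hU (s ≫ f ▷ R ≫ t.inv) := by
  subst hI hO hR hS hU
  have : t' = t := by
    ext
    simpa [transport] using ht
  subst hs this
  simp [transport]

lemma frame_rename (σ : ℕ → ℕ) {I O : List (Wire τ)} (f : tw ty I ⟶ tw ty O)
    (R : List (Wire τ)) :
    frame (transport (tw_renameList σ I) (tw_renameList σ O) f) (renameList σ R) =
      transport (tw_renameList_append σ I R) (tw_renameList_append σ O R) (frame f R) :=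
  transport_frame _ _ (tw_renameList σ R) _ _ _ (spl ty O R) _ _ _ _
    (spl_renameList σ I R) (spl_renameList σ O R) f

/-- All lists of wires that occur while running the program stay without repetitions under the
renaming. -/
def renameOk (σ : ℕ → ℕ) : List (Step τ κ) → List (Wire τ) → Bool
  | [], L => decide (renameList σ L).Nodup
  | s :: P, L => decide (renameList σ L).Nodup && renameOk σ P (s.outs ++ rest s.ins L)

variable {dom cod : κ → List τ} {sem : ∀ k, ten ty (dom k) ⟶ ten ty (cod k)}

lemma Den.rename (σ : ℕ → ℕ) {s : Step τ κ} {f : tw ty s.ins ⟶ tw ty s.outs}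
    (h : Den dom cod sem s f) : Den dom cod sem (s.rename σ)
      (transport (tw_renameList σ s.ins) (tw_renameList σ s.outs) f) := by
  obtain ⟨h₁, h₂, rfl⟩ := h
  exact ⟨(types_renameList σ _).trans h₁, (types_renameList σ _).trans h₂, transport_eqToHom _ _
    (congrArg (ten ty) h₁) (congrArg (ten ty) h₂) _⟩

/-- The check `renameOk` follows one particular ordering of the wires, so it is made on a permuted
list K. The equality for L' absorbs the difference between renaming an appended list and appending
renamed lists. The map σ need not be injective: only wires alive at the same moment must keep
distinct names. -/
lemma Sem.rename (σ : ℕ → ℕ) {P : List (Step τ κ)} {L M : List (Wire τ)}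
    {f : tw ty L ⟶ tw ty M} (h : Sem dom cod sem P L M f) :
    ∀ {K : List (Wire τ)}, L.Perm K → renameOk σ P K = true →
    ∀ {L' : List (Wire τ)} (hL' : L' = renameList σ L),
      Sem dom cod sem (P.map (Step.rename σ)) L' (renameList σ M)
        (transport (by rw [hL', tw_renameList]) (tw_renameList σ M) f) := by
  induction h with
  | nil L M f hn hf =>
    intro K hK hr L' hL'
    subst hL'
    simp only [renameOk, decide_eq_true_eq] at hr
    exact Sem.nil _ _ _ ((hK.map _).nodup_iff.2 hr) (hf.rename σ)
  | cons s P L M R e f g hn he hf hg ih =>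
    intro K hK hr L' hL'
    subst hL'
    simp only [renameOk, Bool.and_eq_true, decide_eq_true_eq] at hr
    have hp : (s.outs ++ R).Perm (s.outs ++ rest s.ins K) :=
      (perm_rest (hK.symm.trans he.perm) (hK.nodup_iff.1 hn)).symm.append_left _
    have hg' := ih hp hr.2 (L' := renameList σ s.outs ++ renameList σ R) (by simp)
    have he' := he.rename σ
    have key : ∀ (J : List (Wire τ)) (hJ : J = renameList σ (s.ins ++ R)),
        Can ty (renameList σ L) J (transport (tw_renameList σ L) (by rw [hJ, tw_renameList]) e) := by
      intro J hJ
      subst hJ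
      exact he'
    have he'' := key (renameList σ s.ins ++ renameList σ R) (by simp)
    refine cast ?_ (Sem.cons (s.rename σ) (P.map (Step.rename σ)) _ _ (renameList σ R) _ _ _
      ((hK.map _).nodup_iff.2 hr.1) he'' (hf.rename σ) hg')
    congr 1
    have hfr := frame_rename σ f R
    refine (congrArg (fun t => _ ≫ t ≫ _) hfr).trans ?_
    rw [transport_comp, transport_comp]

/-- Well-typedness of a program. -/
def wellTyped (dom cod : κ → List τ) : List (Step τ κ) → List (Wire τ) → List (Wire τ) → Bool
  | [], L, M => decide L.Nodup && L.isPerm M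
  | s :: P, L, M => decide L.Nodup && decide s.ins.Nodup && s.ins.all (fun w => decide (w ∈ L)) &&
      decide (s.ins.map Prod.fst = dom s.op) && decide (s.outs.map Prod.fst = cod s.op) &&
      wellTyped dom cod P (s.outs ++ rest s.ins L) M

lemma exists_sem (P : List (Step τ κ)) : ∀ {L M : List (Wire τ)},
    wellTyped dom cod P L M = true → ∃ f, Sem dom cod sem P L M f := by
  induction P with
  | nil =>
    intro L M h
    simp only [wellTyped, Bool.and_eq_true, decide_eq_true_eq, List.isPerm_iff] at h
    obtain ⟨f, hf⟩ := exists_can (ty := ty) h.2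
    exact ⟨f, Sem.nil _ _ _ h.1 hf⟩
  | cons s P ih =>
    intro L M h
    simp only [wellTyped, Bool.and_eq_true, decide_eq_true_eq, List.all_eq_true] at h
    obtain ⟨⟨⟨⟨⟨hL, hn⟩, hs⟩, h₁⟩, h₂⟩, h⟩ := h
    obtain ⟨g, hg⟩ := ih h
    obtain ⟨e, he⟩ := exists_can (ty := ty) (perm_append_rest hn (fun w hw => hs w hw) hL)
    exact ⟨_, Sem.cons s P _ _ _ e _ g hL he ⟨h₁, h₂, rfl⟩ hg⟩

variable (dom cod sem) in
/-- The meaning of `P` is a meaning of `Q`. -/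
def Imp (P Q : List (Step τ κ)) (L M : List (Wire τ)) : Prop :=
  ∀ f, Sem dom cod sem P L M f → Sem dom cod sem Q L M f

variable (dom cod sem) in
/-- The programs `P` and `Q` have the same meaning. -/
def Eqv (P Q : List (Step τ κ)) (L M : List (Wire τ)) : Prop :=
  ∃ f, Sem dom cod sem P L M f ∧ Sem dom cod sem Q L M f

lemma Imp.trans {P Q R : List (Step τ κ)} {L M : List (Wire τ)} (h : Imp dom cod sem P Q L M)
    (h' : Imp dom cod sem Q R L M) : Imp dom cod sem P R L M := fun f hf => h' f (h f hf)

lemma Eqv.symm {P Q : List (Step τ κ)} {L M : List (Wire τ)} (h : Eqv dom cod sem P Q L M) :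
    Eqv dom cod sem Q P L M := h.imp fun _ h => h.symm

lemma Eqv.trans {P Q R : List (Step τ κ)} {L M : List (Wire τ)} (h : Eqv dom cod sem P Q L M)
    (h' : Eqv dom cod sem Q R L M) : Eqv dom cod sem P R L M := by
  obtain ⟨f, hf, hf'⟩ := h
  obtain ⟨g, hg, hg'⟩ := h'
  obtain rfl := hf'.unique hg
  exact ⟨f, hf, hg'⟩

/-- An implication says nothing about a program without meaning, so chains of rewritings need no
typing of the intermediate programs. A single check of the first program turns the whole chain into
an equality. -/
lemma Imp.eqv {P Q : List (Step τ κ)} {L M : List (Wire τ)} (h : Imp dom cod sem P Q L M)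
    (hw : wellTyped dom cod P L M = true := by decide +kernel) : Eqv dom cod sem P Q L M := by
  obtain ⟨f, hf⟩ := exists_sem (sem := sem) P hw
  exact ⟨f, hf, h f hf⟩

/-- Two steps are independent if neither uses a result of the other. -/
def independent (s t : Step τ κ) : Bool :=
  (s.ins.all fun w => decide (w ∉ t.outs)) && (s.outs.all fun w => decide (w ∉ t.ins))

lemma imp_swap {s t : Step τ κ} (h : independent s t = true) (P : List (Step τ κ))
    (L M : List (Wire τ)) : Imp dom cod sem (s :: t :: P) (t :: s :: P) L M := by
  simp only [independent, Bool.and_eq_true, List.all_eq_true, decide_eq_true_eq] at h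
  exact fun f hf => hf.swap (fun w hw => h.1 w hw) (fun w hw => h.2 w hw)

lemma independent_comm {s t : Step τ κ} (h : independent s t = true) :
    independent t s = true := by
  simp only [independent, Bool.and_eq_true, List.all_eq_true, decide_eq_true_eq] at h ⊢
  exact ⟨fun w hw hw' => h.2 w hw' hw, fun w hw hw' => h.1 w hw' hw⟩

lemma imp_cons {P Q : List (Step τ κ)} {s : Step τ κ} {M : List (Wire τ)}
    (h : ∀ L, Imp dom cod sem P Q L M) (L : List (Wire τ)) :
    Imp dom cod sem (s :: P) (s :: Q) L M := by
  intro f hf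
  cases hf with
  | cons _ _ _ _ R e f g hn he hf hg => exact Sem.cons _ _ _ _ R _ _ _ hn he hf (h _ _ hg)

/-- Move the step `s` to the front of a program, past independent steps. -/
def pull (s : Step τ κ) : List (Step τ κ) → Option (List (Step τ κ))
  | [] => none
  | t :: Q => if t = s then some Q else
      if independent t s then (pull s Q).map (t :: ·) else none

lemma imp_pull {s : Step τ κ} {M : List (Wire τ)} : ∀ {Q Q' : List (Step τ κ)},
    pull s Q = some Q' → ∀ L, Imp dom cod sem (s :: Q') Q L M := by
  intro Q
  induction Q with
  | nil => intro Q' h; simp [pull] at h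
  | cons t Q ih =>
    intro Q' h
    simp only [pull] at h
    split_ifs at h with h₁ h₂
    · intro L f hf
      obtain rfl := Option.some.inj h
      rwa [h₁]
    · obtain ⟨Q'', h₃, rfl⟩ := Option.map_eq_some_iff.1 h
      intro L
      exact (imp_swap (independent_comm h₂) _ _ _).trans (imp_cons (ih h₃) L)

/-- Check that two programs differ by exchanges of independent steps. -/
def reorder : List (Step τ κ) → List (Step τ κ) → Bool
  | [], Q => Q.isEmpty
  | s :: P, Q => match pull s Q with
    | none => false
    | some Q' => reorder P Q'

lemma imp_reorder {M : List (Wire τ)} : ∀ {P Q : List (Step τ κ)}, reorder P Q = true →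
    ∀ L, Imp dom cod sem P Q L M := by
  intro P
  induction P with
  | nil =>
    intro Q h L f hf
    obtain rfl := List.isEmpty_iff.1 h
    exact hf
  | cons s P ih =>
    intro Q h L
    simp only [reorder] at h
    cases hQ : pull s Q with
    | none => simp [hQ] at h
    | some Q' =>
      rw [hQ] at h
      exact (imp_cons (ih h) L).trans (imp_pull hQ L)

/-- The part of a program that can be run before the steps of `B`, and the remaining part. -/
def cut (B : List (Step τ κ)) : List (Step τ κ) → List (Step τ κ) → List (Step τ κ) →
    List (Step τ κ) → List (Step τ κ) × List (Step τ κ)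
  | [], pre, post, _ => (pre, post)
  | t :: Q, pre, post, blocked =>
    if t ∈ B then cut B Q pre post (t :: blocked)
    else if blocked.all (independent t) then cut B Q (pre ++ [t]) post blocked
    else cut B Q pre (post ++ [t]) (t :: blocked)

/-- A finite renaming. -/
def subst : List (ℕ × ℕ) → ℕ → ℕ
  | [], n => n
  | (a, b) :: l, n => if n = a then b else subst l n

/-- The run is split before and after the renamed copy of A. Framed by the idle wires, both sides of
the identity have the same meaning, so the run through A may be exchanged for one through B. -/
theorem imp_rule {A B : List (Step τ κ)} {I O : List (Wire τ)} (r : Eqv dom cod sem A B I O)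
    (σ : ℕ → ℕ) {pre post : List (Step τ κ)} {L M : List (Wire τ)}
    (hA : renameOk σ A I = true) (hB : renameOk σ B I = true)
    (hI : ∀ w ∈ renameList σ I, w ∈ final pre L)
    (hdA : ∀ s ∈ A.map (Step.rename σ), s.outs.Disjoint (rest (renameList σ I) (final pre L)))
    (hdB : ∀ s ∈ B.map (Step.rename σ), s.outs.Disjoint (rest (renameList σ I) (final pre L))) :
    Imp dom cod sem (pre ++ (A.map (Step.rename σ) ++ post))
      (pre ++ (B.map (Step.rename σ) ++ post)) L M := by
  intro f hf
  obtain ⟨K, g₁, g, h₁, h, rfl⟩ := hf.of_append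
  obtain ⟨K', g₂, g₃, h₂, h₃, rfl⟩ := h.of_append
  obtain ⟨φ, hφA, hφB⟩ := r
  have hA' := hφA.rename σ (List.Perm.refl _) hA rfl
  have hB' := hφB.rename σ (List.Perm.refl _) hB rfl
  have hK := h₁.perm_final (List.Perm.refl L)
  have hKR := perm_append_rest hA'.nodup (fun w hw => hK.mem_iff.2 (hI w hw)) h₂.nodup
  set R := rest (renameList σ I) K
  have hR : R.Perm (rest (renameList σ I) (final pre L)) := hK.filter _
  obtain ⟨c, hc⟩ := exists_can (ty := ty) hKR
  have hn := hKR.nodup_iff.1 h₂.nodup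
  have hA'' := (hA'.frame hn fun s hs w hw hw' => hdA s hs hw (hR.mem_iff.1 hw')).pre hc
  have hB'' := (hB'.frame hn fun s hs w hw hw' => hdB s hs hw (hR.mem_iff.1 hw')).pre hc
  -- The given run and the framed one may list their final wires in different orders; d reconciles
  -- them and d' undoes this afterwards.
  obtain ⟨d, hd⟩ := exists_can (ty := ty)
    ((h₂.perm_final (List.Perm.refl _)).trans (hA''.perm_final (List.Perm.refl _)).symm)
  obtain ⟨d', hd', hdd, -⟩ := hd.inv h₃.nodup
  have e := (h₂.post hd).unique hA''
  rw [← e] at hB''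
  have hB₃ := hB''.post hd'
  rw [Category.assoc, hdd, Category.comp_id] at hB₃
  exact h₁.append (hB₃.append h₃)

lemma imp_rename (σ : ℕ → ℕ) {P : List (Step τ κ)} {L M : List (Wire τ)}
    (h : renameOk σ P L = true) (hL : renameList σ L = L) (hM : renameList σ M = M) :
    Imp dom cod sem P (P.map (Step.rename σ)) L M := by
  intro f hf
  have := hf.rename σ (List.Perm.refl _) h hL.symm
  have key : ∀ (M' : List (Wire τ)) (hM' : M' = M) (e : tw ty M' = tw ty M),
      Sem dom cod sem (P.map (Step.rename σ)) L M' (transport rfl e f) →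
      Sem dom cod sem (P.map (Step.rename σ)) L M f := by
    intro M' hM' e h'
    subst hM'
    simpa [transport] using h'
  exact key _ hM _ this

/-- The renamed program, cut around the image of `A` under `l`. -/
def around (A P : List (Step τ κ)) (l : List ℕ) (ρ : List (ℕ × ℕ)) :
    List (Step τ κ) × List (Step τ κ) :=
  cut (A.map (Step.rename fun n => l.getD n 0)) (P.map (Step.rename (subst ρ))) [] [] []

/-- The result of replacing in `P`, after the renaming `ρ`, the image of `A` under the renaming `l`
by the image of `B`. -/
def replace (A B P : List (Step τ κ)) (l : List ℕ) (ρ : List (ℕ × ℕ)) : List (Step τ κ) :=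
  (around A P l ρ).1 ++ (B.map (Step.rename fun n => l.getD n 0) ++ (around A P l ρ).2)

/-- The conditions under which `replace` preserves the meaning. -/
def replaceOk (A B P : List (Step τ κ)) (I L M : List (Wire τ)) (l : List ℕ)
    (ρ : List (ℕ × ℕ)) : Bool :=
  let σ := fun n => l.getD n 0
  let A' := A.map (Step.rename σ)
  let B' := B.map (Step.rename σ)
  let c := around A P l ρ
  let K := final c.1 L
  let R := rest (renameList σ I) K
  renameOk (subst ρ) P L && decide (renameList (subst ρ) L = L) &&
    decide (renameList (subst ρ) M = M) &&
    reorder (P.map (Step.rename (subst ρ))) (c.1 ++ (A' ++ c.2)) &&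
    renameOk σ A I && renameOk σ B I && (renameList σ I).all (fun w => decide (w ∈ K)) &&
    A'.all (fun s => s.outs.all fun w => decide (w ∉ R)) &&
    B'.all (fun s => s.outs.all fun w => decide (w ∉ R))

/-- A single rewriting. Entry n of `l` is the wire of the program that plays wire n of the identity,
be it an input, an output or an internal wire of either side; entries at names absent from the
identity do not matter. The renaming `ρ` acts on the program first. It is required when the
right-hand side is the empty program, as the output must then bear the name of the input. -/
theorem Imp.replace {A B P Q : List (Step τ κ)} {I O L M : List (Wire τ)}
    (r : Eqv dom cod sem A B I O) (l : List ℕ) (ρ : List (ℕ × ℕ))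
    (h' : Imp dom cod sem (WirePrograms.replace A B P l ρ) Q L M)
    (h : replaceOk A B P I L M l ρ = true := by decide +kernel) : Imp dom cod sem P Q L M := by
  simp only [replaceOk, Bool.and_eq_true, decide_eq_true_eq, List.all_eq_true] at h
  obtain ⟨⟨⟨⟨⟨⟨⟨⟨h₁, h₂⟩, h₃⟩, h₄⟩, h₅⟩, h₆⟩, h₇⟩, h₈⟩, h₉⟩ := h
  exact (imp_rename _ h₁ h₂ h₃).trans ((imp_reorder h₄ L).trans
    ((imp_rule r _ h₅ h₆ h₇ h₈ h₉).trans h'))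

theorem Imp.finish {P Q : List (Step τ κ)} {L M : List (Wire τ)} (ρ : List (ℕ × ℕ))
    (h : (renameOk (subst ρ) P L && decide (renameList (subst ρ) L = L) &&
      decide (renameList (subst ρ) M = M) && reorder (P.map (Step.rename (subst ρ))) Q) = true :=
        by decide +kernel) :
    Imp dom cod sem P Q L M := by
  simp only [Bool.and_eq_true, decide_eq_true_eq] at h
  exact (imp_rename _ h.1.1.1 h.1.1.2 h.1.2).trans (imp_reorder h.2 L)

end

/-! ### Between programs and morphisms with arbitrary bracketing. -/

section

variable {C : Type u} [Category.{v} C] [MonoidalCategory C] [SymmetricCategory C]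

variable {τ κ : Type} [DecidableEq τ] [DecidableEq κ] {ty : τ → C}
  {dom cod : κ → List τ} {sem : ∀ k, ten ty (dom k) ⟶ ten ty (cod k)}

lemma associator_conj {S T U S' T' U' ST STU TU Z : C} (s : S ≅ S') (t : T ≅ T') (u : U ≅ U')
    (p : ST ≅ S' ⊗ T') (p' : STU ≅ ST ⊗ U') (q : TU ≅ T' ⊗ U') (q' : Z ≅ S' ⊗ TU) :
    ((((s ⊗ᵢ t) ≪≫ p.symm) ⊗ᵢ u) ≪≫ p'.symm).inv ≫ (α_ S T U).hom ≫
      ((s ⊗ᵢ ((t ⊗ᵢ u) ≪≫ q.symm)) ≪≫ q'.symm).hom =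
    p'.hom ≫ p.hom ▷ U' ≫ (α_ S' T' U').hom ≫ S' ◁ q.inv ≫ q'.inv := by
  have h : (α_ S T U).hom ≫ (s.hom ⊗ₘ (t.hom ⊗ₘ u.hom)) =
      ((s.hom ⊗ₘ t.hom) ⊗ₘ u.hom) ≫ (α_ S' T' U').hom := (associator_naturality _ _ _).symm
  have h₂ : s.hom ⊗ₘ ((t.hom ⊗ₘ u.hom) ≫ q.inv) =
      (s.hom ⊗ₘ (t.hom ⊗ₘ u.hom)) ≫ S' ◁ q.inv := by
    rw [tensorHom_comp_whiskerLeft]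
  simp only [Iso.trans_inv, Iso.trans_hom, tensorIso_inv, tensorIso_hom, Iso.symm_inv,
    Iso.symm_hom, Category.assoc, h₂]
  rw [reassoc_of% h]
  simp only [← Category.assoc]
  congr 3
  rw [Category.assoc, MonoidalCategory.tensorHom_comp_tensorHom, Category.assoc,
    MonoidalCategory.tensorHom_comp_tensorHom]
  simp

lemma whisker_rightUnitor {W I J : C} (s : I ⊗ 𝟙_ C ⟶ J) :
    W ◁ ((ρ_ I).inv ≫ s) = (ρ_ (W ⊗ I)).inv ≫ (α_ W I (𝟙_ C)).hom ≫ W ◁ s := by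
  simp

lemma rightUnitor_conj {S S' Z : C} (t : S ≅ S') (s : S' ⊗ 𝟙_ C ⟶ Z) :
    (ρ_ S').inv ≫ s = t.inv ≫ (ρ_ S).inv ≫ (t.hom ⊗ₘ 𝟙 (𝟙_ C)) ≫ s := by
  rw [tensorHom_id, ← rightUnitor_inv_naturality_assoc, Iso.inv_hom_id_assoc]

lemma rightUnitor_frame {I O I' O' : C} (s : I' ≅ I ⊗ 𝟙_ C) (t : O' ≅ O ⊗ 𝟙_ C) (f : I ⟶ O)
    {d : O' ⟶ O} (h : ((ρ_ O).inv ≫ t.inv) ≫ d = 𝟙 _) :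
    ((ρ_ I).inv ≫ s.inv) ≫ (s.hom ≫ f ▷ 𝟙_ C ≫ t.inv) ≫ d = f := by
  simp only [Category.assoc, Iso.inv_hom_id_assoc] at h ⊢
  rw [← rightUnitor_inv_naturality_assoc, h, Category.comp_id]

lemma eq_eqToHom_of_heq {X X' Y Y' : C} (hX : X = X') (hY : Y = Y') {f : X ⟶ Y} {g : X' ⟶ Y'}
    (h : HEq f g) : f = eqToHom hX ≫ g ≫ eqToHom hY.symm := by
  subst hX hY
  simpa using eq_of_heq h

/-- Bracketings of lists of wires. -/
inductive Shape (τ : Type)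
  | wire (w : Wire τ)
  | unit
  | tensor (t u : Shape τ)

/-- The tensor product of a bracketed list of wires. -/
def Shape.obj (ty : τ → C) : Shape τ → C
  | wire w => ty w.1
  | unit => 𝟙_ C
  | tensor t u => t.obj ty ⊗ u.obj ty

/-- The underlying list of wires. -/
def Shape.wires : Shape τ → List (Wire τ)
  | wire w => [w]
  | unit => []
  | tensor t u => t.wires ++ u.wires

/-- The constraint from the bracketed to the right-bracketed tensor product. -/
def Shape.iso (ty : τ → C) : (t : Shape τ) → (t.obj ty ≅ tw ty t.wires)
  | wire w => (ρ_ (ty w.1)).symm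
  | unit => Iso.refl _
  | tensor t u => (t.iso ty ⊗ᵢ u.iso ty) ≪≫ (spl ty t.wires u.wires).symm

/-- A morphism between bracketed tensor products, rebracketed. -/
def flat {t u : Shape τ} (f : t.obj ty ⟶ u.obj ty) : tw ty t.wires ⟶ tw ty u.wires :=
  (t.iso ty).inv ≫ f ≫ (u.iso ty).hom

lemma flat_injective {t u : Shape τ} {f g : t.obj ty ⟶ u.obj ty} (h : flat f = flat g) : f = g := by
  simpa [flat] using h

variable (dom cod sem) in
/-- The program `P` computes the morphism `f`. -/
def Computes (P : List (Step τ κ)) (t u : Shape τ) (f : t.obj ty ⟶ u.obj ty) : Prop :=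
  Sem dom cod sem P t.wires u.wires (flat f)

namespace Computes

variable {P Q : List (Step τ κ)} {s t u v : Shape τ}

lemma comp {f : s.obj ty ⟶ t.obj ty} {g : t.obj ty ⟶ u.obj ty} (h : Computes dom cod sem P s t f)
    (h' : Computes dom cod sem Q t u g) : Computes dom cod sem (P ++ Q) s u (f ≫ g) := by
  have := Sem.append h h'
  simpa [Computes, flat] using this

lemma of_can {f : s.obj ty ⟶ t.obj ty} (hn : s.wires.Nodup) (h : Can ty s.wires t.wires (flat f)) :
    Computes dom cod sem [] s t f := Sem.nil _ _ _ hn h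

lemma id (s : Shape τ) (hn : s.wires.Nodup := by decide) : Computes dom cod sem [] s s (𝟙 _) := by
  refine of_can hn ?_
  simpa [flat] using Can.refl s.wires

lemma flat_assoc (s t u : Shape τ) :
    (flat (t := .tensor (.tensor s t) u) (u := .tensor s (.tensor t u)) (ty := ty)
      ((α_ (s.obj ty) (t.obj ty) (u.obj ty)).hom)) = reassocTw ty s.wires t.wires u.wires :=
  associator_conj (s.iso ty) (t.iso ty) (u.iso ty) (spl ty s.wires t.wires)
    (spl ty (s.wires ++ t.wires) u.wires) (spl ty t.wires u.wires)
    (spl ty s.wires (t.wires ++ u.wires))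

lemma assoc (s t u : Shape τ) (hn : (Shape.tensor (.tensor s t) u).wires.Nodup := by decide) :
    Computes dom cod sem [] (.tensor (.tensor s t) u) (.tensor s (.tensor t u))
      ((α_ (s.obj ty) (t.obj ty) (u.obj ty)).hom) := by
  refine of_can hn ?_
  rw [flat_assoc]
  exact can_reassocTw _ _ _

/-- A morphism computed by the empty program is canonical and has a canonical inverse; a one-sided
inverse already has to coincide with it. -/
lemma of_inv {f : s.obj ty ⟶ t.obj ty} {g : t.obj ty ⟶ s.obj ty}
    (h : Computes dom cod sem [] s t f) (hgf : g ≫ f = 𝟙 _) :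
    Computes dom cod sem [] t s g := by
  cases h with
  | nil _ _ _ hn hf =>
    obtain ⟨k, hk, h₁, h₂⟩ := hf.inv hn
    refine of_can (hf.perm.nodup_iff.1 hn) ?_
    have : flat g = k := by
      have h₃ : flat g ≫ flat f = 𝟙 _ := by simp [flat, reassoc_of% hgf]
      have := congrArg (fun x => x ≫ k) h₃
      simpa [h₁] using this
    rwa [this]

lemma assocInv (s t u : Shape τ) (hn : (Shape.tensor (.tensor s t) u).wires.Nodup := by decide) :
    Computes dom cod sem [] (.tensor s (.tensor t u)) (.tensor (.tensor s t) u)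
      ((α_ (s.obj ty) (t.obj ty) (u.obj ty)).inv) :=
  of_inv (assoc s t u hn) (Iso.inv_hom_id _)

lemma braid (s t : Shape τ) (hn : (Shape.tensor s t).wires.Nodup := by decide) :
    Computes dom cod sem [] (.tensor s t) (.tensor t s) (β_ (s.obj ty) (t.obj ty)).hom := by
  refine of_can hn ?_
  refine cast ?_ (can_braid (ty := ty) s.wires t.wires)
  congr 1
  change _ = ((spl ty s.wires t.wires).hom ≫ ((s.iso ty).inv ⊗ₘ (t.iso ty).inv)) ≫ (β_ _ _).hom ≫
    ((t.iso ty).hom ⊗ₘ (s.iso ty).hom) ≫ (spl ty t.wires s.wires).inv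
  rw [← BraidedCategory.braiding_naturality_assoc]
  simp

lemma leftUnitor (t : Shape τ) (hn : t.wires.Nodup := by decide) :
    Computes dom cod sem [] (.tensor .unit t) t (λ_ (t.obj ty)).hom := by
  refine of_can hn ?_
  refine cast ?_ (Can.refl (ty := ty) t.wires)
  congr 1
  change 𝟙 _ = ((λ_ _).inv ≫ (𝟙 (𝟙_ C) ⊗ₘ (t.iso ty).inv)) ≫ (λ_ _).hom ≫ (t.iso ty).hom
  simp

lemma leftUnitorInv (t : Shape τ) (hn : t.wires.Nodup := by decide) :
    Computes dom cod sem [] t (.tensor .unit t) (λ_ (t.obj ty)).inv :=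
  of_inv (leftUnitor t hn) (Iso.inv_hom_id _)

lemma can_append_nil (I : List (Wire τ)) : Can ty I (I ++ []) ((ρ_ _).inv ≫ (spl ty I []).inv) := by
  induction I with
  | nil =>
    refine cast ?_ (Can.nil (ty := ty))
    congr 1
    change 𝟙 (𝟙_ C) = (ρ_ (𝟙_ C)).inv ≫ (λ_ _).hom
    simp [unitors_equal]
  | cons w I ih =>
    refine cast ?_ (ih.whisker w)
    congr 1
    exact whisker_rightUnitor (spl ty I []).inv

lemma rightUnitorInv (t : Shape τ) (hn : t.wires.Nodup := by decide) :
    Computes dom cod sem [] t (.tensor t .unit) (ρ_ (t.obj ty)).inv := by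
  refine of_can hn ?_
  refine cast ?_ (can_append_nil (ty := ty) t.wires)
  congr 1
  exact rightUnitor_conj (t.iso ty) (spl ty t.wires []).inv

lemma rightUnitor (t : Shape τ) (hn : t.wires.Nodup := by decide) :
    Computes dom cod sem [] (.tensor t .unit) t (ρ_ (t.obj ty)).hom :=
  of_inv (rightUnitorInv t hn) (Iso.hom_inv_id _)

lemma whiskerRight {f : s.obj ty ⟶ t.obj ty} (h : Computes dom cod sem P s t f) (v : Shape τ)
    (hn : (s.wires ++ v.wires).Nodup := by decide)
    (hd : ∀ x ∈ P, ∀ w ∈ x.outs, w ∉ v.wires := by decide) :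
    Computes dom cod sem P (.tensor s v) (.tensor t v) (f ▷ v.obj ty) := by
  refine cast ?_ (Sem.frame h hn fun x hx w hw hw' => hd x hx w hw hw')
  congr 1
  change (spl ty s.wires v.wires).hom ≫ ((s.iso ty).inv ≫ f ≫ (t.iso ty).hom) ▷ _ ≫
    (spl ty t.wires v.wires).inv =
    ((spl ty s.wires v.wires).hom ≫ ((s.iso ty).inv ⊗ₘ (v.iso ty).inv)) ≫ f ▷ v.obj ty ≫
      ((t.iso ty).hom ⊗ₘ (v.iso ty).hom) ≫ (spl ty t.wires v.wires).inv
  simp only [MonoidalCategory.tensorHom_def, Category.assoc, comp_whiskerRight,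
    whisker_exchange_assoc]
  simp

/-- Idle wires stand on the right in a run, so left whiskering is obtained by conjugating right
whiskering with braidings. -/
lemma whiskerLeft (v : Shape τ) {f : s.obj ty ⟶ t.obj ty} (h : Computes dom cod sem P s t f)
    (hn : (s.wires ++ v.wires).Nodup := by decide)
    (hd : ∀ x ∈ P, ∀ w ∈ x.outs, w ∉ v.wires := by decide)
    (hn' : (t.wires ++ v.wires).Nodup := by decide) :
    Computes dom cod sem P (.tensor v s) (.tensor v t) (v.obj ty ◁ f) := by
  have := (braid (dom := dom) (cod := cod) (sem := sem) (ty := ty) v s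
    (List.perm_append_comm.nodup_iff.1 hn)).comp
    ((h.whiskerRight v hn hd).comp (braid t v hn'))
  have e : v.obj ty ◁ f = (β_ (v.obj ty) (s.obj ty)).hom ≫ f ▷ v.obj ty ≫
      (β_ (t.obj ty) (v.obj ty)).hom := by
    rw [BraidedCategory.braiding_naturality_left]
    simp
  have h₂ : Computes dom cod sem ([] ++ (P ++ [])) (.tensor v s) (.tensor v t) (v.obj ty ◁ f) := by
    rw [e]; exact this
  simpa using h₂

lemma tensorHom {s' t' : Shape τ} {f : s.obj ty ⟶ t.obj ty} {g : s'.obj ty ⟶ t'.obj ty}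
    (h : Computes dom cod sem P s t f) (h' : Computes dom cod sem Q s' t' g)
    (hn : (s.wires ++ s'.wires).Nodup := by decide)
    (hd : ∀ x ∈ P, ∀ w ∈ x.outs, w ∉ s'.wires := by decide)
    (hn₂ : (s'.wires ++ t.wires).Nodup := by decide)
    (hd' : ∀ x ∈ Q, ∀ w ∈ x.outs, w ∉ t.wires := by decide)
    (hn₃ : (t'.wires ++ t.wires).Nodup := by decide) :
    Computes dom cod sem (P ++ Q) (.tensor s s') (.tensor t t') (f ⊗ₘ g) := by
  have e := MonoidalCategory.tensorHom_def f g
  have := (h.whiskerRight s' hn hd).comp (h'.whiskerLeft t hn₂ hd' hn₃)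
  rw [e]
  exact this

lemma of_den {x : Step τ κ} {f : tw ty x.ins ⟶ tw ty x.outs} (h : Den dom cod sem x f)
    (hn : x.ins.Nodup) (hn' : x.outs.Nodup) : Sem dom cod sem [x] x.ins x.outs f := by
  have c := can_append_nil (ty := ty) x.ins
  have hO : (x.outs ++ []).Nodup := by simpa using hn'
  obtain ⟨d, hd, h₁, -⟩ := (can_append_nil (ty := ty) x.outs).inv hn'
  refine cast ?_ (Sem.cons x [] _ _ [] _ f _ hn c h (Sem.nil _ _ _ hO hd))
  congr 1
  exact rightUnitor_frame (spl ty x.ins []) (spl ty x.outs []) f h₁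

/-- The object of a list of wires depends on the types and not on the names. The flattening of a
structure morphism is thus the same for all names, and `HEq` only bridges two presentations of the
lists of types. -/
lemma generator {f : t.obj ty ⟶ u.obj ty} {k : κ} (h₁ : t.wires.map Prod.fst = dom k)
    (h₂ : u.wires.map Prod.fst = cod k) (hf : HEq (flat f) (sem k))
    (hn : t.wires.Nodup) (hn' : u.wires.Nodup) :
    Computes dom cod sem [⟨k, t.wires, u.wires⟩] t u f := by
  exact of_den (x := ⟨k, t.wires, u.wires⟩) ⟨h₁, h₂,
    eq_eqToHom_of_heq (congrArg (ten ty) h₁) (congrArg (ten ty) h₂) hf⟩ hn hn'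

lemma eqv {f g : t.obj ty ⟶ u.obj ty} (h : Computes dom cod sem P t u f)
    (h' : Computes dom cod sem Q t u g) (e : f = g) : Eqv dom cod sem P Q t.wires u.wires :=
  ⟨_, h, e ▸ h'⟩

lemma eq_of_imp {f g : t.obj ty ⟶ u.obj ty} (h : Computes dom cod sem P t u f)
    (h' : Computes dom cod sem Q t u g) (e : Imp dom cod sem P Q t.wires u.wires) : f = g :=
  flat_injective ((e _ h).unique h')

end Computes

end

end WirePrograms

namespace WeakHopfQuasi

open WirePrograms

universe v u

/-! ### The signature of comodule magmas over a weak Hopf quasigroup. -/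

section Signature

/-- Types of wires: the weak Hopf quasigroup `H`, the comodule magma `A` and
an object `B`. -/
inductive Ty
  | H
  | A
  | B
  deriving DecidableEq

/-- Names of the structure morphisms. -/
inductive Op
  | mulH | mulA | oneH | oneA | comul | counit | coact | lam | tgt | src | bar | inc | clu
  | fst | snd | prj
  deriving DecidableEq

namespace Op

/-- The types of the arguments of an operation. -/
def dom : Op → List Ty
  | mulH => [.H, .H]
  | mulA => [.A, .A]
  | oneH => []
  | oneA => []
  | comul => [.H]
  | counit => [.H]
  | coact => [.A]
  | lam => [.H]
  | tgt => [.H]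
  | src => [.H]
  | bar => [.H]
  | inc => [.B]
  | clu => [.H]
  | fst => [.H]
  | snd => [.H]
  | prj => [.A]

/-- The types of the results of an operation. -/
def cod : Op → List Ty
  | mulH => [.H]
  | mulA => [.A]
  | oneH => [.H]
  | oneA => [.A]
  | comul => [.H, .H]
  | counit => []
  | coact => [.A, .H]
  | lam => [.H]
  | tgt => [.H]
  | src => [.H]
  | bar => [.H]
  | inc => [.A]
  | clu => [.A]
  | fst => [.A]
  | snd => [.A]
  | prj => [.B]

end Op

variable {C : Type u} [Category.{v} C] [MonoidalCategory C] [SymmetricCategory C]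

variable (H A B : C) [WeakHopfQuasigroup H] [UnitalMagmaObj A] [RightComoduleMagma H A]

/-- The object named by a type. -/
def obj : Ty → C
  | .H => H
  | .A => A
  | .B => B

/-- The right-hand side of the first cleftness condition. -/
def cleftUnit : H ⟶ A :=
  (ρ_ H).inv ≫ H ◁ (un A ≫ rho H A) ≫ (α_ H A H).inv ≫ (β_ H A).hom ▷ H ≫
      (α_ A H H).hom ≫ A ◁ (mu H ≫ ε[H]) ≫ (ρ_ A).hom

/-- Additional morphisms: a candidate for a cleaving morphism with its inverse, and an object `B`
with morphisms from and to `A`. -/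
structure Env where
  h : H ⟶ A
  k : H ⟶ A
  j : B ⟶ A
  q : A ⟶ B

variable {H A B}

/-- A wire of type `H`. -/
abbrev x (n : ℕ) : Wire Ty := (.H, n)
/-- A wire of type `A`. -/
abbrev a (n : ℕ) : Wire Ty := (.A, n)
/-- A wire of type `B`. -/
abbrev b (n : ℕ) : Wire Ty := (.B, n)

/-- A single wire as a bracketed list. -/
abbrev tx (n : ℕ) : Shape Ty := .wire (.H, n)
/-- A single wire as a bracketed list. -/
abbrev ta (n : ℕ) : Shape Ty := .wire (.A, n)
/-- A single wire as a bracketed list. -/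
abbrev tb (n : ℕ) : Shape Ty := .wire (.B, n)

variable (E : Env H A B)

/-- The morphisms denoted by the operations. -/
def Env.sem : ∀ k : Op, ten (obj H A B) k.dom ⟶ ten (obj H A B) k.cod
  | .mulH => flat (t := .tensor (tx 0) (tx 1)) (u := tx 0) (ty := obj H A B) (mu H)
  | .mulA => flat (t := .tensor (ta 0) (ta 1)) (u := ta 0) (ty := obj H A B) (mu A)
  | .oneH => flat (t := .unit) (u := tx 0) (ty := obj H A B) (un H)
  | .oneA => flat (t := .unit) (u := ta 0) (ty := obj H A B) (un A)
  | .comul => flat (t := tx 0) (u := .tensor (tx 0) (tx 1)) (ty := obj H A B) (Δ[H])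
  | .counit => flat (t := tx 0) (u := .unit) (ty := obj H A B) (ε[H])
  | .coact => flat (t := ta 0) (u := .tensor (ta 0) (tx 1)) (ty := obj H A B) (rho H A)
  | .lam => flat (t := tx 0) (u := tx 0) (ty := obj H A B) (WeakHopfQuasigroup.antipode : H ⟶ H)
  | .tgt => flat (t := tx 0) (u := tx 0) (ty := obj H A B) (target H)
  | .src => flat (t := tx 0) (u := tx 0) (ty := obj H A B)
      (conv WeakHopfQuasigroup.antipode (𝟙 H) : H ⟶ H)
  | .bar => flat (t := tx 0) (u := tx 0) (ty := obj H A B) (barSource H)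
  | .inc => flat (t := tb 0) (u := ta 0) (ty := obj H A B) E.j
  | .clu => flat (t := tx 0) (u := ta 0) (ty := obj H A B) (cleftUnit H A)
  | .fst => flat (t := tx 0) (u := ta 0) (ty := obj H A B) E.h
  | .snd => flat (t := tx 0) (u := ta 0) (ty := obj H A B) E.k
  | .prj => flat (t := ta 0) (u := tb 0) (ty := obj H A B) E.q

/-- Programs in the structure morphisms. -/
abbrev Prog := List (Step Ty Op)

/-- `P` computes `f`. -/
abbrev Env.Comp (P : Prog) (t u : Shape Ty) (f : t.obj (obj H A B) ⟶ u.obj (obj H A B)) : Prop :=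
  Computes Op.dom Op.cod E.sem P t u f

/-- The programs `P` and `Q` have the same meaning. -/
abbrev Env.Eq (P Q : Prog) (L M : List (Wire Ty)) : Prop := Eqv Op.dom Op.cod E.sem P Q L M

/-- `k ← i j` for the product of `H`. -/
abbrev mulH (i j k : ℕ) : Step Ty Op := ⟨.mulH, [x i, x j], [x k]⟩
abbrev mulA (i j k : ℕ) : Step Ty Op := ⟨.mulA, [a i, a j], [a k]⟩
abbrev oneH (k : ℕ) : Step Ty Op := ⟨.oneH, [], [x k]⟩
abbrev oneA (k : ℕ) : Step Ty Op := ⟨.oneA, [], [a k]⟩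
abbrev comul (i j k : ℕ) : Step Ty Op := ⟨.comul, [x i], [x j, x k]⟩
abbrev counit (i : ℕ) : Step Ty Op := ⟨.counit, [x i], []⟩
abbrev coact (i j k : ℕ) : Step Ty Op := ⟨.coact, [a i], [a j, x k]⟩
abbrev lam (i j : ℕ) : Step Ty Op := ⟨.lam, [x i], [x j]⟩
abbrev tgt (i j : ℕ) : Step Ty Op := ⟨.tgt, [x i], [x j]⟩
abbrev src (i j : ℕ) : Step Ty Op := ⟨.src, [x i], [x j]⟩
abbrev bar (i j : ℕ) : Step Ty Op := ⟨.bar, [x i], [x j]⟩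
abbrev inc (i j : ℕ) : Step Ty Op := ⟨.inc, [b i], [a j]⟩
abbrev clu (i j : ℕ) : Step Ty Op := ⟨.clu, [x i], [a j]⟩
abbrev fst (i j : ℕ) : Step Ty Op := ⟨.fst, [x i], [a j]⟩
abbrev snd (i j : ℕ) : Step Ty Op := ⟨.snd, [x i], [a j]⟩
abbrev prj (i j : ℕ) : Step Ty Op := ⟨.prj, [a i], [b j]⟩

section Generators

lemma comp_mulH (i j k : ℕ) (h : i ≠ j := by decide) :
    E.Comp [mulH i j k] (.tensor (tx i) (tx j)) (tx k) (mu H) :=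
  .generator (ty := obj H A B) (sem := E.sem) (t := (.tensor (tx i) (tx j))) (u := (tx k))
    (k := .mulH) rfl rfl HEq.rfl (by simpa [Shape.wires] using h) (by simp [Shape.wires])

lemma comp_mulA (i j k : ℕ) (h : i ≠ j := by decide) :
    E.Comp [mulA i j k] (.tensor (ta i) (ta j)) (ta k) (mu A) :=
  .generator (ty := obj H A B) (sem := E.sem) (t := (.tensor (ta i) (ta j))) (u := (ta k))
    (k := .mulA) rfl rfl HEq.rfl (by simpa [Shape.wires] using h) (by simp [Shape.wires])

lemma comp_oneH (i : ℕ) :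
    E.Comp [oneH i] .unit (tx i) (un H) :=
  .generator (ty := obj H A B) (sem := E.sem) (t := .unit) (u := (tx i))
    (k := .oneH) rfl rfl HEq.rfl (by simp [Shape.wires]) (by simp [Shape.wires])

lemma comp_oneA (i : ℕ) :
    E.Comp [oneA i] .unit (ta i) (un A) :=
  .generator (ty := obj H A B) (sem := E.sem) (t := .unit) (u := (ta i))
    (k := .oneA) rfl rfl HEq.rfl (by simp [Shape.wires]) (by simp [Shape.wires])

lemma comp_comul (i j k : ℕ) (h : j ≠ k := by decide) :
    E.Comp [comul i j k] (tx i) (.tensor (tx j) (tx k)) (Δ[H]) :=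
  .generator (ty := obj H A B) (sem := E.sem) (t := (tx i)) (u := (.tensor (tx j) (tx k)))
    (k := .comul) rfl rfl HEq.rfl (by simp [Shape.wires]) (by simpa [Shape.wires] using h)

lemma comp_counit (i : ℕ) :
    E.Comp [counit i] (tx i) .unit (ε[H]) :=
  .generator (ty := obj H A B) (sem := E.sem) (t := (tx i)) (u := .unit)
    (k := .counit) rfl rfl HEq.rfl (by simp [Shape.wires]) (by simp [Shape.wires])

lemma comp_coact (i j k : ℕ) :
    E.Comp [coact i j k] (ta i) (.tensor (ta j) (tx k)) (rho H A) :=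
  .generator (ty := obj H A B) (sem := E.sem) (t := (ta i)) (u := (.tensor (ta j) (tx k)))
    (k := .coact) rfl rfl HEq.rfl (by simp [Shape.wires]) (by simp [Shape.wires])

lemma comp_lam (i j : ℕ) :
    E.Comp [lam i j] (tx i) (tx j) (WeakHopfQuasigroup.antipode : H ⟶ H) :=
  .generator (ty := obj H A B) (sem := E.sem) (t := (tx i)) (u := (tx j))
    (k := .lam) rfl rfl HEq.rfl (by simp [Shape.wires]) (by simp [Shape.wires])

lemma comp_tgt (i j : ℕ) :
    E.Comp [tgt i j] (tx i) (tx j) (target H) :=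
  .generator (ty := obj H A B) (sem := E.sem) (t := (tx i)) (u := (tx j))
    (k := .tgt) rfl rfl HEq.rfl (by simp [Shape.wires]) (by simp [Shape.wires])

lemma comp_src (i j : ℕ) :
    E.Comp [src i j] (tx i) (tx j) (conv WeakHopfQuasigroup.antipode (𝟙 H) : H ⟶ H) :=
  .generator (ty := obj H A B) (sem := E.sem) (t := (tx i)) (u := (tx j))
    (k := .src) rfl rfl HEq.rfl (by simp [Shape.wires]) (by simp [Shape.wires])

lemma comp_bar (i j : ℕ) :
    E.Comp [bar i j] (tx i) (tx j) (barSource H) :=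
  .generator (ty := obj H A B) (sem := E.sem) (t := (tx i)) (u := (tx j))
    (k := .bar) rfl rfl HEq.rfl (by simp [Shape.wires]) (by simp [Shape.wires])

lemma comp_inc (i j : ℕ) :
    E.Comp [inc i j] (tb i) (ta j) E.j :=
  .generator (ty := obj H A B) (sem := E.sem) (t := (tb i)) (u := (ta j))
    (k := .inc) rfl rfl HEq.rfl (by simp [Shape.wires]) (by simp [Shape.wires])

lemma comp_clu (i j : ℕ) :
    E.Comp [clu i j] (tx i) (ta j) (cleftUnit H A) :=
  .generator (ty := obj H A B) (sem := E.sem) (t := (tx i)) (u := (ta j))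
    (k := .clu) rfl rfl HEq.rfl (by simp [Shape.wires]) (by simp [Shape.wires])

lemma comp_fst (i j : ℕ) :
    E.Comp [fst i j] (tx i) (ta j) (E.h) :=
  .generator (ty := obj H A B) (sem := E.sem) (t := (tx i)) (u := (ta j))
    (k := .fst) rfl rfl HEq.rfl (by simp [Shape.wires]) (by simp [Shape.wires])

lemma comp_snd (i j : ℕ) :
    E.Comp [snd i j] (tx i) (ta j) (E.k) :=
  .generator (ty := obj H A B) (sem := E.sem) (t := (tx i)) (u := (ta j))
    (k := .snd) rfl rfl HEq.rfl (by simp [Shape.wires]) (by simp [Shape.wires])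

lemma comp_prj (i j : ℕ) :
    E.Comp [prj i j] (ta i) (tb j) (E.q) :=
  .generator (ty := obj H A B) (sem := E.sem) (t := (ta i)) (u := (tb j))
    (k := .prj) rfl rfl HEq.rfl (by simp [Shape.wires]) (by simp [Shape.wires])

end Generators

end Signature

section Programs

variable {C : Type u} [Category.{v} C] [MonoidalCategory C] [SymmetricCategory C]

variable {H A B : C} [WeakHopfQuasigroup H] [UnitalMagmaObj A] [RightComoduleMagma H A]
  (E : Env H A B)

/-! ### The axioms as equations between programs -/

/-- One output of the comultiplication reuses the name 0, so that input and output agree with those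
of the empty program. -/
lemma eq_counit_comul : E.Eq [comul 0 1 0, counit 1] [] [x 0] [x 0] :=
  ((comp_comul E 0 1 0).comp (((comp_counit E 1).whiskerRight (tx 0)).comp
    (.leftUnitor (tx 0)))).eqv (.id (tx 0))
    ((ComonObj.counit_comul_assoc H _).trans (Iso.inv_hom_id _))

lemma eq_comul_counit : E.Eq [comul 0 0 1, counit 1] [] [x 0] [x 0] :=
  ((comp_comul E 0 0 1).comp (((comp_counit E 1).whiskerLeft (tx 0)).comp
    (.rightUnitor (tx 0)))).eqv (.id (tx 0))
    ((ComonObj.comul_counit_assoc H _).trans (Iso.inv_hom_id _))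

lemma eq_comul_comul : E.Eq [comul 0 4 3, comul 4 1 2] [comul 0 1 4, comul 4 2 3]
    [x 0] [x 1, x 2, x 3] :=
  ((comp_comul E 0 4 3).comp (((comp_comul E 4 1 2).whiskerRight (tx 3)).comp
    (.assoc (tx 1) (tx 2) (tx 3)))).eqv
    ((comp_comul E 0 1 4).comp ((comp_comul E 4 2 3).whiskerLeft (tx 1)))
    (ComonObj.comul_assoc H).symm

lemma eq_one_mul : E.Eq [oneH 1, mulH 1 0 0] [] [x 0] [x 0] :=
  ((Computes.leftUnitorInv (tx 0)).comp (((comp_oneH E 1).whiskerRight (tx 0)).comp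
    (comp_mulH E 1 0 0))).eqv (.id (tx 0))
    ((congrArg (fun t => (λ_ H).inv ≫ t) UnitalMagmaObj.one_mul).trans (Iso.inv_hom_id _))

lemma eq_mul_one : E.Eq [oneH 1, mulH 0 1 0] [] [x 0] [x 0] :=
  ((Computes.rightUnitorInv (tx 0)).comp (((comp_oneH E 1).whiskerLeft (tx 0)).comp
    (comp_mulH E 0 1 0))).eqv (.id (tx 0))
    ((congrArg (fun t => (ρ_ H).inv ≫ t) UnitalMagmaObj.mul_one).trans (Iso.inv_hom_id _))

lemma eq_one_mulA : E.Eq [oneA 1, mulA 1 0 0] [] [a 0] [a 0] :=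
  ((Computes.leftUnitorInv (ta 0)).comp (((comp_oneA E 1).whiskerRight (ta 0)).comp
    (comp_mulA E 1 0 0))).eqv (.id (ta 0))
    ((congrArg (fun t => (λ_ A).inv ≫ t) UnitalMagmaObj.one_mul).trans (Iso.inv_hom_id _))

lemma eq_mul_oneA : E.Eq [oneA 1, mulA 0 1 0] [] [a 0] [a 0] :=
  ((Computes.rightUnitorInv (ta 0)).comp (((comp_oneA E 1).whiskerLeft (ta 0)).comp
    (comp_mulA E 0 1 0))).eqv (.id (ta 0))
    ((congrArg (fun t => (ρ_ A).inv ≫ t) UnitalMagmaObj.mul_one).trans (Iso.inv_hom_id _))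

lemma comp_tensorMu {X₁ X₂ Y₁ Y₂ : Shape Ty}
    (hn : (Shape.tensor (.tensor X₁ X₂) (.tensor Y₁ Y₂)).wires.Nodup) :
    E.Comp [] (.tensor (.tensor X₁ X₂) (.tensor Y₁ Y₂)) (.tensor (.tensor X₁ Y₁) (.tensor X₂ Y₂))
      (tensorμ (X₁.obj (obj H A B)) (X₂.obj (obj H A B)) (Y₁.obj (obj H A B)) (Y₂.obj (obj H A B))) := by
  simp only [Shape.wires, List.nodup_append', List.disjoint_append_left,
    List.disjoint_append_right] at hn
  have h := hn
  obtain ⟨⟨h₁, h₂, h₁₂⟩, ⟨h₃, h₄, h₃₄⟩, ⟨h₁₃, h₂₃⟩, ⟨h₁₄, h₂₄⟩⟩ := hn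
  have n : ∀ X Y : Shape Ty, X.wires.Nodup → Y.wires.Nodup → X.wires.Disjoint Y.wires →
    (X.wires ++ Y.wires).Nodup := fun X Y a b c => List.nodup_append'.2 ⟨a, b, c⟩
  refine Computes.comp (Q := []) (.assoc X₁ X₂ (.tensor Y₁ Y₂) ?_)
    (.comp (P := []) (Q := []) (.whiskerLeft X₁ (.assocInv X₂ Y₁ Y₂ ?_) ?_ (by simp) ?_)
    (.comp (P := []) (Q := [])
      (.whiskerLeft X₁ (.whiskerRight (.braid X₂ Y₁ ?_) Y₂ ?_ (by simp)) ?_ (by simp) ?_)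
    (.comp (P := []) (Q := []) (.whiskerLeft X₁ (.assoc Y₁ X₂ Y₂ ?_) ?_ (by simp) ?_)
      (.assocInv X₁ Y₁ (.tensor X₂ Y₂) ?_)))) <;>
  simp only [Shape.wires, List.nodup_append', List.disjoint_append_left,
    List.disjoint_append_right, h₁, h₂, h₃, h₄, h₁₂, h₁₃, h₁₄, h₂₃, h₂₄, h₃₄, h₁₂.symm, h₁₃.symm,
    h₁₄.symm, h₂₃.symm, and_self]

lemma eq_mul_comul : E.Eq [mulH 0 1 4, comul 4 2 3]
    [comul 0 4 5, comul 1 6 7, mulH 4 6 2, mulH 5 7 3] [x 0, x 1] [x 2, x 3] :=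
  ((comp_mulH E 0 1 4).comp (comp_comul E 4 2 3)).eqv
    (((comp_comul E 0 4 5).tensorHom (comp_comul E 1 6 7)).comp
      ((comp_tensorMu E (by decide)).comp ((comp_mulH E 4 6 2).tensorHom (comp_mulH E 5 7 3))))
    (WeakHopfQuasigroup.mul_comul (H := H))

lemma eq_counit_assoc : E.Eq [mulH 0 1 3, mulH 3 2 4, counit 4] [mulH 1 2 3, mulH 0 3 4, counit 4]
    [x 0, x 1, x 2] [] :=
  (((comp_mulH E 0 1 3).whiskerRight (tx 2)).comp ((comp_mulH E 3 2 4).comp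
    (comp_counit E 4))).eqv
    (.comp (.assoc (tx 0) (tx 1) (tx 2)) (((comp_mulH E 1 2 3).whiskerLeft (tx 0)).comp
      ((comp_mulH E 0 3 4).comp (comp_counit E 4))))
    (WeakHopfQuasigroup.counit_assoc (H := H))

lemma eq_counit_split' : E.Eq [mulH 0 1 3, mulH 3 2 4, counit 4]
    [comul 1 4 3, mulH 0 3 5, counit 5, mulH 4 2 6, counit 6] [x 0, x 1, x 2] [] :=
  (((comp_mulH E 0 1 3).whiskerRight (tx 2)).comp ((comp_mulH E 3 2 4).comp
    (comp_counit E 4))).eqv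
    (((((comp_comul E 1 4 3).comp (.braid (tx 4) (tx 3))).whiskerLeft (tx 0)).whiskerRight
      (tx 2)).comp
      ((((Computes.assocInv (tx 0) (tx 3) (tx 4)).whiskerRight (tx 2)).comp
        (.assoc (.tensor (tx 0) (tx 3)) (tx 4) (tx 2))).comp
      ((((comp_mulH E 0 3 5).comp (comp_counit E 5)).tensorHom
        ((comp_mulH E 4 2 6).comp (comp_counit E 6))).comp (.leftUnitor .unit))))
    (WeakHopfQuasigroup.counit_split' (H := H))

lemma comp_unit_comul (i j k : ℕ) (h : j ≠ k := by decide) :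
    E.Comp [oneH i, comul i j k] .unit (.tensor (tx j) (tx k)) (un H ≫ Δ[H]) :=
  (comp_oneH E i).comp (comp_comul E i j k h)

lemma eq_unit_split : E.Eq [oneH 3, comul 3 4 2, comul 4 0 1]
    [oneH 3, comul 3 0 4, oneH 5, comul 5 6 2, mulH 4 6 1] [] [x 0, x 1, x 2] :=
  ((comp_oneH E 3).comp ((comp_comul E 3 4 2).comp ((comp_comul E 4 0 1).whiskerRight (tx 2)))).eqv
    (.comp (.leftUnitorInv .unit) (((comp_unit_comul E 3 0 4).tensorHom
      (comp_unit_comul E 5 6 2)).comp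
      ((Computes.comp (.assocInv (.tensor (tx 0) (tx 4)) (tx 6) (tx 2))
        (.whiskerRight (.assoc (tx 0) (tx 4) (tx 6)) (tx 2))).comp
      (((comp_mulH E 4 6 1).whiskerLeft (tx 0)).whiskerRight (tx 2)))))
    (WeakHopfQuasigroup.unit_split (H := H))

lemma eq_unit_split' : E.Eq [oneH 3, comul 3 4 2, comul 4 0 1]
    [oneH 3, comul 3 0 4, oneH 5, comul 5 6 2, mulH 6 4 1] [] [x 0, x 1, x 2] :=
  ((comp_oneH E 3).comp ((comp_comul E 3 4 2).comp ((comp_comul E 4 0 1).whiskerRight (tx 2)))).eqv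
    (.comp (.leftUnitorInv .unit) (((comp_unit_comul E 3 0 4).tensorHom
      (comp_unit_comul E 5 6 2)).comp
      ((Computes.comp (.assocInv (.tensor (tx 0) (tx 4)) (tx 6) (tx 2))
        (.whiskerRight (.assoc (tx 0) (tx 4) (tx 6)) (tx 2))).comp
      (((Computes.comp (.braid (tx 4) (tx 6)) (comp_mulH E 6 4 1)).whiskerLeft
        (tx 0)).whiskerRight (tx 2)))))
    (WeakHopfQuasigroup.unit_split' (H := H))

lemma eq_tgt : E.Eq [tgt 0 1] [oneH 2, comul 2 3 1, mulH 3 0 4, counit 4] [x 0] [x 1] :=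
  (comp_tgt E 0 1).eqv
    (.comp (.leftUnitorInv (tx 0)) (((comp_unit_comul E 2 3 1).whiskerRight (tx 0)).comp
      (.comp (.assoc (tx 3) (tx 1) (tx 0)) (.comp (.whiskerLeft (tx 3) (.braid (tx 1) (tx 0)))
      (.comp (.assocInv (tx 3) (tx 0) (tx 1)) ((((comp_mulH E 3 0 4).comp
        (comp_counit E 4)).whiskerRight (tx 1)).comp (.leftUnitor (tx 1))))))))
    (WeakHopfQuasigroup.target_eq (H := H))

lemma eq_src : E.Eq [src 0 1] [oneH 2, comul 2 1 3, mulH 0 3 4, counit 4] [x 0] [x 1] :=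
  (comp_src E 0 1).eqv
    (.comp (.rightUnitorInv (tx 0)) (((comp_unit_comul E 2 1 3).whiskerLeft (tx 0)).comp
      (.comp (.assocInv (tx 0) (tx 1) (tx 3)) (.comp (.whiskerRight (.braid (tx 0) (tx 1)) (tx 3))
      (.comp (.assoc (tx 1) (tx 0) (tx 3)) ((((comp_mulH E 0 3 4).comp
        (comp_counit E 4)).whiskerLeft (tx 1)).comp (.rightUnitor (tx 1))))))))
    (WeakHopfQuasigroup.source_eq (H := H))

lemma eq_bar : E.Eq [bar 0 1] [oneH 2, comul 2 3 1, mulH 0 3 4, counit 4] [x 0] [x 1] :=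
  (comp_bar E 0 1).eqv
    (.comp (.rightUnitorInv (tx 0)) (((comp_unit_comul E 2 3 1).whiskerLeft (tx 0)).comp
      (.comp (.assocInv (tx 0) (tx 3) (tx 1)) ((((comp_mulH E 0 3 4).comp
        (comp_counit E 4)).whiskerRight (tx 1)).comp (.leftUnitor (tx 1)))))) rfl

lemma comp_unit_coact (i j k : ℕ) :
    E.Comp [oneA i, coact i j k] .unit (.tensor (ta j) (tx k)) (un A ≫ rho H A) :=
  (comp_oneA E i).comp (comp_coact E i j k)

lemma eq_clu : E.Eq [clu 0 1] [oneA 2, coact 2 1 3, mulH 0 3 4, counit 4] [x 0] [a 1] :=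
  (comp_clu E 0 1).eqv
    (.comp (.rightUnitorInv (tx 0)) (((comp_unit_coact E 2 1 3).whiskerLeft (tx 0)).comp
      (.comp (.assocInv (tx 0) (ta 1) (tx 3)) (.comp (.whiskerRight (.braid (tx 0) (ta 1)) (tx 3))
      (.comp (.assoc (ta 1) (tx 0) (tx 3)) ((((comp_mulH E 0 3 4).comp
        (comp_counit E 4)).whiskerLeft (ta 1)).comp (.rightUnitor (ta 1)))))))) rfl

lemma eq_src_lam : E.Eq [comul 0 2 3, src 2 4, lam 3 5, mulH 4 5 1] [lam 0 1] [x 0] [x 1] :=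
  ((comp_comul E 0 2 3).comp (((comp_src E 2 4).tensorHom (comp_lam E 3 5)).comp
    (comp_mulH E 4 5 1))).eqv (comp_lam E 0 1)
    (WeakHopfQuasigroup.source_conv_antipode (H := H))

lemma eq_mul_mul_lam : E.Eq [comul 1 3 4, mulH 0 3 5, lam 4 6, mulH 5 6 2] [tgt 1 3, mulH 0 3 2]
    [x 0, x 1] [x 2] :=
  (((comp_comul E 1 3 4).whiskerLeft (tx 0)).comp (.comp (.assocInv (tx 0) (tx 3) (tx 4))
    (((comp_mulH E 0 3 5).tensorHom (comp_lam E 4 6)).comp (comp_mulH E 5 6 2)))).eqv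
    (((comp_tgt E 1 3).whiskerLeft (tx 0)).comp (comp_mulH E 0 3 2))
    (WeakHopfQuasigroup.mul_mul_antipode (H := H))

lemma eq_coact_counit : E.Eq [coact 0 0 1, counit 1] [] [a 0] [a 0] :=
  ((comp_coact E 0 0 1).comp (((comp_counit E 1).whiskerLeft (ta 0)).comp
    (.rightUnitor (ta 0)))).eqv (.id (ta 0))
    (by
      have := congrArg (fun t => t ≫ (ρ_ A).hom) (RightComoduleMagma.coact_counit (H := H) (A := A))
      simp only [Category.assoc, Iso.inv_hom_id] at this
      exact this)

lemma eq_coact_coact : E.Eq [coact 0 4 3, coact 4 1 2] [coact 0 1 4, comul 4 2 3]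
    [a 0] [a 1, x 2, x 3] :=
  ((comp_coact E 0 4 3).comp (((comp_coact E 4 1 2).whiskerRight (tx 3)).comp
    (.assoc (ta 1) (tx 2) (tx 3)))).eqv
    ((comp_coact E 0 1 4).comp ((comp_comul E 4 2 3).whiskerLeft (ta 1)))
    (RightComoduleMagma.coact_coassoc (H := H) (A := A))

lemma eq_mul_coact : E.Eq [mulA 0 1 4, coact 4 2 3]
    [coact 0 4 5, coact 1 6 7, mulA 4 6 2, mulH 5 7 3] [a 0, a 1] [a 2, x 3] :=
  ((comp_mulA E 0 1 4).comp (comp_coact E 4 2 3)).eqv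
    (((comp_coact E 0 4 5).tensorHom (comp_coact E 1 6 7)).comp
      ((comp_tensorMu E (by decide)).comp ((comp_mulA E 4 6 2).tensorHom (comp_mulH E 5 7 3))))
    (RightComoduleMagma.mul_coact (H := H) (A := A))

lemma eq_unit_coact : E.Eq [oneA 2, coact 2 0 3, tgt 3 1] [oneA 2, coact 2 0 1] [] [a 0, x 1] :=
  ((comp_oneA E 2).comp ((comp_coact E 2 0 3).comp ((comp_tgt E 3 1).whiskerLeft (ta 0)))).eqv
    (comp_unit_coact E 2 0 1) (RightComoduleMagma.unit_coact (H := H) (A := A))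

lemma eq_inc_coact (hj : E.j ≫ rho H A = E.j ≫ rho H A ≫ A ◁ target H) : E.Eq [inc 0 3, coact 3 1 4, tgt 4 2] [inc 0 3, coact 3 1 2]
    [b 0] [a 1, x 2] :=
  ((comp_inc E 0 3).comp ((comp_coact E 3 1 4).comp ((comp_tgt E 4 2).whiskerLeft (ta 1)))).eqv
    ((comp_inc E 0 3).comp (comp_coact E 3 1 2)) hj.symm

lemma eq_bar_mul : E.Eq [bar 0 3, mulH 3 1 2] [comul 1 3 2, mulH 0 3 4, counit 4]
    [x 0, x 1] [x 2] :=
  (((comp_bar E 0 3).whiskerRight (tx 1)).comp (comp_mulH E 3 1 2)).eqv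
    (((comp_comul E 1 3 2).whiskerLeft (tx 0)).comp (.comp (.assocInv (tx 0) (tx 3) (tx 2))
      ((((comp_mulH E 0 3 4).comp (comp_counit E 4)).whiskerRight (tx 2)).comp
        (.leftUnitor (tx 2))))) (barSource_mul H)

/-- This is `mul_theta` again, because left multiplication by Π̄(x) is y ↦ ε(x y₁) y₂. -/
lemma eq_bar_mul_mul : E.Eq [mulH 1 2 4, bar 0 5, mulH 5 4 3] [bar 0 4, mulH 4 1 5, mulH 5 2 3]
    [x 0, x 1, x 2] [x 3] :=
  (((comp_mulH E 1 2 4).whiskerLeft (tx 0)).comp (((comp_bar E 0 5).whiskerRight (tx 4)).comp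
    (comp_mulH E 5 4 3))).eqv
    (.comp (.assocInv (tx 0) (tx 1) (tx 2)) ((((comp_bar E 0 4).whiskerRight (tx 1)).comp
      (comp_mulH E 4 1 5) |>.whiskerRight (tx 2)).comp (comp_mulH E 5 2 3)))
    (by
      have h := mul_theta H
      rw [← barSource_mul] at h
      exact h)

lemma eq_tgt_bar : E.Eq [tgt 0 2, bar 2 1] [tgt 0 1] [x 0] [x 1] :=
  ((comp_tgt E 0 2).comp (comp_bar E 2 1)).eqv (comp_tgt E 0 1) (target_barSource H)

lemma eq_tgt_conv : E.Eq [comul 0 2 3, lam 3 4, mulH 2 4 1] [tgt 0 1] [x 0] [x 1] :=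
  ((comp_comul E 0 2 3).comp (((Computes.id (tx 2)).tensorHom (comp_lam E 3 4)).comp
    (comp_mulH E 2 4 1))).eqv (comp_tgt E 0 1) rfl

/-! ### Identities in the weak Hopf quasigroup. -/

/-- Since δ is multiplicative, the twisted splitting of the counit gives ε(y₁ z) ε(x₁ y₂) x₂ y₃, and
the last factors recombine to x y₂. -/
lemma eq_comul_mul_counit :
    E.Eq [mulH 0 1 4, comul 4 5 3, mulH 5 2 6, counit 6]
      [comul 1 4 5, mulH 4 2 6, counit 6, mulH 0 5 3]
      [x 0, x 1, x 2] [x 3] :=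
  .trans (Imp.eqv (P := [mulH 0 1 4, comul 4 5 3, mulH 5 2 6, counit 6]) (Q := [comul 0 6 7,
    comul 1 4 5, mulH 4 2 8, counit 8, comul 5 9 10, mulH 6 9 11, counit 11, mulH 7 10 3]) (
    .replace (eq_mul_comul E) [0, 1, 5, 3, 4, 7, 8, 9] [] <|
    .replace (eq_counit_split' E) [4, 8, 2, 5, 6, 10, 11] [] <|
    .replace (eq_comul_comul E) [1, 6, 5, 9, 8] [] <|
    .finish [(4, 6), (5, 9), (6, 4), (8, 5), (9, 10), (10, 11), (11, 8)])) <|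
  (Imp.eqv (P := [comul 0 6 7, comul 1 4 5, mulH 4 2 8, counit 8, comul 5 9 10, mulH 6 9 11,
    counit 11, mulH 7 10 3]) (Q := [comul 1 4 5, mulH 4 2 6, counit 6, mulH 0 5 3]) (
    .replace (eq_mul_comul E).symm [0, 5, 11, 3, 6, 7, 9, 10] [] <|
    .replace (eq_counit_comul E) [3, 11] [(6, 3)] <|
    .finish [(8, 6)]))

/-- Expand Π(y) = ε(1₁ y) 1₂ and use the preceding identity for the product x · 1. This counit form
of right multiplication by Π(y) is used throughout. -/
lemma eq_mul_tgt :
    E.Eq [tgt 1 3, mulH 0 3 2]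
      [comul 0 3 2, mulH 3 1 4, counit 4]
      [x 0, x 1] [x 2] :=
  .trans (Imp.eqv (P := [tgt 1 3, mulH 0 3 2]) (Q := [oneH 5, comul 5 8 3, mulH 8 1 4, counit 4,
    mulH 0 3 2]) (
    .replace (eq_tgt E) [1, 3, 4, 5, 6] [] <|
    .finish [(4, 5), (5, 8), (6, 4)])) <|
  .trans (Imp.eqv (P := [oneH 5, mulH 0 5 8, comul 8 3 2, mulH 3 1 4, counit 4]) (Q := [oneH 5,
    comul 5 8 3, mulH 8 1 4, counit 4, mulH 0 3 2]) (
    .replace (eq_comul_mul_counit E) [0, 5, 1, 2, 8, 3, 4] [] <|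
    .finish [])).symm <|
  (Imp.eqv (P := [oneH 5, mulH 0 5 8, comul 8 3 2, mulH 3 1 4, counit 4]) (Q := [comul 0 3 2,
    mulH 3 1 4, counit 4]) (
    .replace (eq_mul_one E) [0, 5] [(8, 0)] <|
    .finish []))

/-- The expansion 1₁ ⊗ ε(1'₁ 1₂) 1'₂ is the twisted unit axiom with ε applied to the middle factor.
-/
lemma eq_unit_tgt :
    E.Eq [oneH 2, comul 2 0 3, tgt 3 1]
      [oneH 2, comul 2 0 1]
      [] [x 0, x 1] :=
  (Imp.eqv (
    .replace (eq_tgt E) [3, 1, 4, 5, 6] [] <|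
    .replace (eq_unit_split' E).symm [0, 6, 1, 2, 3, 4, 5] [] <|
    .replace (eq_comul_comul E) [2, 0, 6, 1, 3] [] <|
    .replace (eq_counit_comul E) [1, 6] [(3, 1)] <|
    .finish []))

lemma eq_bar_tgt :
    E.Eq [bar 0 2, tgt 2 1]
      [bar 0 1]
      [x 0] [x 1] :=
  .trans (Imp.eqv (P := [bar 0 2, tgt 2 1]) (Q := [oneH 2, comul 2 3 1, mulH 0 3 4, counit 4]) (
    .replace (eq_bar E) [0, 2, 3, 4, 5] [] <|
    .replace (eq_unit_tgt E) [4, 1, 3, 2] [] <|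
    .finish [(3, 2), (4, 3), (5, 4)])) <|
  (Imp.eqv (P := [bar 0 1]) (Q := [oneH 2, comul 2 3 1, mulH 0 3 4, counit 4]) (
    .replace (eq_bar E) [0, 1, 2, 3, 4] [] <|
    .finish [])).symm

/-- As Π̄ fixes Π(x), left multiplication by Π(x) is y ↦ ε(Π(x) y₁) y₂, and coassociativity lets it
pass through δ. -/
lemma eq_comul_tgt_mul :
    E.Eq [tgt 0 4, mulH 4 1 5, comul 5 2 3]
      [tgt 0 4, comul 1 5 3, mulH 4 5 2]
      [x 0, x 1] [x 2, x 3] :=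
  .trans (Imp.eqv (P := [tgt 0 4, mulH 4 1 5, comul 5 2 3]) (Q := [comul 1 5 3, tgt 0 6,
    comul 5 4 2, mulH 6 4 7, counit 7]) (
    .replace (eq_tgt_bar E).symm [0, 4, 6] [] <|
    .replace (eq_bar_mul E) [6, 1, 5, 4, 7] [] <|
    .replace (eq_comul_comul E).symm [1, 4, 2, 3, 5] [] <|
    .finish [])) <|
  (Imp.eqv (P := [tgt 0 4, comul 1 5 3, mulH 4 5 2]) (Q := [comul 1 5 3, tgt 0 6, comul 5 4 2,
    mulH 6 4 7, counit 7]) (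
    .replace (eq_tgt_bar E).symm [0, 4, 6] [] <|
    .replace (eq_bar_mul E) [6, 5, 2, 4, 7] [] <|
    .finish [])).symm

lemma eq_comul_mul_tgt :
    E.Eq [tgt 1 4, mulH 0 4 5, comul 5 2 3]
      [tgt 1 4, comul 0 5 3, mulH 5 4 2]
      [x 0, x 1] [x 2, x 3] :=
  .trans (Imp.eqv (P := [tgt 1 4, mulH 0 4 5, comul 5 2 3]) (Q := [comul 0 4 5, comul 5 2 3,
    mulH 4 1 6, counit 6]) (
    .replace (eq_mul_tgt E) [0, 1, 5, 4, 6] [] <|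
    .finish [])) <|
  (Imp.eqv (P := [tgt 1 4, comul 0 5 3, mulH 5 4 2]) (Q := [comul 0 4 5, comul 5 2 3, mulH 4 1 6,
    counit 6]) (
    .replace (eq_mul_tgt E) [5, 1, 2, 4, 6] [] <|
    .replace (eq_comul_comul E) [0, 4, 2, 3, 5] [] <|
    .finish [])).symm

/-- Write a product w as ε(w₁) w₂. By the two preceding lemmas the factor Π(y) stays in the first
component, so the two sides are ε(x₁(Π(y) z₁)) x₂ z₂ and ε((x₁ Π(y)) z₁) x₂ z₂; these agree because
associativity holds under ε. -/
lemma eq_mul_tgt_mul :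
    E.Eq [tgt 1 4, mulH 4 2 5, mulH 0 5 3]
      [tgt 1 4, mulH 0 4 5, mulH 5 2 3]
      [x 0, x 1, x 2] [x 3] :=
  .trans (Imp.eqv (P := [tgt 1 4, comul 0 5 6, comul 2 7 8, mulH 4 7 9, mulH 5 9 10, counit 10,
    mulH 6 8 3]) (Q := [tgt 1 4, mulH 4 2 5, mulH 0 5 3]) (
    .replace (eq_comul_tgt_mul E).symm [1, 2, 9, 8, 4, 7] [] <|
    .replace (eq_mul_comul E).symm [0, 7, 10, 3, 5, 6, 9, 8] [] <|
    .replace (eq_counit_comul E) [3, 10] [(5, 3)] <|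
    .finish [(7, 5)])).symm <|
  (Imp.eqv (P := [tgt 1 4, comul 0 5 6, comul 2 7 8, mulH 4 7 9, mulH 5 9 10, counit 10,
    mulH 6 8 3]) (Q := [tgt 1 4, mulH 0 4 5, mulH 5 2 3]) (
    .replace (eq_counit_assoc E).symm [5, 4, 7, 9, 10] [] <|
    .replace (eq_comul_mul_tgt E).symm [0, 1, 9, 6, 4, 5] [] <|
    .replace (eq_mul_comul E).symm [5, 2, 10, 3, 9, 6, 7, 8] [] <|
    .replace (eq_counit_comul E) [3, 10] [(9, 3)] <|
    .finish []))

/-- Both sides come from x₁ 1₁ ⊗ ε(x₂ 1₂) 1₃. Contracting the counit gives the left one; splitting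
the triple coproduct of the unit as 1₁ ⊗ 1₂ 1'₁ ⊗ 1'₂ and rebracketing under ε gives the right one.
The mirror image `eq_unit_mul` uses the twisted unit axiom. -/
lemma eq_mul_unit :
    E.Eq [oneH 3, comul 3 4 2, mulH 0 4 1]
      [comul 0 1 3, bar 3 2]
      [x 0] [x 1, x 2] :=
  .trans (Imp.eqv (P := [oneH 3, comul 3 4 5, comul 0 6 7, mulH 6 4 1, comul 5 8 2, mulH 7 8 9,
    counit 9]) (Q := [oneH 3, comul 3 4 2, mulH 0 4 1]) (
    .replace (eq_comul_comul E).symm [3, 4, 8, 2, 5] [] <|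
    .replace (eq_mul_comul E).symm [0, 5, 1, 9, 6, 7, 4, 8] [] <|
    .replace (eq_comul_counit E) [1, 9] [(6, 1)] <|
    .finish [(5, 4)])).symm <|
  .trans (Imp.eqv (P := [oneH 3, comul 3 4 5, comul 0 6 7, mulH 6 4 1, comul 5 8 2, mulH 7 8 9,
    counit 9]) (Q := [comul 0 1 3, oneH 4, comul 4 5 2, mulH 3 5 6, counit 6]) (
    .replace (eq_comul_comul E).symm [3, 4, 8, 2, 5] [] <|
    .replace (eq_unit_split E) [4, 8, 2, 3, 5, 10, 11] [] <|
    .replace (eq_counit_assoc E).symm [7, 5, 11, 8, 9] [] <|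
    .replace (eq_mul_comul E).symm [0, 3, 1, 8, 6, 7, 4, 5] [] <|
    .replace (eq_mul_one E) [0, 3] [(6, 0)] <|
    .finish [(8, 3), (9, 6), (10, 4), (11, 5)])) <|
  (Imp.eqv (P := [comul 0 1 3, bar 3 2]) (Q := [comul 0 1 3, oneH 4, comul 4 5 2, mulH 3 5 6,
    counit 6]) (
    .replace (eq_bar E) [3, 2, 4, 5, 6] [] <|
    .finish [])).symm

lemma eq_unit_mul :
    E.Eq [oneH 3, comul 3 4 2, mulH 4 0 1]
      [comul 0 1 3, tgt 3 2]
      [x 0] [x 1, x 2] :=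
  .trans (Imp.eqv (P := [oneH 3, comul 3 4 5, comul 0 6 7, mulH 4 6 1, comul 5 8 2, mulH 8 7 9,
    counit 9]) (Q := [oneH 3, comul 3 4 2, mulH 4 0 1]) (
    .replace (eq_comul_comul E).symm [3, 4, 8, 2, 5] [] <|
    .replace (eq_mul_comul E).symm [5, 0, 1, 9, 4, 8, 6, 7] [] <|
    .replace (eq_comul_counit E) [1, 9] [(4, 1)] <|
    .finish [(5, 4)])).symm <|
  .trans (Imp.eqv (P := [oneH 3, comul 3 4 5, comul 0 6 7, mulH 4 6 1, comul 5 8 2, mulH 8 7 9,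
    counit 9]) (Q := [comul 0 1 3, oneH 4, comul 4 5 2, mulH 5 3 6, counit 6]) (
    .replace (eq_comul_comul E).symm [3, 4, 8, 2, 5] [] <|
    .replace (eq_unit_split' E) [4, 8, 2, 3, 5, 10, 11] [] <|
    .replace (eq_counit_assoc E) [11, 5, 7, 8, 9] [] <|
    .replace (eq_mul_comul E).symm [3, 0, 1, 8, 4, 5, 6, 7] [] <|
    .replace (eq_one_mul E) [0, 3] [(4, 0)] <|
    .finish [(8, 3), (9, 6), (10, 4), (11, 5)])) <|
  (Imp.eqv (P := [comul 0 1 3, tgt 3 2]) (Q := [comul 0 1 3, oneH 4, comul 4 5 2, mulH 5 3 6,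
    counit 6]) (
    .replace (eq_tgt E) [3, 2, 4, 5, 6] [] <|
    .finish [])).symm

/-- Both sides equal ε(x (1₁ y)) 1₂, by `eq_mul_unit` and `eq_unit_mul`. -/
lemma eq_bar_tgt_exchange :
    E.Eq [comul 0 3 4, mulH 3 1 5, counit 5, bar 4 2]
      [comul 1 3 4, mulH 0 3 5, counit 5, tgt 4 2]
      [x 0, x 1] [x 2] :=
  .trans (Imp.eqv (P := [comul 0 3 4, mulH 3 1 5, counit 5, bar 4 2]) (Q := [oneH 4, comul 4 6 2,
    mulH 6 1 3, mulH 0 3 5, counit 5]) (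
    .replace (eq_mul_unit E).symm [0, 3, 2, 4, 6] [] <|
    .replace (eq_counit_assoc E) [0, 6, 1, 3, 5] [] <|
    .finish [])) <|
  (Imp.eqv (P := [comul 1 3 4, mulH 0 3 5, counit 5, tgt 4 2]) (Q := [oneH 4, comul 4 6 2,
    mulH 6 1 3, mulH 0 3 5, counit 5]) (
    .replace (eq_unit_mul E).symm [1, 3, 2, 4, 6] [] <|
    .finish [])).symm

lemma eq_bar_comul :
    E.Eq [bar 0 3, comul 3 1 2]
      [bar 0 3, oneH 4, comul 4 5 2, mulH 3 5 1]
      [x 0] [x 1, x 2] :=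
  .trans (Imp.eqv (P := [bar 0 3, comul 3 1 2]) (Q := [oneH 4, comul 4 5 2, oneH 6, comul 6 7 3,
    mulH 0 7 8, counit 8, mulH 3 5 1]) (
    .replace (eq_bar E) [0, 3, 4, 5, 6] [] <|
    .replace (eq_comul_comul E).symm [4, 5, 1, 2, 3] [] <|
    .replace (eq_unit_split E) [5, 1, 2, 4, 3, 7, 8] [] <|
    .finish [(4, 6), (5, 7), (6, 8), (7, 4), (8, 5)])) <|
  (Imp.eqv (P := [bar 0 3, oneH 4, comul 4 5 2, mulH 3 5 1]) (Q := [oneH 4, comul 4 5 2, oneH 6,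
    comul 6 7 3, mulH 0 7 8, counit 8, mulH 3 5 1]) (
    .replace (eq_bar E) [0, 3, 6, 7, 8] [] <|
    .finish [])).symm

/-! ### The coaction on the unit of A, and the idempotent ∇. -/

lemma eq_unit_coact_bar :
    E.Eq [oneA 2, coact 2 0 3, bar 3 1]
      [oneA 2, coact 2 0 1]
      [] [a 0, x 1] :=
  (Imp.eqv (
    .replace (eq_unit_coact E).symm [0, 3, 2, 4] [] <|
    .replace (eq_tgt_bar E) [4, 1, 3] [] <|
    .replace (eq_unit_coact E) [0, 1, 2, 4] [] <|
    .finish []))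

/-- Plays the role of the unit axiom for A: Π̄ fixes the H-component of ρ(1), so `eq_bar_comul`
describes its coproduct. -/
lemma eq_unit_coact_comul :
    E.Eq [oneA 2, coact 2 0 3, comul 3 1 4]
      [oneA 2, coact 2 0 3, oneH 5, comul 5 6 4, mulH 3 6 1]
      [] [a 0, x 1, x 4] :=
  (Imp.eqv (
    .replace (eq_unit_coact_bar E).symm [0, 3, 2, 5] [] <|
    .replace (eq_bar_comul E) [5, 1, 4, 3, 6, 7] [] <|
    .replace (eq_unit_coact_bar E) [0, 3, 2, 5] [] <|
    .finish [(6, 5), (7, 6)]))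

/-- Since Π fixes the H-component of ρ(1), `eq_mul_tgt` rewrites x 1₁ as ε(x₁ 1₁) x₂. This is the
source of the formula ∇(a ⊗ x) = a u(x₁) ⊗ x₂. -/
lemma eq_mul_unit_coact :
    E.Eq [oneA 3, coact 3 1 4, mulH 0 4 2]
      [comul 0 3 2, clu 3 1]
      [x 0] [a 1, x 2] :=
  .trans (Imp.eqv (P := [oneA 3, coact 3 1 4, mulH 0 4 2]) (Q := [comul 0 3 2, oneA 4, coact 4 1 5,
    mulH 3 5 6, counit 6]) (
    .replace (eq_unit_coact E).symm [1, 4, 3, 5] [] <|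
    .replace (eq_mul_tgt E) [0, 5, 2, 4, 6] [] <|
    .finish [(3, 4), (4, 3)])) <|
  (Imp.eqv (P := [comul 0 3 2, clu 3 1]) (Q := [comul 0 3 2, oneA 4, coact 4 1 5, mulH 3 5 6,
    counit 6]) (
    .replace (eq_clu E) [3, 1, 4, 5, 6] [] <|
    .finish [])).symm

/-- The argument of `eq_mul_unit`, now through a₀ 1₀ ⊗ ε(a₁ 1₁) 1₂ and with `eq_unit_coact_comul` as
the unit axiom. -/
lemma eq_mul_unit_coact_bar :
    E.Eq [oneA 3, coact 3 4 2, mulA 0 4 1]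
      [coact 0 1 3, bar 3 2]
      [a 0] [a 1, x 2] :=
  .trans (Imp.eqv (P := [coact 0 3 4, oneA 5, coact 5 6 7, comul 7 8 2, mulA 3 6 1, mulH 4 8 9,
    counit 9]) (Q := [oneA 3, coact 3 4 2, mulA 0 4 1]) (
    .replace (eq_coact_coact E).symm [5, 6, 8, 2, 7] [] <|
    .replace (eq_mul_coact E).symm [0, 7, 1, 9, 3, 4, 6, 8] [] <|
    .replace (eq_coact_counit E) [1, 9] [(3, 1)] <|
    .finish [(5, 3), (7, 4)])).symm <|
  .trans (Imp.eqv (P := [coact 0 3 4, oneA 5, coact 5 6 7, comul 7 8 2, mulA 3 6 1, mulH 4 8 9,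
    counit 9]) (Q := [coact 0 1 3, oneH 4, comul 4 5 2, mulH 3 5 6, counit 6]) (
    .replace (eq_unit_coact_comul E) [6, 8, 5, 7, 2, 10, 11] [] <|
    .replace (eq_counit_assoc E).symm [4, 7, 11, 8, 9] [] <|
    .replace (eq_mul_coact E).symm [0, 5, 1, 8, 3, 4, 6, 7] [] <|
    .replace (eq_mul_oneA E) [0, 5] [(3, 0)] <|
    .finish [(8, 3), (9, 6), (10, 4), (11, 5)])) <|
  (Imp.eqv (P := [coact 0 1 3, bar 3 2]) (Q := [coact 0 1 3, oneH 4, comul 4 5 2, mulH 3 5 6,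
    counit 6]) (
    .replace (eq_bar E) [3, 2, 4, 5, 6] [] <|
    .finish [])).symm

lemma eq_counit_mul_bar :
    E.Eq [comul 1 3 4, mulH 0 3 5, bar 5 6, mulH 4 6 7, counit 7]
      [mulH 0 1 2, counit 2]
      [x 0, x 1] [] :=
  (Imp.eqv (
    .replace (eq_bar E) [5, 6, 2, 8, 9] [] <|
    .replace (eq_counit_assoc E) [0, 3, 8, 5, 9] [] <|
    .replace (eq_mul_comul E).symm [1, 2, 5, 7, 3, 4, 8, 6] [] <|
    .replace (eq_mul_one E) [1, 2] [(3, 1)] <|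
    .replace (eq_comul_counit E) [1, 7] [(5, 1)] <|
    .finish [(9, 2)]))

/-- Expanding u and applying the formula for multiplication by ρ(1) to the product a b₀ gives a₀ b₀
ε(b₂ Π̄(a₁ b₁)). Here `eq_counit_mul_bar` reduces the scalar to ε(a₁ b₁), and no rebracketing in A
is needed. -/
lemma eq_mul_clu :
    E.Eq [coact 1 3 4, mulA 0 3 5, clu 4 6, mulA 5 6 2]
      [mulA 0 1 2]
      [a 0, a 1] [a 2] :=
  .trans (Imp.eqv (P := [coact 1 3 4, mulA 0 3 5, clu 4 6, mulA 5 6 2]) (Q := [coact 0 3 4,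
    coact 1 5 6, mulA 3 5 2, mulH 4 6 7, counit 7]) (
    .replace (eq_clu E) [4, 6, 7, 8, 9] [] <|
    .replace (eq_mul_unit_coact_bar E) [5, 2, 8, 7, 6] [] <|
    .replace (eq_mul_coact E) [0, 3, 2, 7, 5, 6, 10, 11] [] <|
    .replace (eq_coact_coact E) [1, 10, 11, 4, 3] [] <|
    .replace (eq_counit_mul_bar E) [6, 3, 12, 11, 4, 7, 8, 9] [] <|
    .finish [(3, 6), (5, 3), (6, 4), (10, 5), (12, 7)])) <|
  (Imp.eqv (P := [coact 0 3 4, coact 1 5 6, mulA 3 5 2, mulH 4 6 7, counit 7]) (Q := [mulA 0 1 2]) (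
    .replace (eq_mul_coact E).symm [0, 1, 2, 7, 3, 4, 5, 6] [] <|
    .replace (eq_coact_counit E) [2, 7] [(3, 2)] <|
    .finish []))

lemma eq_clu_mul :
    E.Eq [coact 0 2 3, clu 3 4, mulA 2 4 0]
      []
      [a 0] [a 0] :=
  .trans (Imp.eqv (P := [oneA 1, coact 0 2 3, clu 3 4, mulA 1 2 5, mulA 5 4 0]) (Q := [coact 0 2 3,
    clu 3 4, mulA 2 4 0]) (
    .replace (eq_one_mulA E) [2, 1] [(5, 2)] <|
    .finish [])).symm <|
  (Imp.eqv (P := [oneA 1, coact 0 2 3, clu 3 4, mulA 1 2 5, mulA 5 4 0]) (Q := []) (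
    .replace (eq_mul_clu E) [1, 0, 0, 2, 3, 5, 4] [] <|
    .replace (eq_one_mulA E) [0, 1] [] <|
    .finish []))

lemma eq_can_nabla :
    E.Eq [coact 1 4 5, mulA 0 4 6, oneA 7, coact 7 8 9, mulA 6 8 2, mulH 5 9 3]
      [coact 1 4 3, mulA 0 4 2]
      [a 0, a 1] [a 2, x 3] :=
  (Imp.eqv (
    .replace (eq_mul_unit_coact E) [5, 8, 3, 7, 9] [] <|
    .replace (eq_coact_coact E).symm [1, 4, 7, 3, 5] [] <|
    .replace (eq_mul_clu E) [0, 5, 2, 4, 7, 6, 8] [] <|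
    .finish [(5, 4)]))

/-- As ε(x₁ 1₁) x₂ = x 1₁ and ε is associative on products, the left side is (a 1₀) 1'₀ ε(x (1₁
1'₁)). Now a 1₀ ⊗ 1₁ = can(a ⊗ 1) is fixed by ∇. -/
lemma eq_clu_clu :
    E.Eq [comul 1 3 4, clu 3 5, mulA 0 5 6, clu 4 7, mulA 6 7 2]
      [clu 1 3, mulA 0 3 2]
      [a 0, x 1] [a 2] :=
  .trans (Imp.eqv (P := [comul 1 3 4, clu 3 5, mulA 0 5 6, clu 4 7, mulA 6 7 2]) (Q := [oneA 4,
    coact 4 3 5, mulH 1 5 6, counit 6, mulA 0 3 2]) (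
    .replace (eq_clu E) [3, 5, 8, 9, 10] [] <|
    .replace (eq_clu E) [4, 7, 11, 12, 13] [] <|
    .replace (eq_mul_tgt E).symm [1, 9, 4, 3, 10] [] <|
    .replace (eq_unit_coact E) [5, 3, 8, 9] [] <|
    .replace (eq_counit_assoc E) [1, 3, 12, 4, 13] [] <|
    .replace (eq_can_nabla E) [0, 8, 2, 4, 5, 3, 6, 11, 7, 12] [] <|
    .finish [(4, 5), (5, 3), (8, 4), (13, 6)])) <|
  (Imp.eqv (P := [clu 1 3, mulA 0 3 2]) (Q := [oneA 4, coact 4 3 5, mulH 1 5 6, counit 6,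
    mulA 0 3 2]) (
    .replace (eq_clu E) [1, 3, 4, 5, 6] [] <|
    .finish [])).symm

lemma eq_nabla_nabla :
    E.Eq [oneA 4, coact 4 5 6, mulA 0 5 7, mulH 1 6 8, oneA 9, coact 9 10 11, mulA 7 10 2,
      mulH 8 11 3]
      [oneA 4, coact 4 5 6, mulA 0 5 2, mulH 1 6 3]
      [a 0, x 1] [a 2, x 3] :=
  .trans (Imp.eqv (P := [oneA 4, coact 4 5 6, mulA 0 5 7, mulH 1 6 8, oneA 9, coact 9 10 11,
    mulA 7 10 2, mulH 8 11 3]) (Q := [comul 1 4 3, clu 4 5, mulA 0 5 2]) (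
    .replace (eq_mul_unit_coact E) [1, 5, 8, 4, 6] [] <|
    .replace (eq_mul_unit_coact E) [8, 10, 3, 9, 11] [] <|
    .replace (eq_comul_comul E).symm [1, 4, 9, 3, 8] [] <|
    .replace (eq_clu_clu E) [0, 8, 2, 4, 9, 5, 7, 10] [] <|
    .finish [(4, 5), (8, 4)])) <|
  (Imp.eqv (P := [oneA 4, coact 4 5 6, mulA 0 5 2, mulH 1 6 3]) (Q := [comul 1 4 3, clu 4 5,
    mulA 0 5 2]) (
    .replace (eq_mul_unit_coact E) [1, 5, 3, 4, 6] [] <|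
    .finish [])).symm

/-! ### Multiplication by coinvariants. -/

/-- For coinvariant c one may replace c₁ by Π(c₁), and a₁ Π(c₁) = ε(a₁ c₁) a₂; the counit then
recombines the product. The companion for products c a uses Π̄ and `eq_bar_mul`. -/
lemma eq_mul_inc_coact (hj : E.j ≫ rho H A = E.j ≫ rho H A ≫ A ◁ target H) :
    E.Eq [inc 1 4, mulA 0 4 5, coact 5 2 3]
      [coact 0 4 3, inc 1 5, mulA 4 5 2]
      [a 0, b 1] [a 2, x 3] :=
  .trans (Imp.eqv (P := [inc 1 4, mulA 0 4 5, coact 5 2 3]) (Q := [coact 0 6 3, coact 6 10 11,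
    inc 1 7, coact 7 8 9, mulA 10 8 2, mulH 11 9 12, counit 12]) (
    .replace (eq_mul_coact E) [0, 4, 2, 3, 5, 6, 7, 8] [] <|
    .replace (eq_inc_coact E hj).symm [1, 7, 8, 4, 9] [] <|
    .replace (eq_mul_tgt E) [6, 9, 3, 8, 10] [] <|
    .replace (eq_coact_coact E).symm [0, 5, 8, 3, 6] [] <|
    .finish [(4, 7), (5, 10), (7, 8), (8, 11), (10, 12)])) <|
  (Imp.eqv (P := [coact 0 6 3, coact 6 10 11, inc 1 7, coact 7 8 9, mulA 10 8 2, mulH 11 9 12,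
    counit 12]) (Q := [coact 0 4 3, inc 1 5, mulA 4 5 2]) (
    .replace (eq_mul_coact E).symm [6, 7, 2, 12, 10, 11, 8, 9] [] <|
    .replace (eq_coact_counit E) [2, 12] [(10, 2)] <|
    .finish [(6, 4), (7, 5)]))

lemma eq_inc_mul_coact (hj : E.j ≫ rho H A = E.j ≫ rho H A ≫ A ◁ target H) :
    E.Eq [inc 0 4, mulA 4 1 5, coact 5 2 3]
      [coact 1 4 3, inc 0 5, mulA 5 4 2]
      [b 0, a 1] [a 2, x 3] :=
  .trans (Imp.eqv (P := [inc 0 4, mulA 4 1 5, coact 5 2 3]) (Q := [inc 0 4, coact 4 6 7,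
    coact 1 8 3, coact 8 9 10, mulA 6 9 2, mulH 7 10 12, counit 12]) (
    .replace (eq_mul_coact E) [4, 1, 2, 3, 5, 6, 7, 8] [] <|
    .replace (eq_inc_coact E hj).symm [0, 5, 6, 4, 9] [] <|
    .replace (eq_tgt_bar E).symm [9, 6, 10] [] <|
    .replace (eq_bar_mul E) [10, 8, 3, 6, 11] [] <|
    .replace (eq_inc_coact E hj) [0, 5, 10, 4, 9] [] <|
    .replace (eq_coact_coact E).symm [1, 7, 6, 3, 8] [] <|
    .finish [(5, 6), (6, 10), (7, 9), (10, 7), (11, 12)])) <|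
  (Imp.eqv (P := [inc 0 4, coact 4 6 7, coact 1 8 3, coact 8 9 10, mulA 6 9 2, mulH 7 10 12,
    counit 12]) (Q := [coact 1 4 3, inc 0 5, mulA 5 4 2]) (
    .replace (eq_mul_coact E).symm [4, 8, 2, 12, 6, 7, 9, 10] [] <|
    .replace (eq_coact_counit E) [2, 12] [(6, 2)] <|
    .finish [(4, 5), (8, 4)]))

/-- Both sides come from a₀ b₀ ⊗ ε(a₁ b₁) Π̄(a₂), the right one after `eq_bar_tgt_exchange`. -/
lemma eq_coact_mul_bar :
    E.Eq [coact 0 4 5, mulA 4 1 2, bar 5 3]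
      [coact 1 4 5, mulA 0 4 2, tgt 5 3]
      [a 0, a 1] [a 2, x 3] :=
  .trans (Imp.eqv (P := [coact 0 4 5, comul 5 6 7, coact 1 8 9, mulA 4 8 2, mulH 6 9 10, counit 10,
    bar 7 3]) (Q := [coact 0 4 5, mulA 4 1 2, bar 5 3]) (
    .replace (eq_coact_coact E).symm [0, 4, 6, 7, 5] [] <|
    .replace (eq_mul_coact E).symm [5, 1, 2, 10, 4, 6, 8, 9] [] <|
    .replace (eq_coact_counit E) [2, 10] [(4, 2)] <|
    .finish [(5, 4), (7, 5)])).symm <|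
  (Imp.eqv (P := [coact 0 4 5, comul 5 6 7, coact 1 8 9, mulA 4 8 2, mulH 6 9 10, counit 10,
    bar 7 3]) (Q := [coact 1 4 5, mulA 0 4 2, tgt 5 3]) (
    .replace (eq_bar_tgt_exchange E) [5, 9, 3, 6, 7, 10] [] <|
    .replace (eq_coact_coact E).symm [1, 8, 6, 7, 9] [] <|
    .replace (eq_mul_coact E).symm [0, 9, 2, 10, 4, 5, 8, 6] [] <|
    .replace (eq_coact_counit E) [2, 10] [(4, 2)] <|
    .finish [(7, 5), (9, 4)]))

/-- The morphism `E.j` is coinvariant, and its image associates with `A` in the middle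
position. -/
structure Env.IsCoinv : Prop where
  inc_coact : E.j ≫ rho H A = E.j ≫ rho H A ≫ A ◁ target H
  middle : E.Eq [inc 1 4, mulA 4 2 5, mulA 0 5 3] [inc 1 4, mulA 0 4 5, mulA 5 2 3]
    [a 0, b 1, a 2] [a 3]

/-- The conditions on a cleaving morphism and its inverse. -/
structure Env.IsCleft : Prop where
  fst_coact : E.Eq [fst 0 3, coact 3 1 2] [comul 0 3 2, fst 3 1] [x 0] [a 1, x 2]
  shift : E.Eq [comul 0 3 4, snd 4 5, coact 5 1 6, mulH 3 6 2] [snd 0 3, coact 3 1 4, bar 4 2]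
    [x 0] [a 1, x 2]
  mul_snd_fst : E.Eq [comul 1 3 4, snd 3 5, mulA 0 5 6, fst 4 7, mulA 6 7 2]
    [clu 1 3, mulA 0 3 2] [a 0, x 1] [a 2]
  mul_fst_snd : E.Eq [comul 1 3 4, fst 3 5, mulA 0 5 6, snd 4 7, mulA 6 7 2]
    [comul 1 3 4, fst 3 5, snd 4 6, mulA 5 6 7, mulA 0 7 2] [a 0, x 1] [a 2]

/-- The morphism `a ↦ a₀ k(a₁)` factors through `E.j`. -/
def Env.Factors : Prop :=
  E.Eq [prj 0 2, inc 2 1] [coact 0 2 3, snd 3 4, mulA 2 4 1] [a 0] [a 1]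

/-! ### Consequences of the cleftness conditions. -/

/-- The coaction gives a₀ k(a₂)₀ ⊗ a₁ k(a₂)₁; condition (c2) puts the second factor into the image
of Π̄, which Π fixes. -/
lemma eq_snd_coinv (hE : E.IsCleft) :
    E.Eq [coact 0 3 4, snd 4 5, mulA 3 5 6, coact 6 1 7, tgt 7 2]
      [coact 0 3 4, snd 4 5, mulA 3 5 6, coact 6 1 2]
      [a 0] [a 1, x 2] :=
  .trans (Imp.eqv (P := [coact 0 3 4, snd 4 5, mulA 3 5 6, coact 6 1 7, tgt 7 2]) (Q :=
    [coact 0 3 4, snd 4 5, coact 5 6 7, bar 7 2, mulA 3 6 1]) (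
    .replace (eq_mul_coact E) [3, 5, 1, 7, 6, 8, 9, 10] [] <|
    .replace (eq_coact_coact E) [0, 6, 8, 4, 3] [] <|
    .replace hE.shift [3, 9, 7, 8, 4, 5, 10] [] <|
    .replace (eq_bar_tgt E) [4, 2, 7] [] <|
    .finish [(3, 4), (4, 7), (6, 3), (8, 5), (9, 6)])) <|
  (Imp.eqv (P := [coact 0 3 4, snd 4 5, mulA 3 5 6, coact 6 1 2]) (Q := [coact 0 3 4, snd 4 5,
    coact 5 6 7, bar 7 2, mulA 3 6 1]) (
    .replace (eq_mul_coact E) [3, 5, 1, 2, 6, 7, 8, 9] [] <|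
    .replace (eq_coact_coact E) [0, 6, 7, 4, 3] [] <|
    .replace hE.shift [3, 8, 2, 7, 4, 5, 9] [] <|
    .finish [(3, 4), (4, 7), (6, 3), (7, 5), (8, 6)])).symm

/-- Condition (c3) reduces (a₀ k(a₁)) h(a₂) to a₀ u(a₁), and `eq_clu_mul` finishes. -/
lemma eq_reconstruct (hE : E.IsCleft) (hq : E.Factors) :
    E.Eq [coact 0 2 3, prj 2 4, inc 4 5, fst 3 6, mulA 5 6 0]
      []
      [a 0] [a 0] :=
  (Imp.eqv (
    .replace hq [2, 5, 4, 1, 7] [] <|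
    .replace (eq_coact_coact E) [0, 4, 1, 3, 2] [] <|
    .replace hE.mul_snd_fst [4, 2, 0, 1, 3, 7, 5, 6] [] <|
    .replace (eq_clu_mul E) [0, 0, 4, 2, 1] [] <|
    .finish []))

lemma eq_conv_fst_snd (hE : E.IsCleft) (hq : E.Factors) :
    E.Eq [comul 0 2 3, fst 2 4, snd 3 5, mulA 4 5 1]
      [fst 0 2, prj 2 3, inc 3 1]
      [x 0] [a 1] :=
  (Imp.eqv (
    .replace hq [2, 1, 3, 4, 5] [] <|
    .replace hE.fst_coact [0, 3, 4, 2] [] <|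
    .finish [(3, 4), (4, 3)])).symm

/-- Colinearity of h gives q ∘ h = h * k, so (c4) rewrites the product as (q(a₀) h(a₁)) k(a₂).
Because q(a₀) is coinvariant, this is q evaluated at q(a₀) h(a₁) = a. -/
lemma eq_prj_mul_prj_fst (hj : E.IsCoinv) (hE : E.IsCleft) (hq : E.Factors) :
    E.Eq [coact 0 2 3, prj 2 4, inc 4 5, fst 3 6, prj 6 7, inc 7 8, mulA 5 8 1]
      [prj 0 2, inc 2 1]
      [a 0] [a 1] :=
  .trans (Imp.eqv (P := [coact 0 2 3, prj 2 4, inc 4 5, fst 3 6, prj 6 7, inc 7 8, mulA 5 8 1]) (Q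
    := [coact 0 11 12, prj 11 13, inc 13 16, comul 12 15 3, fst 15 14, mulA 16 14 2, snd 3 4,
      mulA 2 4 1]) (
    .replace (eq_conv_fst_snd E hE hq).symm [3, 8, 6, 7, 9, 10] [] <|
    .replace hE.mul_fst_snd.symm [5, 3, 1, 6, 7, 9, 10, 8] [] <|
    .finish [(2, 11), (3, 12), (4, 13), (5, 16), (6, 15), (7, 3), (8, 4), (9, 14), (10, 2)])) <|
  .trans (Imp.eqv (P := [coact 0 11 12, prj 11 13, inc 13 14, fst 12 15, mulA 14 15 16, prj 16 2,
    inc 2 1]) (Q := [coact 0 11 12, prj 11 13, inc 13 16, comul 12 15 3, fst 15 14, mulA 16 14 2,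
      snd 3 4, mulA 2 4 1]) (
    .replace hq [16, 1, 2, 3, 4] [] <|
    .replace (eq_inc_mul_coact E hj.inc_coact) [13, 15, 2, 3, 14, 16] [] <|
    .replace hE.fst_coact [12, 14, 3, 15] [] <|
    .finish [])).symm <|
  (Imp.eqv (P := [coact 0 11 12, prj 11 13, inc 13 14, fst 12 15, mulA 14 15 16, prj 16 2,
    inc 2 1]) (Q := [prj 0 2, inc 2 1]) (
    .replace (eq_reconstruct E hE hq) [0, 0, 11, 12, 13, 14, 15] [(16, 0)] <|
    .finish []))

/-- Rebracketing a(b₀ k(b₁)) directly is not allowed, so b is first written as q(b₀) h(b₁). Middle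
associativity and (c4) lead to (a q(b₀)) (h * k)(b₁); moving the coinvariant factor back gives a
(q(b₀) q(h(b₁))), where the preceding lemma applies. -/
lemma eq_can_snd (hj : E.IsCoinv) (hE : E.IsCleft) (hq : E.Factors) :
    E.Eq [coact 1 3 4, mulA 0 3 5, snd 4 6, mulA 5 6 2]
      [prj 1 3, inc 3 4, mulA 0 4 2]
      [a 0, a 1] [a 2] :=
  .trans (Imp.eqv (P := [coact 1 11 12, prj 11 13, inc 13 14, fst 12 15, mulA 14 15 16,
    coact 16 3 4, mulA 0 3 5, snd 4 6, mulA 5 6 2]) (Q := [coact 1 3 4, mulA 0 3 5, snd 4 6,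
      mulA 5 6 2]) (
    .replace (eq_reconstruct E hE hq) [1, 0, 11, 12, 13, 14, 15] [(16, 1)] <|
    .finish [])).symm <|
  (Imp.eqv (P := [coact 1 11 12, prj 11 13, inc 13 14, fst 12 15, mulA 14 15 16, coact 16 3 4,
    mulA 0 3 5, snd 4 6, mulA 5 6 2]) (Q := [prj 1 3, inc 3 4, mulA 0 4 2]) (
    .replace (eq_inc_mul_coact E hj.inc_coact) [13, 15, 3, 4, 14, 16] [] <|
    .replace hE.fst_coact [12, 14, 4, 15] [] <|
    .replace hj.middle [0, 13, 14, 5, 16, 3] [] <|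
    .replace hE.mul_fst_snd [3, 12, 2, 15, 4, 14, 5, 6] [] <|
    .replace (eq_conv_fst_snd E hE hq) [12, 6, 15, 4, 14, 5] [] <|
    .replace hj.middle.symm [0, 13, 6, 2, 16, 3] [] <|
    .replace (eq_prj_mul_prj_fst E hj hE hq) [1, 3, 11, 12, 13, 16, 15, 4, 6] [] <|
    .finish [(3, 4), (11, 3)]))

lemma eq_can_snd_fst (hj : E.IsCoinv) (hE : E.IsCleft) (hq : E.Factors) :
    E.Eq [coact 1 4 5, mulA 0 4 6, comul 5 7 8, snd 7 9, mulA 6 9 2, fst 8 3]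
      [coact 1 4 5, prj 4 6, inc 6 7, mulA 0 7 2, fst 5 3]
      [a 0, a 1] [a 2, a 3] :=
  (Imp.eqv (
    .replace (eq_coact_coact E).symm [1, 4, 7, 8, 5] [] <|
    .replace (eq_can_snd E hj hE hq) [0, 5, 2, 4, 7, 6, 9] [] <|
    .finish [(4, 6), (5, 4), (8, 5)]))

lemma eq_snd_fst_can (hE : E.IsCleft) :
    E.Eq [comul 1 4 5, snd 4 6, mulA 0 6 7, fst 5 8, coact 8 9 3, mulA 7 9 2]
      [oneA 4, coact 4 5 6, mulA 0 5 2, mulH 1 6 3]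
      [a 0, x 1] [a 2, x 3] :=
  .trans (Imp.eqv (P := [comul 1 4 5, snd 4 6, mulA 0 6 7, fst 5 8, coact 8 9 3, mulA 7 9 2]) (Q :=
    [comul 1 4 3, clu 4 5, mulA 0 5 2]) (
    .replace hE.fst_coact [5, 9, 3, 8] [] <|
    .replace (eq_comul_comul E).symm [1, 4, 8, 3, 5] [] <|
    .replace hE.mul_snd_fst [0, 5, 2, 4, 8, 6, 7, 9] [] <|
    .finish [(4, 5), (5, 4)])) <|
  (Imp.eqv (P := [oneA 4, coact 4 5 6, mulA 0 5 2, mulH 1 6 3]) (Q := [comul 1 4 3, clu 4 5,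
    mulA 0 5 2]) (
    .replace (eq_mul_unit_coact E) [1, 5, 3, 4, 6] [] <|
    .finish [])).symm

lemma eq_snd_fst_lineal :
    E.Eq [comul 1 4 5, snd 4 6, mulA 0 6 2, fst 5 3]
      [oneA 7, comul 1 4 5, snd 4 6, mulA 7 6 8, mulA 0 8 2, fst 5 3]
      [a 0, x 1] [a 2, a 3] :=
  (Imp.eqv (
    .replace (eq_one_mulA E) [6, 7] [(8, 6)] <|
    .finish [])).symm

lemma eq_prj_coact :
    E.Eq [coact 0 4 3, prj 4 5, comul 3 6 7]
      [coact 0 4 7, coact 4 8 6, prj 8 5]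
      [a 0] [b 5, x 6, x 7] :=
  (Imp.eqv (
    .replace (eq_coact_coact E) [0, 8, 6, 7, 4] [] <|
    .finish [(4, 3), (8, 4)])).symm

lemma eq_inc_mul_fst_coact (hj : E.IsCoinv) (hE : E.IsCleft) :
    E.Eq [inc 0 4, fst 1 5, mulA 4 5 6, coact 6 2 3]
      [comul 1 7 3, inc 0 4, fst 7 5, mulA 4 5 2]
      [b 0, x 1] [a 2, x 3] :=
  (Imp.eqv (
    .replace (eq_inc_mul_coact E hj.inc_coact) [0, 5, 2, 3, 4, 6] [] <|
    .replace hE.fst_coact [1, 4, 3, 5] [] <|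
    .finish [(4, 5), (5, 7), (6, 4)]))

lemma eq_inc_mul_mul_fst (hj : E.IsCoinv) :
    E.Eq [inc 0 4, inc 1 5, mulA 4 5 6, fst 2 7, mulA 6 7 3]
      [inc 0 4, inc 1 5, fst 2 7, mulA 5 7 6, mulA 4 6 3]
      [b 0, b 1, x 2] [a 3] :=
  (Imp.eqv (
    .replace hj.middle [4, 1, 7, 3, 5, 6] [] <|
    .finish [])).symm

lemma eq_inc_mul_prj (hj : E.IsCoinv) (hE : E.IsCleft) (hq : E.Factors) :
    E.Eq [inc 0 3, mulA 3 1 4, prj 4 5, inc 5 2]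
      [prj 1 3, inc 0 4, inc 3 5, mulA 4 5 2]
      [b 0, a 1] [a 2] :=
  (Imp.eqv (
    .replace hq [4, 2, 5, 6, 7] [] <|
    .replace (eq_inc_mul_coact E hj.inc_coact) [0, 1, 5, 6, 3, 4] [] <|
    .replace (eq_can_snd E hj hE hq) [4, 1, 2, 3, 6, 5, 7] [] <|
    .finish [(6, 5)]))

/-- Properties of the morphisms obtained from a normal basis, the inverse of the canonical morphism
and the projection to the coinvariants. -/
structure Env.IsGalois : Prop where
  fst_coact : E.Eq [fst 0 3, coact 3 1 2]
    [comul 0 3 2, fst 3 1]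
    [x 0] [a 1, x 2]
  reconstruct : E.Eq [coact 0 2 3, prj 2 4, inc 4 5, fst 3 6, mulA 5 6 0]
    []
    [a 0] [a 0]
  can_snd : E.Eq [coact 1 3 4, mulA 0 3 5, snd 4 6, mulA 5 6 2]
    [prj 1 3, inc 3 4, mulA 0 4 2]
    [a 0, a 1] [a 2]
  nabla_snd : E.Eq [oneA 30, coact 30 31 32, mulA 0 31 33, mulH 1 32 34, snd 34 8, mulA 33 8 2]
    [snd 1 3, mulA 0 3 2]
    [a 0, x 1] [a 2]

/-- The formula for the coaction on multiples of `E.k`. -/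
def Env.SndCoact : Prop :=
  E.Eq [snd 1 4, mulA 0 4 5, coact 5 2 3]
    [oneA 30, coact 30 31 32, mulA 0 31 33, mulH 1 32 34, coact 33 4 5, comul 34 6 7, lam 6 8,
      mulH 5 8 3, snd 7 9, mulA 4 9 2]
    [a 0, x 1] [a 2, x 3]

/-- The formula for the coaction on multiples of `E.k`, projected to the source. -/
def Env.SndCoactBar : Prop :=
  E.Eq [snd 1 4, mulA 0 4 5, coact 5 2 6, bar 6 3]
    [oneA 30, coact 30 31 32, mulA 0 31 33, mulH 1 32 34, comul 34 4 5, tgt 4 3, snd 5 6,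
      mulA 33 6 2]
    [a 0, x 1] [a 2, x 3]

/-- The morphism `E.q` is linear. -/
def Env.Linear : Prop :=
  E.Eq [inc 0 3, mulA 3 1 4, prj 4 5, inc 5 2]
    [prj 1 3, inc 0 4, inc 3 5, mulA 4 5 2]
    [b 0, a 1] [a 2]

/-- The product of `E.k` and `E.h`. -/
def Env.SndFst : Prop :=
  E.Eq [comul 1 3 4, snd 3 5, mulA 0 5 6, fst 4 7, mulA 6 7 2]
    [clu 1 3, mulA 0 3 2]
    [a 0, x 1] [a 2]

/-! ### Consequences of a normal basis with almost lineal inverse. -/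

lemma eq_mul_prj_inc_mul (hj : E.IsCoinv) (hl : E.Linear) :
    E.Eq [inc 1 4, mulA 4 2 5, prj 5 6, inc 6 7, mulA 0 7 3]
      [inc 1 4, mulA 0 4 5, prj 2 6, inc 6 7, mulA 5 7 3]
      [a 0, b 1, a 2] [a 3] :=
  (Imp.eqv (
    .replace hl [1, 2, 7, 4, 5, 6] [] <|
    .replace hj.middle [0, 1, 6, 3, 5, 7] [] <|
    .finish [(4, 6), (5, 4), (6, 7), (7, 5)]))

/-- Because the H-component of ρ(1) is fixed by Π, δ(x 1₁) = x₁ 1₁ ⊗ x₂. Thus ∇ acts on the factor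
feeding k alone, where `nabla_snd` absorbs it. -/
lemma eq_nabla_snd_fst (hE : E.IsGalois) :
    E.Eq [oneA 30, coact 30 31 32, mulA 0 31 33, mulH 1 32 34, comul 34 3 4, snd 3 5, mulA 33 5 6,
      fst 4 7, mulA 6 7 2]
      [comul 1 3 4, snd 3 5, mulA 0 5 6, fst 4 7, mulA 6 7 2]
      [a 0, x 1] [a 2] :=
  (Imp.eqv (
    .replace (eq_unit_coact E).symm [31, 32, 30, 8] [] <|
    .replace (eq_comul_mul_tgt E) [1, 8, 3, 4, 32, 34] [] <|
    .replace (eq_unit_coact E) [31, 32, 30, 8] [] <|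
    -- The zeros from position 4 to 7 and from 9 to 29 belong to names that the identity does not
    -- use.
    .replace hE.nabla_snd [0, 34, 6, 8, 0, 0, 0, 0, 5, 0, 0, 0, 0, 0, 0, 0, 0, 0, 0, 0, 0, 0, 0, 0,
      0, 0, 0, 0, 0, 0, 30, 31, 32, 33, 3] [] <|
    .finish [(8, 5), (34, 3)]))

lemma eq_nabla_clu :
    E.Eq [oneA 30, coact 30 31 32, mulA 0 31 33, mulH 1 32 34, clu 34 3, mulA 33 3 2]
      [clu 1 3, mulA 0 3 2]
      [a 0, x 1] [a 2] :=
  (Imp.eqv (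
    .replace (eq_mul_unit_coact E) [1, 31, 34, 30, 32] [] <|
    .replace (eq_clu_clu E) [0, 1, 2, 30, 34, 31, 33, 3] [] <|
    .finish [(30, 3)]))

/-- Both sides are a b: the left one becomes (a q(b₀)) h(b₁) = a (q(b₀) h(b₁)), the right one is
`eq_mul_clu`. -/
lemma eq_can_snd_mul_fst (hj : E.IsCoinv) (hE : E.IsGalois) :
    E.Eq [coact 1 20 21, mulA 0 20 22, comul 21 3 4, snd 3 5, mulA 22 5 6, fst 4 7, mulA 6 7 2]
      [coact 1 20 21, mulA 0 20 22, clu 21 3, mulA 22 3 2]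
      [a 0, a 1] [a 2] :=
  .trans (Imp.eqv (P := [coact 1 20 21, mulA 0 20 22, comul 21 3 4, snd 3 5, mulA 22 5 6, fst 4 7,
    mulA 6 7 2]) (Q := [mulA 0 1 2]) (
    .replace (eq_coact_coact E).symm [1, 20, 3, 4, 21] [] <|
    .replace hE.can_snd [0, 21, 6, 20, 3, 22, 5] [] <|
    .replace hj.middle.symm [0, 20, 7, 2, 3, 6] [] <|
    .replace hE.reconstruct [1, 0, 21, 4, 20, 3, 7] [(6, 1)] <|
    .finish [])) <|
  (Imp.eqv (P := [coact 1 20 21, mulA 0 20 22, clu 21 3, mulA 22 3 2]) (Q := [mulA 0 1 2]) (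
    .replace (eq_mul_clu E) [0, 1, 2, 20, 21, 22, 3] [] <|
    .finish [])).symm

lemma eq_fst_conv_snd (hE : E.IsGalois) :
    E.Eq [comul 0 2 3, fst 2 4, snd 3 5, mulA 4 5 1]
      [fst 0 2, prj 2 3, inc 3 1]
      [x 0] [a 1] :=
  .trans (Imp.eqv (P := [oneA 6, comul 0 2 3, fst 2 4, mulA 6 4 7, snd 3 5, mulA 7 5 1]) (Q :=
    [comul 0 2 3, fst 2 4, snd 3 5, mulA 4 5 1]) (
    .replace (eq_one_mulA E) [4, 6] [(7, 4)] <|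
    .finish [])).symm <|
  (Imp.eqv (P := [oneA 6, comul 0 2 3, fst 2 4, mulA 6 4 7, snd 3 5, mulA 7 5 1]) (Q := [fst 0 2,
    prj 2 3, inc 3 1]) (
    .replace hE.fst_coact.symm [0, 4, 3, 2] [] <|
    .replace hE.can_snd [6, 2, 1, 4, 3, 7, 5] [] <|
    .replace (eq_one_mulA E) [1, 6] [(3, 1)] <|
    .finish [(4, 3)]))

/-- By colinearity of h, the left side is (a b₀) k(b₁) for b = h(x), so both sides equal a q(h(x)).
-/
lemma eq_mul_fst_snd (hE : E.IsGalois) :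
    E.Eq [comul 1 3 4, fst 3 5, mulA 0 5 6, snd 4 7, mulA 6 7 2]
      [comul 1 3 4, fst 3 5, snd 4 6, mulA 5 6 7, mulA 0 7 2]
      [a 0, x 1] [a 2] :=
  .trans (Imp.eqv (P := [comul 1 3 4, fst 3 5, mulA 0 5 6, snd 4 7, mulA 6 7 2]) (Q := [fst 1 3,
    prj 3 4, inc 4 7, mulA 0 7 2]) (
    .replace hE.fst_coact.symm [1, 5, 4, 3] [] <|
    .replace hE.can_snd [0, 3, 2, 5, 4, 6, 7] [] <|
    .finish [(4, 7), (5, 4)])) <|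
  (Imp.eqv (P := [comul 1 3 4, fst 3 5, snd 4 6, mulA 5 6 7, mulA 0 7 2]) (Q := [fst 1 3, prj 3 4,
    inc 4 7, mulA 0 7 2]) (
    .replace (eq_fst_conv_snd E hE) [1, 7, 3, 4, 5, 6] [] <|
    .finish [])).symm

lemma eq_snd_conv_fst (hv : E.SndFst) :
    E.Eq [comul 0 2 3, snd 2 4, fst 3 5, mulA 4 5 1]
      [clu 0 1]
      [x 0] [a 1] :=
  .trans (Imp.eqv (P := [oneA 6, comul 0 2 3, snd 2 4, mulA 6 4 7, fst 3 5, mulA 7 5 1]) (Q :=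
    [comul 0 2 3, snd 2 4, fst 3 5, mulA 4 5 1]) (
    .replace (eq_one_mulA E) [4, 6] [(7, 4)] <|
    .finish [])).symm <|
  (Imp.eqv (P := [oneA 6, comul 0 2 3, snd 2 4, mulA 6 4 7, fst 3 5, mulA 7 5 1]) (Q := [clu 0 1]) (
    .replace hv [6, 0, 1, 2, 3, 4, 7, 5] [] <|
    .replace (eq_one_mulA E) [1, 6] [(2, 1)] <|
    .finish []))

/-- Both sides equal a₀ q(b) ⊗ a₁. On the right ∇ disappears after can, and (a₁ b₁) λ(b₂) = a₁ Π(b₁)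
= ε(a₁ b₁) a₂, after which the counit contracts. -/
lemma eq_can_snd_coact (hj : E.IsCoinv) (hE : E.IsGalois) :
    E.Eq [coact 1 20 21, mulA 0 20 22, snd 21 4, mulA 22 4 5, coact 5 2 3]
      [coact 1 20 21, mulA 0 20 22, oneA 30, coact 30 31 32, mulA 22 31 33, mulH 21 32 34,
        coact 33 4 5, comul 34 6 7, lam 6 8, mulH 5 8 3, snd 7 9, mulA 4 9 2]
      [a 0, a 1] [a 2, x 3] :=
  .trans (Imp.eqv (P := [coact 1 20 21, mulA 0 20 22, snd 21 4, mulA 22 4 5, coact 5 2 3]) (Q :=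
    [coact 0 10 3, prj 1 34, inc 34 7, mulA 10 7 2]) (
    .replace hE.can_snd [0, 1, 5, 20, 21, 22, 4] [] <|
    .replace (eq_mul_inc_coact E hj.inc_coact) [0, 20, 2, 3, 21, 5] [] <|
    .finish [(5, 7), (20, 34), (21, 10)])) <|
  (Imp.eqv (P := [coact 1 20 21, mulA 0 20 22, oneA 30, coact 30 31 32, mulA 22 31 33,
    mulH 21 32 34, coact 33 4 5, comul 34 6 7, lam 6 8, mulH 5 8 3, snd 7 9, mulA 4 9 2]) (Q :=
      [coact 0 10 3, prj 1 34, inc 34 7, mulA 10 7 2]) (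
    .replace (eq_can_nabla E) [0, 1, 33, 34, 20, 21, 22, 30, 31, 32] [] <|
    .replace (eq_mul_coact E) [0, 20, 4, 5, 33, 10, 11, 12] [] <|
    .replace (eq_coact_coact E).symm [1, 20, 6, 7, 34] [] <|
    .replace (eq_coact_coact E) [34, 11, 12, 6, 20] [] <|
    .replace (eq_mul_mul_lam E) [10, 20, 3, 12, 6, 5, 8] [] <|
    .replace (eq_mul_tgt E) [10, 20, 3, 12, 5] [] <|
    .replace (eq_coact_coact E).symm [0, 33, 12, 3, 10] [] <|
    .replace (eq_mul_coact E).symm [10, 34, 4, 5, 33, 12, 11, 20] [] <|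
    .replace (eq_coact_counit E) [33, 5] [(4, 33)] <|
    .replace hE.can_snd [10, 1, 2, 34, 7, 33, 9] [] <|
    .finish [])).symm

/-- The case a = 1 of the general formula. The scalar in u(x₁) produces Π^R(x₁) next to λ(x₂);
rebracketing through Π̄ makes them adjacent, and Π^R * λ = λ. -/
lemma eq_snd_coact (hc : E.SndCoact) :
    E.Eq [snd 0 3, coact 3 1 2]
      [comul 0 3 4, snd 4 5, lam 3 6, oneA 7, coact 7 8 9, mulA 8 5 1, mulH 9 6 2]
      [x 0] [a 1, x 2] :=
  .trans (Imp.eqv (P := [oneA 9, snd 0 3, mulA 9 3 4, coact 4 1 2]) (Q := [snd 0 3, coact 3 1 2]) (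
    .replace (eq_one_mulA E) [3, 9] [(4, 3)] <|
    .finish [])).symm <|
  (Imp.eqv (P := [oneA 9, snd 0 3, mulA 9 3 4, coact 4 1 2]) (Q := [comul 0 3 4, snd 4 5, lam 3 6,
    oneA 7, coact 7 8 9, mulA 8 5 1, mulH 9 6 2]) (
    .replace hc [9, 0, 1, 2, 3, 4, 11, 12, 13, 14, 0, 0, 0, 0, 0, 0, 0, 0, 0, 0, 0, 0, 0, 0, 0, 0,
      0, 0, 0, 0, 5, 6, 7, 8, 10] [] <|
    .replace (eq_one_mulA E) [6, 9] [(8, 6)] <|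
    .replace (eq_mul_unit_coact E) [0, 6, 10, 5, 7] [] <|
    .replace (eq_clu E) [5, 6, 7, 8, 9] [] <|
    .replace (eq_coact_coact E) [7, 3, 4, 8, 6] [] <|
    .replace (eq_unit_coact_comul E) [3, 4, 7, 6, 8, 15, 16] [] <|
    .replace (eq_src E).symm [5, 16, 15, 8, 9] [] <|
    .replace (eq_unit_coact_bar E).symm [3, 6, 7, 8] [] <|
    .replace (eq_bar_mul_mul E).symm [8, 16, 13, 2, 6, 4] [] <|
    .replace (eq_comul_comul E).symm [0, 5, 11, 12, 10] [] <|
    .replace (eq_src_lam E) [10, 6, 5, 11, 16, 13] [] <|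
    .replace (eq_unit_coact_bar E) [3, 4, 7, 8] [] <|
    .finish [(3, 8), (4, 9), (10, 3), (12, 4), (14, 5)]))

/-- The H-component x₁ (1₁ λ(x₂)) rebrackets to (x₁ 1₁) λ(x₂), as Π fixes 1₁. Then x₁ 1₁ releases
u(x₁), and x₂ λ(x₃) = Π(x₂) remains. -/
lemma eq_mul_snd_coact (hc : E.SndCoact) :
    E.Eq [comul 0 3 4, snd 4 5, coact 5 1 6, mulH 3 6 2]
      [comul 0 3 4, comul 4 5 6, clu 3 7, tgt 5 2, snd 6 8, mulA 7 8 1]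
      [x 0] [a 1, x 2] :=
  (Imp.eqv (
    .replace (eq_snd_coact E hc) [4, 1, 6, 5, 7, 8, 9, 10, 11, 12] [] <|
    .replace (eq_unit_coact E).symm [11, 12, 10, 13] [] <|
    .replace (eq_mul_tgt_mul E) [3, 13, 9, 2, 12, 6] [] <|
    .replace (eq_unit_coact E) [11, 12, 10, 13] [] <|
    .replace (eq_mul_unit_coact E) [3, 11, 6, 10, 12] [] <|
    .replace (eq_comul_comul E) [0, 10, 6, 4, 3] [] <|
    .replace (eq_comul_comul E).symm [3, 6, 5, 7, 4] [] <|
    .replace (eq_tgt_conv E) [4, 2, 6, 5, 9] [] <|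
    .finish [(3, 4), (4, 5), (7, 6), (10, 3), (11, 7)]))

/-- Both sides equal a₀ q(b) ⊗ Π̄(a₁); on the right `eq_coact_mul_bar` trades Π on the coaction of b
for Π̄ on that of a. -/
lemma eq_can_snd_coact_bar (hj : E.IsCoinv) (hE : E.IsGalois) :
    E.Eq [coact 1 20 21, mulA 0 20 22, snd 21 4, mulA 22 4 5, coact 5 2 6, bar 6 3]
      [coact 1 20 21, mulA 0 20 22, oneA 30, coact 30 31 32, mulA 22 31 33, mulH 21 32 34,
        comul 34 4 5, tgt 4 3, snd 5 6, mulA 33 6 2]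
      [a 0, a 1] [a 2, x 3] :=
  .trans (Imp.eqv (P := [coact 1 20 21, mulA 0 20 22, snd 21 4, mulA 22 4 5, coact 5 2 6, bar 6 3])
    (Q := [coact 0 20 4, bar 4 3, prj 1 34, inc 34 5, mulA 20 5 2]) (
    .replace hE.can_snd [0, 1, 5, 20, 21, 22, 4] [] <|
    .replace (eq_mul_inc_coact E hj.inc_coact) [0, 20, 2, 6, 21, 5] [] <|
    .finish [(6, 4), (20, 34), (21, 20)])) <|
  (Imp.eqv (P := [coact 1 20 21, mulA 0 20 22, oneA 30, coact 30 31 32, mulA 22 31 33,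
    mulH 21 32 34, comul 34 4 5, tgt 4 3, snd 5 6, mulA 33 6 2]) (Q := [coact 0 20 4, bar 4 3,
      prj 1 34, inc 34 5, mulA 20 5 2]) (
    .replace (eq_can_nabla E) [0, 1, 33, 34, 20, 21, 22, 30, 31, 32] [] <|
    .replace (eq_coact_coact E).symm [1, 20, 4, 5, 34] [] <|
    .replace (eq_coact_mul_bar E).symm [0, 34, 33, 3, 20, 4] [] <|
    .replace hE.can_snd [20, 1, 2, 34, 5, 33, 6] [] <|
    .finish [])).symm

/-- Condition (c2): both sides are u(x₁) k(x₃) ⊗ Π(x₂), the right one by the case a = 1 of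
`SndCoactBar`. -/
lemma eq_snd_shift (hc : E.SndCoact) (hb : E.SndCoactBar) :
    E.Eq [comul 0 3 4, snd 4 5, coact 5 1 6, mulH 3 6 2]
      [snd 0 3, coact 3 1 4, bar 4 2]
      [x 0] [a 1, x 2] :=
  .trans (Imp.eqv (P := [comul 0 3 4, snd 4 5, coact 5 1 6, mulH 3 6 2]) (Q := [comul 0 3 11,
    clu 3 7, comul 11 4 5, tgt 4 2, snd 5 6, mulA 7 6 1]) (
    .replace (eq_mul_snd_coact E hc) [0, 1, 2, 3, 4, 5, 6, 7, 8] [] <|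
    .finish [(4, 11), (5, 4), (6, 5), (8, 6)])) <|
  .trans (Imp.eqv (P := [oneA 9, snd 0 4, mulA 9 4 5, coact 5 1 6, bar 6 2]) (Q := [comul 0 3 11,
    clu 3 7, comul 11 4 5, tgt 4 2, snd 5 6, mulA 7 6 1]) (
    .replace hb [9, 0, 1, 2, 4, 5, 6, 0, 0, 0, 0, 0, 0, 0, 0, 0, 0, 0, 0, 0, 0, 0, 0, 0, 0, 0, 0,
      0, 0, 0, 3, 7, 8, 10, 11] [] <|
    .replace (eq_one_mulA E) [7, 9] [(10, 7)] <|
    .replace (eq_mul_unit_coact E) [0, 7, 11, 3, 8] [] <|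
    .finish [])).symm <|
  (Imp.eqv (P := [oneA 9, snd 0 4, mulA 9 4 5, coact 5 1 6, bar 6 2]) (Q := [snd 0 3, coact 3 1 4,
    bar 4 2]) (
    .replace (eq_one_mulA E) [4, 9] [(5, 4)] <|
    .finish [(4, 3), (6, 4)]))

variable (H A) in
/-- The environment with trivial choices. -/
def Env.trivial : Env H A A := ⟨cleftUnit H A, cleftUnit H A, 𝟙 A, 𝟙 A⟩
section Constraints

variable (s t u : Shape Ty)

lemma comp_id (hn : s.wires.Nodup := by decide) : E.Comp [] s s (𝟙 _) := .id s hn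

lemma comp_assoc (hn : (Shape.tensor (.tensor s t) u).wires.Nodup := by decide) :
    E.Comp [] (.tensor (.tensor s t) u) (.tensor s (.tensor t u)) (α_ _ _ _).hom :=
  .assoc s t u hn

lemma comp_assocInv (hn : (Shape.tensor (.tensor s t) u).wires.Nodup := by decide) :
    E.Comp [] (.tensor s (.tensor t u)) (.tensor (.tensor s t) u) (α_ _ _ _).inv :=
  .assocInv s t u hn

lemma comp_braid (hn : (Shape.tensor s t).wires.Nodup := by decide) :
    E.Comp [] (.tensor s t) (.tensor t s) (β_ _ _).hom :=
  .braid s t hn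

lemma comp_leftUnitorInv (hn : s.wires.Nodup := by decide) :
    E.Comp [] s (.tensor .unit s) (λ_ _).inv :=
  .leftUnitorInv s hn

lemma comp_rightUnitorInv (hn : s.wires.Nodup := by decide) :
    E.Comp [] s (.tensor s .unit) (ρ_ _).inv :=
  .rightUnitorInv s hn

end Constraints

variable (H A) in
/-- The morphism `a ⊗ b ↦ a b₀ ⊗ b₁`. -/
def canonical : A ⊗ A ⟶ A ⊗ H :=
  A ◁ rho H A ≫ (α_ A A H).inv ≫ mu A ▷ H

/-- The morphism `a ⊗ x ↦ a k(x₁) ⊗ h(x₂)`. -/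
def Env.lift : A ⊗ H ⟶ A ⊗ A :=
  A ◁ (Δ[H] ≫ (E.k ⊗ₘ E.h)) ≫ (α_ A A A).inv ≫ mu A ▷ A

/-- The morphism `a ↦ q(a₀) ⊗ a₁`. -/
def Env.sectionMap : A ⟶ B ⊗ H :=
  rho H A ≫ E.q ▷ H

/-- The morphism `c ⊗ x ↦ c h(x)`. -/
def Env.retractionMap : B ⊗ H ⟶ A :=
  B ◁ E.h ≫ E.j ▷ A ≫ mu A

/-- The morphism `a ⊗ x ↦ a₀ k(x₂) ⊗ a₁ λ(x₁)`. -/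
def Env.sndCoact : A ⊗ H ⟶ A ⊗ H :=
  rho H A ▷ H ≫ (A ⊗ H) ◁ (Δ[H] ≫ (β_ H H).hom ≫ E.k ▷ H ≫ A ◁ (WeakHopfQuasigroup.antipode : H ⟶
    H)) ≫ tensorμ A H A H ≫ (mu A ⊗ₘ mu H)

/-- The morphism `a ⊗ x ↦ a k(x₂) ⊗ Π(x₁)` for the target morphism `Π`. -/
def Env.sndCoactBar : A ⊗ H ⟶ A ⊗ H :=
  A ◁ (Δ[H] ≫ (β_ H H).hom ≫ E.k ▷ H ≫ A ◁ target H) ≫ (α_ A A H).inv ≫ mu A ▷ H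

/-! ### Program identities read as equations of morphisms. -/

lemma nabla_comp_nabla :
    nabla H A ≫ nabla H A =
    nabla H A := by
  let E : Env H A A := .trivial H A
  have e := Computes.eq_of_imp (((comp_rightUnitorInv E (.tensor (ta 0) (tx 1))).comp ((((comp_oneA
    E 4).comp (comp_coact E 4 5 6)).whiskerLeft (.tensor (ta 0) (tx 1))).comp ((comp_tensorMu E (X₁
      := (ta 0)) (X₂ := (tx 1)) (Y₁ := (ta 5)) (Y₂ := (tx 6)) (by decide)).comp ((comp_mulA
        E 0 5 7).tensorHom (comp_mulH E 1 6 8))))).comp ((comp_rightUnitorInv E (.tensor (ta 7)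
          (tx 8))).comp ((((comp_oneA E 9).comp (comp_coact E 9 10 11)).whiskerLeft (.tensor (ta 7)
            (tx 8))).comp ((comp_tensorMu E (X₁ := (ta 7)) (X₂ := (tx 8)) (Y₁ := (ta 10)) (Y₂ :=
              (tx 11)) (by decide)).comp ((comp_mulA E 7 10 2).tensorHom (comp_mulH E 8 11 3))))))
    ((comp_rightUnitorInv E (.tensor (ta 0) (tx 1))).comp ((((comp_oneA E 4).comp (comp_coact
      E 4 5 6)).whiskerLeft (.tensor (ta 0) (tx 1))).comp ((comp_tensorMu E (X₁ := (ta 0)) (X₂ :=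
        (tx 1)) (Y₁ := (ta 5)) (Y₂ := (tx 6)) (by decide)).comp ((comp_mulA E 0 5 2).tensorHom
          (comp_mulH E 1 6 3)))))
    (
    .replace (eq_nabla_nabla E) [0, 1, 2, 3, 4, 5, 6, 7, 8, 9, 10, 11] [] <|
    .finish [])
  exact e

lemma canonical_comp_nabla :
    canonical H A ≫ nabla H A =
    canonical H A := by
  let E : Env H A A := .trivial H A
  have e := Computes.eq_of_imp ((((comp_coact E 1 4 5).whiskerLeft (ta 0)).comp ((comp_assocInv E
    (ta 0) (ta 4) (tx 5)).comp ((comp_mulA E 0 4 6).whiskerRight (tx 5)))).comp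
      ((comp_rightUnitorInv E (.tensor (ta 6) (tx 5))).comp ((((comp_oneA E 7).comp (comp_coact
        E 7 8 9)).whiskerLeft (.tensor (ta 6) (tx 5))).comp ((comp_tensorMu E (X₁ := (ta 6)) (X₂ :=
          (tx 5)) (Y₁ := (ta 8)) (Y₂ := (tx 9)) (by decide)).comp ((comp_mulA E 6 8 2).tensorHom
            (comp_mulH E 5 9 3))))))
    (((comp_coact E 1 4 3).whiskerLeft (ta 0)).comp ((comp_assocInv E (ta 0) (ta 4) (tx 3)).comp
      ((comp_mulA E 0 4 2).whiskerRight (tx 3))))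
    (
    .replace (eq_can_nabla E) [0, 1, 2, 3, 4, 5, 6, 7, 8, 9] [] <|
    .finish [])
  exact e

lemma rho_snd_coinv (hE : E.IsCleft) :
    (rho H A ≫ A ◁ E.k ≫ mu A) ≫ rho H A =
    (rho H A ≫ A ◁ E.k ≫ mu A) ≫ rho H A ≫ A ◁ target H := by
  have e := Computes.eq_of_imp (((comp_coact E 0 3 4).comp (((comp_snd E 4 5).whiskerLeft
    (ta 3)).comp (comp_mulA E 3 5 6))).comp ((comp_coact E 6 1 7).comp ((comp_tgt
      E 7 2).whiskerLeft (ta 1))))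
    (((comp_coact E 0 3 4).comp (((comp_snd E 4 5).whiskerLeft (ta 3)).comp (comp_mulA
      E 3 5 6))).comp (comp_coact E 6 1 2))
    (
    .replace (eq_snd_coinv E hE) [0, 1, 2, 3, 4, 5, 6, 7] [] <|
    .finish [])
  exact e.symm

lemma sectionMap_comp_retractionMap (hE : E.IsCleft) (hq : E.Factors) :
    E.sectionMap ≫ E.retractionMap =
    𝟙 A := by
  have e := Computes.eq_of_imp (((comp_coact E 0 1 2).comp ((comp_prj E 1 3).whiskerRight
    (tx 2))).comp (((comp_fst E 2 4).whiskerLeft (tb 3)).comp (((comp_inc E 3 5).whiskerRight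
      (ta 4)).comp (comp_mulA E 5 4 0))))
    (comp_id E (ta 0))
    (
    .replace (eq_reconstruct E hE hq) [0, 0, 1, 2, 3, 5, 4] [] <|
    .finish [])
  exact e

lemma canonical_comp_lift (hj : E.IsCoinv) (hE : E.IsCleft) (hq : E.Factors) :
    canonical H A ≫ E.lift =
    A ◁ (rho H A ≫ E.q ▷ H ≫ B ◁ E.h) ≫ (α_ A B A).inv ≫ (A ◁ E.j ≫ mu A) ▷ A := by
  have e := Computes.eq_of_imp ((((comp_coact E 1 4 5).whiskerLeft (ta 0)).comp ((comp_assocInv E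
    (ta 0) (ta 4) (tx 5)).comp ((comp_mulA E 0 4 6).whiskerRight (tx 5)))).comp ((((comp_comul
      E 5 7 8).comp ((comp_snd E 7 9).tensorHom (comp_fst E 8 3))).whiskerLeft (ta 6)).comp
        ((comp_assocInv E (ta 6) (ta 9) (ta 3)).comp ((comp_mulA E 6 9 2).whiskerRight (ta 3)))))
    ((((comp_coact E 1 4 5).comp (((comp_prj E 4 6).whiskerRight (tx 5)).comp ((comp_fst
      E 5 3).whiskerLeft (tb 6)))).whiskerLeft (ta 0)).comp ((comp_assocInv E (ta 0) (tb 6)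
        (ta 3)).comp ((((comp_inc E 6 7).whiskerLeft (ta 0)).comp (comp_mulA E 0 7 2)).whiskerRight
          (ta 3))))
    (
    .replace (eq_can_snd_fst E hj hE hq) [0, 1, 2, 3, 4, 5, 6, 7, 8, 9] [] <|
    .finish [])
  exact e

lemma lift_comp_canonical (hE : E.IsCleft) :
    E.lift ≫ canonical H A =
    nabla H A := by
  have e := Computes.eq_of_imp (((((comp_comul E 1 4 5).comp ((comp_snd E 4 6).tensorHom (comp_fst
    E 5 7))).whiskerLeft (ta 0)).comp ((comp_assocInv E (ta 0) (ta 6) (ta 7)).comp ((comp_mulA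
      E 0 6 8).whiskerRight (ta 7)))).comp (((comp_coact E 7 9 3).whiskerLeft (ta 8)).comp
        ((comp_assocInv E (ta 8) (ta 9) (tx 3)).comp ((comp_mulA E 8 9 2).whiskerRight (tx 3)))))
    ((comp_rightUnitorInv E (.tensor (ta 0) (tx 1))).comp ((((comp_oneA E 4).comp (comp_coact
      E 4 5 6)).whiskerLeft (.tensor (ta 0) (tx 1))).comp ((comp_tensorMu E (X₁ := (ta 0)) (X₂ :=
        (tx 1)) (Y₁ := (ta 5)) (Y₂ := (tx 6)) (by decide)).comp ((comp_mulA E 0 5 2).tensorHom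
          (comp_mulH E 1 6 3)))))
    (
    .replace (eq_snd_fst_can E hE) [0, 1, 2, 3, 4, 5, 6, 8, 7, 9] [] <|
    .finish [])
  exact e

lemma lift_eq :
    E.lift =
    A ◁ ((λ_ H).inv ≫ un A ▷ H ≫ E.lift) ≫ (α_ A A A).inv ≫ mu A ▷ A := by
  have e := Computes.eq_of_imp ((((comp_comul E 1 4 5).comp ((comp_snd E 4 6).tensorHom (comp_fst
    E 5 3))).whiskerLeft (ta 0)).comp ((comp_assocInv E (ta 0) (ta 6) (ta 3)).comp ((comp_mulA
      E 0 6 2).whiskerRight (ta 3))))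
    ((((comp_leftUnitorInv E (tx 1)).comp (((comp_oneA E 4).whiskerRight (tx 1)).comp
      ((((comp_comul E 1 5 6).comp ((comp_snd E 5 7).tensorHom (comp_fst E 6 3))).whiskerLeft
        (ta 4)).comp ((comp_assocInv E (ta 4) (ta 7) (ta 3)).comp ((comp_mulA E 4 7 8).whiskerRight
          (ta 3)))))).whiskerLeft (ta 0)).comp ((comp_assocInv E (ta 0) (ta 8) (ta 3)).comp
            ((comp_mulA E 0 8 2).whiskerRight (ta 3))))
    (
    .replace (eq_snd_fst_lineal E) [0, 1, 2, 3, 4, 5, 6, 7, 8] [] <|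
    .finish [(4, 5), (5, 6), (6, 7), (7, 4)])
  exact e

lemma sectionMap_colinear :
    E.sectionMap ≫ B ◁ Δ[H] ≫ (α_ B H H).inv =
    rho H A ≫ E.sectionMap ▷ H := by
  have e := Computes.eq_of_imp (((comp_coact E 0 1 2).comp ((comp_prj E 1 5).whiskerRight
    (tx 2))).comp (((comp_comul E 2 6 7).whiskerLeft (tb 5)).comp (comp_assocInv E (tb 5) (tx 6)
      (tx 7))))
    ((comp_coact E 0 1 7).comp (((comp_coact E 1 2 6).comp ((comp_prj E 2 5).whiskerRight
      (tx 6))).whiskerRight (tx 7)))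
    (
    .replace (eq_prj_coact E) [0, 0, 0, 2, 1, 5, 6, 7, 3] [] <|
    .finish [(3, 2)])
  exact e

lemma retractionMap_colinear (hj : E.IsCoinv) (hE : E.IsCleft) :
    E.retractionMap ≫ rho H A =
    (B ◁ Δ[H] ≫ (α_ B H H).inv) ≫ E.retractionMap ▷ H := by
  have e := Computes.eq_of_imp ((((comp_fst E 1 4).whiskerLeft (tb 0)).comp (((comp_inc
    E 0 5).whiskerRight (ta 4)).comp (comp_mulA E 5 4 6))).comp (comp_coact E 6 2 3))
    ((((comp_comul E 1 4 3).whiskerLeft (tb 0)).comp (comp_assocInv E (tb 0) (tx 4) (tx 3))).comp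
      ((((comp_fst E 4 5).whiskerLeft (tb 0)).comp (((comp_inc E 0 6).whiskerRight (ta 5)).comp
        (comp_mulA E 6 5 2))).whiskerRight (tx 3)))
    (
    .replace (eq_inc_mul_fst_coact E hj hE) [0, 1, 2, 3, 5, 4, 6, 7] [] <|
    .finish [(4, 5), (5, 6), (7, 4)])
  exact e

lemma retractionMap_linear (hj : E.IsCoinv) :
    (α_ B B H).inv ≫ ((E.j ⊗ₘ E.j) ≫ mu A) ▷ H ≫ A ◁ E.h ≫ mu A =
    B ◁ E.retractionMap ≫ E.j ▷ A ≫ mu A := by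
  have e := Computes.eq_of_imp ((comp_assocInv E (tb 0) (tb 1) (tx 2)).comp (((((comp_inc
    E 0 4).tensorHom (comp_inc E 1 5)).comp (comp_mulA E 4 5 6)).whiskerRight (tx 2)).comp
      (((comp_fst E 2 7).whiskerLeft (ta 6)).comp (comp_mulA E 6 7 3))))
    (((((comp_fst E 2 4).whiskerLeft (tb 1)).comp (((comp_inc E 1 5).whiskerRight (ta 4)).comp
      (comp_mulA E 5 4 6))).whiskerLeft (tb 0)).comp (((comp_inc E 0 7).whiskerRight (ta 6)).comp
        (comp_mulA E 7 6 3)))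
    (
    .replace (eq_inc_mul_mul_fst E hj) [0, 1, 2, 3, 4, 5, 6, 7] [] <|
    .finish [(4, 7), (7, 4)])
  exact e

lemma act_comp_prj (hj : E.IsCoinv) (hE : E.IsCleft) (hq : E.Factors) :
    (E.j ▷ A ≫ mu A) ≫ E.q ≫ E.j =
    B ◁ E.q ≫ (E.j ⊗ₘ E.j) ≫ mu A := by
  have e := Computes.eq_of_imp ((((comp_inc E 0 3).whiskerRight (ta 1)).comp (comp_mulA
    E 3 1 4)).comp ((comp_prj E 4 5).comp (comp_inc E 5 2)))
    (((comp_prj E 1 3).whiskerLeft (tb 0)).comp (((comp_inc E 0 4).tensorHom (comp_inc E 3 5)).comp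
      (comp_mulA E 4 5 2)))
    (
    .replace (eq_inc_mul_prj E hj hE hq) [0, 1, 2, 3, 4, 5] [] <|
    .finish [])
  exact e

lemma mul_prj_balanced (hj : E.IsCoinv) (hl : E.Linear) :
    (A ◁ E.j ≫ mu A) ▷ A ≫ A ◁ (E.q ≫ E.j) ≫ mu A =
    (α_ A B A).hom ≫ A ◁ (E.j ▷ A ≫ mu A) ≫ A ◁ (E.q ≫ E.j) ≫ mu A := by
  have e := Computes.eq_of_imp ((comp_assoc E (ta 0) (tb 1) (ta 2)).comp (((((comp_inc
    E 1 4).whiskerRight (ta 2)).comp (comp_mulA E 4 2 5)).whiskerLeft (ta 0)).comp ((((comp_prj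
      E 5 6).comp (comp_inc E 6 7)).whiskerLeft (ta 0)).comp (comp_mulA E 0 7 3))))
    (((((comp_inc E 1 4).whiskerLeft (ta 0)).comp (comp_mulA E 0 4 5)).whiskerRight (ta 2)).comp
      ((((comp_prj E 2 6).comp (comp_inc E 6 7)).whiskerLeft (ta 5)).comp (comp_mulA E 5 7 3)))
    (
    .replace (eq_mul_prj_inc_mul E hj hl) [0, 1, 2, 3, 4, 5, 6, 7] [] <|
    .finish [])
  exact e.symm

lemma nabla_comp_snd_fst (hE : E.IsGalois) :
    nabla H A ≫ A ◁ Δ[H] ≫ (α_ A H H).inv ≫ (A ◁ E.k ⊗ₘ E.h) ≫ mu A ▷ A ≫ mu A =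
    A ◁ Δ[H] ≫ (α_ A H H).inv ≫ (A ◁ E.k ⊗ₘ E.h) ≫ mu A ▷ A ≫ mu A := by
  have e := Computes.eq_of_imp (((comp_rightUnitorInv E (.tensor (ta 0) (tx 1))).comp ((((comp_oneA
    E 3).comp (comp_coact E 3 4 5)).whiskerLeft (.tensor (ta 0) (tx 1))).comp ((comp_tensorMu E (X₁
      := (ta 0)) (X₂ := (tx 1)) (Y₁ := (ta 4)) (Y₂ := (tx 5)) (by decide)).comp ((comp_mulA
        E 0 4 6).tensorHom (comp_mulH E 1 5 7))))).comp (((comp_comul E 7 8 9).whiskerLeft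
          (ta 6)).comp ((comp_assocInv E (ta 6) (tx 8) (tx 9)).comp ((((comp_snd
            E 8 10).whiskerLeft (ta 6)).tensorHom (comp_fst E 9 11)).comp (((comp_mulA
              E 6 10 12).whiskerRight (ta 11)).comp (comp_mulA E 12 11 2))))))
    (((comp_comul E 1 3 4).whiskerLeft (ta 0)).comp ((comp_assocInv E (ta 0) (tx 3) (tx 4)).comp
      ((((comp_snd E 3 5).whiskerLeft (ta 0)).tensorHom (comp_fst E 4 6)).comp (((comp_mulA
        E 0 5 7).whiskerRight (ta 6)).comp (comp_mulA E 7 6 2)))))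
    (
    .replace (eq_nabla_snd_fst E hE) [0, 1, 2, 8, 9, 10, 12, 11, 0, 0, 0, 0, 0, 0, 0, 0, 0, 0, 0,
      0, 0, 0, 0, 0, 0, 0, 0, 0, 0, 0, 3, 4, 5, 6, 7] [] <|
    .finish [(8, 3), (9, 4), (10, 5), (11, 6), (12, 7)])
  exact e

lemma nabla_comp_cleftUnit :
    nabla H A ≫ A ◁ cleftUnit H A ≫ mu A =
    A ◁ cleftUnit H A ≫ mu A := by
  let E : Env H A A := .trivial H A
  have e := Computes.eq_of_imp (((comp_rightUnitorInv E (.tensor (ta 0) (tx 1))).comp ((((comp_oneA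
    E 3).comp (comp_coact E 3 4 5)).whiskerLeft (.tensor (ta 0) (tx 1))).comp ((comp_tensorMu E (X₁
      := (ta 0)) (X₂ := (tx 1)) (Y₁ := (ta 4)) (Y₂ := (tx 5)) (by decide)).comp ((comp_mulA
        E 0 4 6).tensorHom (comp_mulH E 1 5 7))))).comp (((comp_clu E 7 8).whiskerLeft (ta 6)).comp
          (comp_mulA E 6 8 2)))
    (((comp_clu E 1 3).whiskerLeft (ta 0)).comp (comp_mulA E 0 3 2))
    (
    .replace (eq_nabla_clu E) [0, 1, 2, 8, 0, 0, 0, 0, 0, 0, 0, 0, 0, 0, 0, 0, 0, 0, 0, 0, 0, 0, 0,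
      0, 0, 0, 0, 0, 0, 0, 3, 4, 5, 6, 7] [] <|
    .finish [(8, 3)])
  exact e

lemma canonical_comp_snd_fst (hj : E.IsCoinv) (hE : E.IsGalois) :
    canonical H A ≫ A ◁ Δ[H] ≫ (α_ A H H).inv ≫ (A ◁ E.k ⊗ₘ E.h) ≫ mu A ▷ A ≫ mu A =
    canonical H A ≫ A ◁ cleftUnit H A ≫ mu A := by
  have e := Computes.eq_of_imp ((((comp_coact E 1 3 4).whiskerLeft (ta 0)).comp ((comp_assocInv E
    (ta 0) (ta 3) (tx 4)).comp ((comp_mulA E 0 3 5).whiskerRight (tx 4)))).comp (((comp_comul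
      E 4 6 7).whiskerLeft (ta 5)).comp ((comp_assocInv E (ta 5) (tx 6) (tx 7)).comp ((((comp_snd
        E 6 8).whiskerLeft (ta 5)).tensorHom (comp_fst E 7 9)).comp (((comp_mulA
          E 5 8 10).whiskerRight (ta 9)).comp (comp_mulA E 10 9 2))))))
    ((((comp_coact E 1 3 4).whiskerLeft (ta 0)).comp ((comp_assocInv E (ta 0) (ta 3) (tx 4)).comp
      ((comp_mulA E 0 3 5).whiskerRight (tx 4)))).comp (((comp_clu E 4 6).whiskerLeft (ta 5)).comp
        (comp_mulA E 5 6 2)))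
    (
    .replace (eq_can_snd_mul_fst E hj hE) [0, 1, 2, 6, 7, 8, 10, 9, 0, 0, 0, 0, 0, 0, 0, 0, 0, 0,
      0, 0, 3, 4, 5] [] <|
    .finish [])
  exact e

lemma canonical_comp_snd_coact (hj : E.IsCoinv) (hE : E.IsGalois) :
    canonical H A ≫ (A ◁ E.k ≫ mu A) ≫ rho H A =
    canonical H A ≫ nabla H A ≫ E.sndCoact := by
  have e := Computes.eq_of_imp ((((comp_coact E 1 4 5).whiskerLeft (ta 0)).comp ((comp_assocInv E
    (ta 0) (ta 4) (tx 5)).comp ((comp_mulA E 0 4 6).whiskerRight (tx 5)))).comp ((((comp_snd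
      E 5 7).whiskerLeft (ta 6)).comp (comp_mulA E 6 7 8)).comp (comp_coact E 8 2 3)))
    ((((comp_coact E 1 4 5).whiskerLeft (ta 0)).comp ((comp_assocInv E (ta 0) (ta 4) (tx 5)).comp
      ((comp_mulA E 0 4 6).whiskerRight (tx 5)))).comp (((comp_rightUnitorInv E (.tensor (ta 6)
        (tx 5))).comp ((((comp_oneA E 7).comp (comp_coact E 7 8 9)).whiskerLeft (.tensor (ta 6)
          (tx 5))).comp ((comp_tensorMu E (X₁ := (ta 6)) (X₂ := (tx 5)) (Y₁ := (ta 8)) (Y₂ :=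
            (tx 9)) (by decide)).comp ((comp_mulA E 6 8 10).tensorHom (comp_mulH E 5 9 11))))).comp
              (((comp_coact E 10 12 13).whiskerRight (tx 11)).comp ((((comp_comul E 11 14 15).comp
                ((comp_braid E (tx 14) (tx 15)).comp (((comp_snd E 15 16).whiskerRight
                  (tx 14)).comp ((comp_lam E 14 17).whiskerLeft (ta 16))))).whiskerLeft (.tensor
                    (ta 12) (tx 13))).comp ((comp_tensorMu E (X₁ := (ta 12)) (X₂ := (tx 13)) (Y₁ :=
                      (ta 16)) (Y₂ := (tx 17)) (by decide)).comp ((comp_mulA E 12 16 2).tensorHom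
                        (comp_mulH E 13 17 3)))))))
    (
    .replace (eq_can_snd_coact E hj hE) [0, 1, 2, 3, 7, 8, 14, 15, 16, 17, 0, 0, 0, 0, 0, 0, 0, 0,
      0, 0, 4, 5, 6, 0, 0, 0, 0, 0, 0, 0, 9, 10, 11, 12, 13] [] <|
    .finish [(7, 12), (8, 13), (9, 7), (10, 8), (11, 9), (12, 10), (13, 11), (16, 17), (17, 16)])
  exact e

lemma canonical_comp_snd_coact_bar (hj : E.IsCoinv) (hE : E.IsGalois) :
    canonical H A ≫ (A ◁ E.k ≫ mu A) ≫ rho H A ≫ A ◁ barSource H =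
    canonical H A ≫ nabla H A ≫ E.sndCoactBar := by
  have e := Computes.eq_of_imp ((((comp_coact E 1 4 5).whiskerLeft (ta 0)).comp ((comp_assocInv E
    (ta 0) (ta 4) (tx 5)).comp ((comp_mulA E 0 4 6).whiskerRight (tx 5)))).comp ((((comp_snd
      E 5 7).whiskerLeft (ta 6)).comp (comp_mulA E 6 7 8)).comp ((comp_coact E 8 2 9).comp
        ((comp_bar E 9 3).whiskerLeft (ta 2)))))
    ((((comp_coact E 1 4 5).whiskerLeft (ta 0)).comp ((comp_assocInv E (ta 0) (ta 4) (tx 5)).comp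
      ((comp_mulA E 0 4 6).whiskerRight (tx 5)))).comp (((comp_rightUnitorInv E (.tensor (ta 6)
        (tx 5))).comp ((((comp_oneA E 7).comp (comp_coact E 7 8 9)).whiskerLeft (.tensor (ta 6)
          (tx 5))).comp ((comp_tensorMu E (X₁ := (ta 6)) (X₂ := (tx 5)) (Y₁ := (ta 8)) (Y₂ :=
            (tx 9)) (by decide)).comp ((comp_mulA E 6 8 10).tensorHom (comp_mulH E 5 9 11))))).comp
              ((((comp_comul E 11 12 13).comp ((comp_braid E (tx 12) (tx 13)).comp (((comp_snd
                E 13 14).whiskerRight (tx 12)).comp ((comp_tgt E 12 3).whiskerLeft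
                  (ta 14))))).whiskerLeft (ta 10)).comp ((comp_assocInv E (ta 10) (ta 14)
                    (tx 3)).comp ((comp_mulA E 10 14 2).whiskerRight (tx 3))))))
    (
    .replace (eq_can_snd_coact_bar E hj hE) [0, 1, 2, 3, 7, 8, 9, 0, 0, 0, 0, 0, 0, 0, 0, 0, 0, 0,
      0, 0, 4, 5, 6, 0, 0, 0, 0, 0, 0, 0, 10, 11, 12, 13, 14] [] <|
    .finish [(7, 12), (8, 13), (9, 14), (10, 7), (11, 8), (12, 9), (13, 10), (14, 11)])
  exact e

lemma conv_snd_fst (hv : E.SndFst) :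
    conv E.k E.h =
    cleftUnit H A := by
  have e := Computes.eq_of_imp ((comp_comul E 0 2 3).comp (((comp_snd E 2 4).tensorHom (comp_fst
    E 3 5)).comp (comp_mulA E 4 5 1)))
    (comp_clu E 0 1)
    (
    .replace (eq_snd_conv_fst E hv) [0, 1, 2, 3, 4, 5] [] <|
    .finish [])
  exact e

lemma mul_snd_coact (hc : E.SndCoact) (hb : E.SndCoactBar) :
    Δ[H] ≫ H ◁ (E.k ≫ rho H A) ≫ (α_ H A H).inv ≫ (β_ H A).hom ▷ H ≫ (α_ A H H).hom ≫ A ◁ mu H =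
    E.k ≫ rho H A ≫ A ◁ barSource H := by
  have e := Computes.eq_of_imp ((comp_comul E 0 3 4).comp ((((comp_snd E 4 5).comp (comp_coact
    E 5 1 6)).whiskerLeft (tx 3)).comp ((comp_assocInv E (tx 3) (ta 1) (tx 6)).comp (((comp_braid E
      (tx 3) (ta 1)).whiskerRight (tx 6)).comp ((comp_assoc E (ta 1) (tx 3) (tx 6)).comp
        ((comp_mulH E 3 6 2).whiskerLeft (ta 1)))))))
    ((comp_snd E 0 3).comp ((comp_coact E 3 1 4).comp ((comp_bar E 4 2).whiskerLeft (ta 1))))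
    (
    .replace (eq_snd_shift E hc hb) [0, 1, 2, 3, 4, 5, 6] [] <|
    .finish [])
  exact e

lemma mul_fst_snd_eq (hE : E.IsGalois) :
    A ◁ Δ[H] ≫ (α_ A H H).inv ≫ (A ◁ E.h ⊗ₘ E.k) ≫ mu A ▷ A ≫ mu A =
    A ◁ conv E.h E.k ≫ mu A := by
  have e := Computes.eq_of_imp (((comp_comul E 1 3 4).whiskerLeft (ta 0)).comp ((comp_assocInv E
    (ta 0) (tx 3) (tx 4)).comp ((((comp_fst E 3 5).whiskerLeft (ta 0)).tensorHom (comp_snd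
      E 4 6)).comp (((comp_mulA E 0 5 7).whiskerRight (ta 6)).comp (comp_mulA E 7 6 2)))))
    ((((comp_comul E 1 3 4).comp (((comp_fst E 3 5).tensorHom (comp_snd E 4 6)).comp (comp_mulA
      E 5 6 7))).whiskerLeft (ta 0)).comp (comp_mulA E 0 7 2))
    (
    .replace (eq_mul_fst_snd E hE) [0, 1, 2, 3, 4, 5, 7, 6] [] <|
    .finish [(6, 7), (7, 6)])
  exact e

/-! ### Equations of morphisms read as program identities. -/

lemma Env.isCoinv (hj : E.j ≫ rho H A = E.j ≫ rho H A ≫ A ◁ target H)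
    (hm : A ◁ (E.j ▷ A ≫ mu A) ≫ mu A = (α_ A B A).inv ≫ (A ◁ E.j ≫ mu A) ▷ A ≫ mu A) : E.IsCoinv
      where
  inc_coact := hj
  middle :=
  (Imp.eqv (
    .replace ((((((comp_inc E 1 4).whiskerRight (ta 2)).comp (comp_mulA E 4 2 5)).whiskerLeft
      (ta 0)).comp (comp_mulA E 0 5 3)).eqv ((comp_assocInv E (ta 0) (tb 1) (ta 2)).comp
        (((((comp_inc E 1 4).whiskerLeft (ta 0)).comp (comp_mulA E 0 4 5)).whiskerRight
          (ta 2)).comp (comp_mulA E 5 2 3))) hm) [0, 1, 2, 3, 4, 5] [] <|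
    .finish []))

lemma Env.isCleft (h₀ : E.h ≫ rho H A = Δ[H] ≫ E.h ▷ H)
    (h₂ : Δ[H] ≫ H ◁ (E.k ≫ rho H A) ≫ (α_ H A H).inv ≫ (β_ H A).hom ▷ H ≫ (α_ A H H).hom ≫ A ◁ mu
      H = E.k ≫ rho H A ≫ A ◁ barSource H)
    (h₃ : A ◁ Δ[H] ≫ (α_ A H H).inv ≫ (A ◁ E.k ⊗ₘ E.h) ≫ mu A ▷ A ≫ mu A = A ◁ cleftUnit H A ≫ mu A)
    (h₄ : A ◁ Δ[H] ≫ (α_ A H H).inv ≫ (A ◁ E.h ⊗ₘ E.k) ≫ mu A ▷ A ≫ mu A = A ◁ conv E.h E.k ≫ mu A)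
      : E.IsCleft where
  fst_coact :=
  (Imp.eqv (
    .replace (((comp_fst E 0 3).comp (comp_coact E 3 1 2)).eqv ((comp_comul E 0 3 2).comp
      ((comp_fst E 3 1).whiskerRight (tx 2))) h₀) [0, 1, 2, 3] [] <|
    .finish []))
  shift :=
  (Imp.eqv (
    .replace (((comp_comul E 0 3 4).comp ((((comp_snd E 4 5).comp (comp_coact E 5 1 6)).whiskerLeft
      (tx 3)).comp ((comp_assocInv E (tx 3) (ta 1) (tx 6)).comp (((comp_braid E (tx 3)
        (ta 1)).whiskerRight (tx 6)).comp ((comp_assoc E (ta 1) (tx 3) (tx 6)).comp ((comp_mulH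
          E 3 6 2).whiskerLeft (ta 1))))))).eqv ((comp_snd E 0 3).comp ((comp_coact E 3 1 4).comp
            ((comp_bar E 4 2).whiskerLeft (ta 1)))) h₂) [0, 1, 2, 3, 4, 5, 6] [] <|
    .finish []))
  mul_snd_fst :=
  (Imp.eqv (
    .replace ((((comp_comul E 1 3 4).whiskerLeft (ta 0)).comp ((comp_assocInv E (ta 0) (tx 3)
      (tx 4)).comp ((((comp_snd E 3 5).whiskerLeft (ta 0)).tensorHom (comp_fst E 4 6)).comp
        (((comp_mulA E 0 5 7).whiskerRight (ta 6)).comp (comp_mulA E 7 6 2))))).eqv (((comp_clu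
          E 1 3).whiskerLeft (ta 0)).comp (comp_mulA E 0 3 2)) h₃) [0, 1, 2, 3, 4, 5, 7, 6] [] <|
    .finish []))
  mul_fst_snd :=
  (Imp.eqv (
    .replace ((((comp_comul E 1 3 4).whiskerLeft (ta 0)).comp ((comp_assocInv E (ta 0) (tx 3)
      (tx 4)).comp ((((comp_fst E 3 5).whiskerLeft (ta 0)).tensorHom (comp_snd E 4 6)).comp
        (((comp_mulA E 0 5 7).whiskerRight (ta 6)).comp (comp_mulA E 7 6 2))))).eqv ((((comp_comul
          E 1 3 4).comp (((comp_fst E 3 5).tensorHom (comp_snd E 4 6)).comp (comp_mulA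
            E 5 6 7))).whiskerLeft (ta 0)).comp (comp_mulA E 0 7 2)) h₄) [0, 1, 2, 3, 4, 5, 7, 6]
              [] <|
    .finish [(6, 7), (7, 6)]))

lemma Env.factors (hq : E.q ≫ E.j = rho H A ≫ A ◁ E.k ≫ mu A) : E.Factors :=
  (Imp.eqv (
    .replace (((comp_prj E 0 2).comp (comp_inc E 2 1)).eqv ((comp_coact E 0 2 3).comp (((comp_snd
      E 3 4).whiskerLeft (ta 2)).comp (comp_mulA E 2 4 1))) hq) [0, 1, 2, 3, 4] [] <|
    .finish []))

lemma Env.isGalois (h₀ : E.h ≫ rho H A = Δ[H] ≫ E.h ▷ H)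
    (hr : E.sectionMap ≫ E.retractionMap = 𝟙 A)
    (hk : canonical H A ≫ A ◁ E.k ≫ mu A = A ◁ (E.q ≫ E.j) ≫ mu A)
    (hn : nabla H A ≫ A ◁ E.k ≫ mu A = A ◁ E.k ≫ mu A) : E.IsGalois where
  fst_coact :=
  (Imp.eqv (
    .replace (((comp_fst E 0 3).comp (comp_coact E 3 1 2)).eqv ((comp_comul E 0 3 2).comp
      ((comp_fst E 3 1).whiskerRight (tx 2))) h₀) [0, 1, 2, 3] [] <|
    .finish []))
  reconstruct :=
  (Imp.eqv (
    .replace ((((comp_coact E 0 1 2).comp ((comp_prj E 1 3).whiskerRight (tx 2))).comp (((comp_fst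
      E 2 4).whiskerLeft (tb 3)).comp (((comp_inc E 3 5).whiskerRight (ta 4)).comp (comp_mulA
        E 5 4 0)))).eqv (comp_id E (ta 0)) hr) [0, 2, 3, 4, 6, 5] [] <|
    .finish []))
  can_snd :=
  (Imp.eqv (
    .replace (((((comp_coact E 1 3 4).whiskerLeft (ta 0)).comp ((comp_assocInv E (ta 0) (ta 3)
      (tx 4)).comp ((comp_mulA E 0 3 5).whiskerRight (tx 4)))).comp (((comp_snd E 4 6).whiskerLeft
        (ta 5)).comp (comp_mulA E 5 6 2))).eqv ((((comp_prj E 1 3).comp (comp_inc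
          E 3 4)).whiskerLeft (ta 0)).comp (comp_mulA E 0 4 2)) hk) [0, 1, 2, 3, 4, 5, 6] [] <|
    .finish []))
  nabla_snd :=
  (Imp.eqv (
    .replace ((((comp_rightUnitorInv E (.tensor (ta 0) (tx 1))).comp ((((comp_oneA E 3).comp
      (comp_coact E 3 4 5)).whiskerLeft (.tensor (ta 0) (tx 1))).comp ((comp_tensorMu E (X₁ :=
        (ta 0)) (X₂ := (tx 1)) (Y₁ := (ta 4)) (Y₂ := (tx 5)) (by decide)).comp ((comp_mulA
          E 0 4 6).tensorHom (comp_mulH E 1 5 7))))).comp (((comp_snd E 7 8).whiskerLeft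
            (ta 6)).comp (comp_mulA E 6 8 2))).eqv (((comp_snd E 1 3).whiskerLeft (ta 0)).comp
              (comp_mulA E 0 3 2)) hn) [0, 1, 2, 30, 31, 32, 33, 34, 8] [] <|
    .finish [(30, 3)]))

lemma Env.linear (hl : (E.j ▷ A ≫ mu A) ≫ E.q ≫ E.j = B ◁ E.q ≫ (E.j ⊗ₘ E.j) ≫ mu A) : E.Linear :=
  (Imp.eqv (
    .replace (((((comp_inc E 0 3).whiskerRight (ta 1)).comp (comp_mulA E 3 1 4)).comp ((comp_prj
      E 4 5).comp (comp_inc E 5 2))).eqv (((comp_prj E 1 3).whiskerLeft (tb 0)).comp (((comp_inc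
        E 0 4).tensorHom (comp_inc E 3 5)).comp (comp_mulA E 4 5 2))) hl) [0, 1, 2, 3, 4, 5] [] <|
    .finish []))

lemma Env.sndFst_of (hv : A ◁ Δ[H] ≫ (α_ A H H).inv ≫ (A ◁ E.k ⊗ₘ E.h) ≫ mu A ▷ A ≫ mu A = A ◁
  cleftUnit H A ≫ mu A) : E.SndFst :=
  (Imp.eqv (
    .replace ((((comp_comul E 1 3 4).whiskerLeft (ta 0)).comp ((comp_assocInv E (ta 0) (tx 3)
      (tx 4)).comp ((((comp_snd E 3 5).whiskerLeft (ta 0)).tensorHom (comp_fst E 4 6)).comp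
        (((comp_mulA E 0 5 7).whiskerRight (ta 6)).comp (comp_mulA E 7 6 2))))).eqv (((comp_clu
          E 1 3).whiskerLeft (ta 0)).comp (comp_mulA E 0 3 2)) hv) [0, 1, 2, 3, 4, 5, 7, 6] [] <|
    .finish []))

lemma Env.sndCoact_of (hc : (A ◁ E.k ≫ mu A) ≫ rho H A = nabla H A ≫ E.sndCoact) : E.SndCoact :=
  (Imp.eqv (
    .replace (((((comp_snd E 1 4).whiskerLeft (ta 0)).comp (comp_mulA E 0 4 5)).comp (comp_coact
      E 5 2 3)).eqv (((comp_rightUnitorInv E (.tensor (ta 0) (tx 1))).comp ((((comp_oneA E 4).comp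
        (comp_coact E 4 5 6)).whiskerLeft (.tensor (ta 0) (tx 1))).comp ((comp_tensorMu E (X₁ :=
          (ta 0)) (X₂ := (tx 1)) (Y₁ := (ta 5)) (Y₂ := (tx 6)) (by decide)).comp ((comp_mulA
            E 0 5 7).tensorHom (comp_mulH E 1 6 8))))).comp (((comp_coact E 7 9 10).whiskerRight
              (tx 8)).comp ((((comp_comul E 8 11 12).comp ((comp_braid E (tx 11) (tx 12)).comp
                (((comp_snd E 12 13).whiskerRight (tx 11)).comp ((comp_lam E 11 14).whiskerLeft
                  (ta 13))))).whiskerLeft (.tensor (ta 9) (tx 10))).comp ((comp_tensorMu E (X₁ :=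
                    (ta 9)) (X₂ := (tx 10)) (Y₁ := (ta 13)) (Y₂ := (tx 14)) (by decide)).comp
                      ((comp_mulA E 9 13 2).tensorHom (comp_mulH E 10 14 3)))))) hc) [0, 1, 2, 3,
                        4, 5, 6, 7, 8, 9, 10, 11, 12, 13, 14] [] <|
    .finish [(4, 30), (5, 31), (6, 32), (7, 33), (8, 34), (9, 4), (10, 5), (11, 6), (12, 7), (13,
      9), (14, 8)]))

lemma Env.sndCoactBar_of (hb : (A ◁ E.k ≫ mu A) ≫ rho H A ≫ A ◁ barSource H = nabla H A ≫
  E.sndCoactBar) : E.SndCoactBar :=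
  (Imp.eqv (
    .replace (((((comp_snd E 1 4).whiskerLeft (ta 0)).comp (comp_mulA E 0 4 5)).comp ((comp_coact
      E 5 2 6).comp ((comp_bar E 6 3).whiskerLeft (ta 2)))).eqv (((comp_rightUnitorInv E (.tensor
        (ta 0) (tx 1))).comp ((((comp_oneA E 4).comp (comp_coact E 4 5 6)).whiskerLeft (.tensor
          (ta 0) (tx 1))).comp ((comp_tensorMu E (X₁ := (ta 0)) (X₂ := (tx 1)) (Y₁ := (ta 5)) (Y₂
            := (tx 6)) (by decide)).comp ((comp_mulA E 0 5 7).tensorHom (comp_mulH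
              E 1 6 8))))).comp ((((comp_comul E 8 9 10).comp ((comp_braid E (tx 9) (tx 10)).comp
                (((comp_snd E 10 11).whiskerRight (tx 9)).comp ((comp_tgt E 9 3).whiskerLeft
                  (ta 11))))).whiskerLeft (ta 7)).comp ((comp_assocInv E (ta 7) (ta 11)
                    (tx 3)).comp ((comp_mulA E 7 11 2).whiskerRight (tx 3))))) hb) [0, 1, 2, 3, 4,
                      5, 6, 7, 8, 9, 10, 11] [] <|
    .finish [(4, 30), (5, 31), (6, 32), (7, 33), (8, 34), (9, 4), (10, 5), (11, 6)]))

end Programs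

variable {C : Type u} [Category.{v} C] [MonoidalCategory C] [SymmetricCategory C]

/-- The splitting of an idempotent by an equalizer. -/
def splittingOfIdempotent [HasEqualizers C] {X : C} (f : X ⟶ X) (hf : f ≫ f = f) :
    Splitting f where
  obj := equalizer f (𝟙 X)
  i := equalizer.ι f (𝟙 X)
  p := equalizer.lift f (by rw [hf, Category.comp_id])
  p_i := equalizer.lift_ι _ _
  i_p := by
    ext
    rw [Category.assoc, equalizer.lift_ι, equalizer.condition, Category.comp_id, Category.id_comp]

variable {H A : C} [WeakHopfQuasigroup H] [UnitalMagmaObj A] [RightComoduleMagma H A]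
  [HasEqualizers C]

lemma coinvMul_incl : coinvMul H A ≫ incl H A = (incl H A ⊗ₘ incl H A) ≫ mu A :=
  equalizer.lift_ι _ _

lemma coinvUnit_incl : coinvUnit H A ≫ incl H A = un A :=
  equalizer.lift_ι _ _

lemma isCoinv_of_incl (E : Env H A (coinv H A)) (hi : E.j = incl H A) (hm : AssocMiddle H A) :
    E.IsCoinv :=
  E.isCoinv (by rw [hi]; exact incl_rho H A) (by rw [hi]; exact hm)

/-- Projecting to A □ H and including back applies ∇, which fixes can. -/
lemma gamma_comp_i [HasCoequalizers C] (hm : AssocMiddle H A) (S : Splitting (nabla H A)) :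
    relProj H A ≫ gamma hm S ≫ S.i = canonical H A := by
  rw [← Category.assoc, proj_gamma]
  refine Eq.trans ?_ (canonical_comp_nabla (H := H) (A := A))
  refine Eq.trans ?_ (congrArg (fun t => canonical H A ≫ t) S.p_i)
  simp only [canonical, Category.assoc]

lemma nabla_comp_p (S : Splitting (nabla H A)) : nabla H A ≫ S.p = S.p := by
  have h : (S.p ≫ S.i) ≫ S.p = S.p := by rw [Category.assoc, S.i_p, Category.comp_id]
  rwa [S.p_i] at h

lemma proj_comp_gamma [HasCoequalizers C] (hm : AssocMiddle H A) (S : Splitting (nabla H A)) :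
    relProj H A ≫ gamma hm S = canonical H A ≫ S.p := by
  rw [proj_gamma, canonical]
  simp only [Category.assoc]

instance [HasCoequalizers C] : Epi (relProj H A) := coequalizer.π_epi

/-! ### From a cleft extension to Galois with normal basis. -/

section Cleft

variable (E : Env H A (coinv H A))

/-- The lift of can(a ⊗ b) is a q(b₀) ⊗ h(b₁). In the relative tensor product q(b₀) moves to the
other side, where q(b₀) h(b₁) = b. -/
lemma gamma_comp_lift [HasCoequalizers C] (hi : E.j = incl H A) (hj : E.IsCoinv) (hE : E.IsCleft)
    (hq : E.Factors) (hm : AssocMiddle H A) (S : Splitting (nabla H A)) :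
    gamma hm S ≫ S.i ≫ E.lift ≫ relProj H A = 𝟙 _ := by
  rw [← cancel_epi (relProj H A), ← Category.assoc, ← Category.assoc, Category.assoc _ _ S.i,
    gamma_comp_i, ← Category.assoc, canonical_comp_lift E hj hE hq, hi, Category.assoc,
    Category.assoc, relProj_condition, Iso.inv_hom_id_assoc, ← whiskerLeft_comp_assoc,
    Category.comp_id]
  have h := sectionMap_comp_retractionMap E hE hq
  rw [Env.sectionMap, Env.retractionMap, hi] at h
  simp only [Category.assoc] at h ⊢
  rw [h, whiskerLeft_id, Category.id_comp]

lemma lift_comp_gamma [HasCoequalizers C] (hE : E.IsCleft) (hm : AssocMiddle H A)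
    (S : Splitting (nabla H A)) : E.lift ≫ relProj H A ≫ gamma hm S = S.p := by
  rw [proj_comp_gamma, ← Category.assoc, lift_comp_canonical E hE, nabla_comp_p]

lemma isWeakGalois [HasCoequalizers C] (hi : E.j = incl H A) (hj : E.IsCoinv) (hE : E.IsCleft)
    (hq : E.Factors) (hm : AssocMiddle H A) (S : Splitting (nabla H A)) : IsWeakGalois hm S :=
  ⟨S.i ≫ E.lift ≫ relProj H A, gamma_comp_lift E hi hj hE hq hm S, by
    rw [Category.assoc, Category.assoc, lift_comp_gamma E hE, S.i_p]⟩

/-- Here γ⁻¹ p is n composed with the lift a ⊗ x ↦ a k(x₁) ⊗ h(x₂), and the lift is the multiple by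
a of its value at 1 ⊗ x; only the unit law is used for this. -/
lemma inverseAlmostLineal [HasCoequalizers C]
    [PreservesColimitsOfShape WalkingParallelPair (tensorLeft A)] (hE : E.IsCleft)
    (hm : AssocMiddle H A) (hr : AssocRight H A) (S : Splitting (nabla H A))
    (hG : IsWeakGalois hm S) : InverseAlmostLineal hm hr S hG := by
  have : IsIso (gamma hm S) := hG
  have h : S.p ≫ inv (gamma hm S) = E.lift ≫ relProj H A := by
    rw [IsIso.comp_inv_eq, Category.assoc, lift_comp_gamma E hE]
  rw [InverseAlmostLineal, h]
  have e := proj_relAct (H := H) (A := A) hr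
  have l := lift_eq E
  simp only [whiskerLeft_comp, Category.assoc] at l ⊢
  rw [e]
  -- Only the lift on the left is expanded; the right side contains the same morphism.
  nth_rw 1 [l]
  simp only [Category.assoc]

lemma act_comp_sectionMap (hi : E.j = incl H A) (hj : E.IsCoinv) (hE : E.IsCleft)
    (hq : E.Factors) : actA H A ≫ E.sectionMap = coinv H A ◁ E.sectionMap ≫ actFree H A := by
  have h : actA H A ≫ E.q = coinv H A ◁ E.q ≫ coinvMul H A := by
    rw [← cancel_mono (incl H A), Category.assoc, Category.assoc, coinvMul_incl]
    have h := act_comp_prj E hj hE hq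
    rw [hi] at h
    exact h
  have h' : actA H A ≫ rho H A = coinv H A ◁ rho H A ≫ (α_ _ _ _).inv ≫ actA H A ▷ H := by
    rw [actA, Category.assoc, incl_mul_rho]
  rw [Env.sectionMap, reassoc_of% h', ← comp_whiskerRight, h, actFree]
  monoidal

lemma actFree_comp_retractionMap (hi : E.j = incl H A) (hj : E.IsCoinv) :
    actFree H A ≫ E.retractionMap = coinv H A ◁ E.retractionMap ≫ actA H A := by
  have h := retractionMap_linear E hj
  rw [hi] at h
  rw [actA, ← h, actFree, Env.retractionMap, hi, ← coinvMul_incl]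
  have e : coinv H A ◁ E.h ≫ incl H A ▷ A = incl H A ▷ H ≫ A ◁ E.h := whisker_exchange _ _
  simp only [Category.assoc, comp_whiskerRight, reassoc_of% e]

/-- Section and retraction present A itself as the image of the idempotent, so the isomorphism b may
be the identity. -/
lemma hasNormalBasis (hi : E.j = incl H A) (hj : E.IsCoinv) (hE : E.IsCleft)
    (hq : E.Factors) : HasNormalBasis H A := by
  have hs := act_comp_sectionMap E hi hj hE hq
  have hr := actFree_comp_retractionMap E hi hj
  have hsr := sectionMap_comp_retractionMap E hE hq
  have cs : E.sectionMap ≫ coactFree H A = rho H A ≫ E.sectionMap ▷ H := sectionMap_colinear E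
  have cr : E.retractionMap ≫ rho H A = coactFree H A ≫ E.retractionMap ▷ H :=
    retractionMap_colinear E hj hE
  refine ⟨E.retractionMap ≫ E.sectionMap, ?_, ?_, ?_,
    ⟨A, E.sectionMap, E.retractionMap, rfl, hsr⟩, Iso.refl A, ?_, ?_⟩
  · rw [Category.assoc, reassoc_of% hsr]
  · rw [reassoc_of% hr, hs, whiskerLeft_comp, Category.assoc]
  · rw [Category.assoc, cs, reassoc_of% cr, comp_whiskerRight]
  · dsimp only [Iso.refl_hom]
    rw [hr, ← whiskerLeft_comp_assoc (coinv H A) E.sectionMap, hsr]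
    simp
  · dsimp only [Iso.refl_hom]
    rw [reassoc_of% cs, ← comp_whiskerRight, hsr]
    simp

end Cleft

/-! ### From Galois with normal basis to a cleft extension. -/

section Galois

lemma coinv_mul_unit : coinv H A ◁ coinvUnit H A ≫ coinvMul H A = (ρ_ _).hom := by
  rw [← cancel_mono (incl H A), Category.assoc, coinvMul_incl, tensorHom_def',
    Category.assoc, ← whiskerLeft_comp_assoc, coinvUnit_incl, whisker_exchange_assoc,
    UnitalMagmaObj.mul_one, rightUnitor_naturality]

lemma coactFree_counit :
    coactFree H A ≫ (coinv H A ◁ ε[H] ≫ (ρ_ _).hom) ▷ H = 𝟙 (coinv H A ⊗ H) := by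
  have h : coactFree H A ≫ (coinv H A ◁ ε[H] ≫ (ρ_ _).hom) ▷ H =
      coinv H A ◁ (Δ[H] ≫ ε[H] ▷ H) ≫ coinv H A ◁ (λ_ H).hom := by
    rw [coactFree]
    monoidal
  rw [h, ComonObj.counit_comul, ← whiskerLeft_comp, Iso.inv_hom_id, whiskerLeft_id]

lemma unit_actFree :
    coinv H A ◁ ((λ_ H).inv ≫ coinvUnit H A ▷ H) ≫ actFree H A = 𝟙 (coinv H A ⊗ H) := by
  have h : coinv H A ◁ ((λ_ H).inv ≫ coinvUnit H A ▷ H) ≫ actFree H A =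
      (ρ_ _).inv ▷ H ≫ (coinv H A ◁ coinvUnit H A ≫ coinvMul H A) ▷ H := by
    rw [actFree]
    monoidal
  rw [h, coinv_mul_unit, ← comp_whiskerRight, Iso.inv_hom_id, id_whiskerRight]

variable [HasCoequalizers C]

/-- Morphisms on the image of `∇` are determined by their composites with the canonical morphism. -/
lemma nabla_ext {hm : AssocMiddle H A} {S : Splitting (nabla H A)} (hG : IsWeakGalois hm S) {Z : C}
    {f g : A ⊗ H ⟶ Z} (hf : nabla H A ≫ f = f) (hg : nabla H A ≫ g = g)
    (h : canonical H A ≫ f = canonical H A ≫ g) : f = g := by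
  have : IsIso (gamma hm S) := hG
  -- The inclusion i is tested after γ and n, an isomorphism and an epimorphism, where it becomes
  -- can.
  have : S.i ≫ f = S.i ≫ g := by
    rw [← cancel_epi (gamma hm S), ← cancel_epi (relProj H A), ← Category.assoc, ← Category.assoc,
      Category.assoc _ _ S.i, gamma_comp_i, h, ← gamma_comp_i hm S]
    simp only [Category.assoc]
  rw [← hf, ← hg, ← S.p_i, Category.assoc, Category.assoc, this]

instance [PreservesColimitsOfShape WalkingParallelPair (tensorLeft A)] :
    Epi (A ◁ relProj H A) :=
  epi_of_isColimit_cofork (isColimitOfHasCoequalizerOfPreservesColimit (tensorLeft A)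
    ((A ◁ incl H A ≫ mu A) ▷ A) ((α_ A (coinv H A) A).hom ≫ A ◁ (incl H A ▷ A ≫ mu A)))

/-- A normal basis yields a section and a retraction. -/
lemma HasNormalBasis.exists_maps (h : HasNormalBasis H A) :
    ∃ (s : A ⟶ coinv H A ⊗ H) (r : coinv H A ⊗ H ⟶ A), s ≫ r = 𝟙 A ∧
      actA H A ≫ s = coinv H A ◁ s ≫ actFree H A ∧
      actFree H A ≫ r = coinv H A ◁ r ≫ actA H A ∧
      s ≫ coactFree H A = rho H A ≫ s ▷ H ∧ r ≫ rho H A = coactFree H A ≫ r ▷ H := by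
  obtain ⟨Ω, hΩ, hl, hc, T, b, hbl, hbc⟩ := h
  have hi : Ω ≫ T.p = T.p := by
    have h : (T.p ≫ T.i) ≫ T.p = T.p := by rw [Category.assoc, T.i_p, Category.comp_id]
    rwa [T.p_i] at h
  have hp : T.i ≫ Ω = T.i := by
    have h : T.i ≫ T.p ≫ T.i = T.i := by rw [← Category.assoc, T.i_p, Category.id_comp]
    rwa [T.p_i] at h
  have hrs : (T.p ≫ b.inv) ≫ b.hom ≫ T.i = Ω := by
    rw [Category.assoc, b.inv_hom_id_assoc, T.p_i]
  refine ⟨b.hom ≫ T.i, T.p ≫ b.inv, ?_, ?_, ?_, ?_, ?_⟩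
  · rw [Category.assoc, ← Category.assoc T.i, T.i_p, Category.id_comp, b.hom_inv_id]
  · rw [← Category.assoc, hbl]
    simp only [Category.assoc, T.p_i, hl]
    rw [← whiskerLeft_comp_assoc _ _ Ω, hp, whiskerLeft_comp_assoc]
  · rw [← cancel_mono b.hom]
    simp only [Category.assoc, hbl, b.inv_hom_id, Category.comp_id]
    rw [← whiskerLeft_comp_assoc, ← whiskerLeft_comp_assoc, Category.assoc, hrs,
      ← reassoc_of% hl, hi]
  · have e := congrArg (fun t => t ≫ T.i ▷ H) hbc
    simp only [Category.assoc, ← comp_whiskerRight, T.p_i] at e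
    rw [← hc, reassoc_of% hp] at e
    simpa only [Category.assoc] using e
  · rw [← cancel_mono (b.hom ▷ H)]
    simp only [Category.assoc, ← hbc, b.inv_hom_id_assoc, ← comp_whiskerRight, b.inv_hom_id,
      Category.comp_id]
    have hx : T.p ≫ T.i ≫ coactFree H A ≫ T.p ▷ H = Ω ≫ coactFree H A ≫ T.p ▷ H := by
      rw [← Category.assoc, T.p_i]
    rw [hx, reassoc_of% hc, ← comp_whiskerRight, hi]

section Basis

variable {s : A ⟶ coinv H A ⊗ H} {r : coinv H A ⊗ H ⟶ A}

variable (s) in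
/-- The first component of a section. -/
def basisFst : A ⟶ coinv H A := s ≫ coinv H A ◁ ε[H] ≫ (ρ_ _).hom

variable (r) in
/-- The restriction of a retraction to `H`. -/
def basisElement : H ⟶ A := (λ_ H).inv ≫ coinvUnit H A ▷ H ≫ r

/-- B ⊗ H is cofree as a comodule, so s is recovered from its component in B. Dually, `eq_of_linear`
recovers r from its restriction to H, as B ⊗ H is free as a module. -/
lemma eq_of_colinear (h : s ≫ coactFree H A = rho H A ≫ s ▷ H) :
    rho H A ≫ basisFst s ▷ H = s := by
  rw [basisFst, comp_whiskerRight, ← reassoc_of% h, coactFree_counit, Category.comp_id]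

lemma eq_of_linear (h : actFree H A ≫ r = coinv H A ◁ r ≫ actA H A) :
    coinv H A ◁ basisElement r ≫ actA H A = r := by
  rw [basisElement, ← Category.assoc, whiskerLeft_comp, Category.assoc, ← h,
    ← Category.assoc, unit_actFree, Category.id_comp]

lemma basisFst_linear (h : actA H A ≫ s = coinv H A ◁ s ≫ actFree H A) :
    actA H A ≫ basisFst s = coinv H A ◁ basisFst s ≫ coinvMul H A := by
  have e : coinvMul H A ▷ H ≫ coinv H A ◁ ε[H] = (coinv H A ⊗ coinv H A) ◁ ε[H] ≫
      coinvMul H A ▷ 𝟙_ C := (whisker_exchange _ _).symm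
  rw [basisFst, reassoc_of% h, actFree, Category.assoc, reassoc_of% e]
  monoidal

lemma basisElement_colinear (h : r ≫ rho H A = coactFree H A ≫ r ▷ H) :
    basisElement r ≫ rho H A = Δ[H] ≫ basisElement r ▷ H := by
  have e : coinvUnit H A ▷ H ≫ coinv H A ◁ Δ[H] = 𝟙_ C ◁ Δ[H] ≫ coinvUnit H A ▷ (H ⊗ H) :=
    (whisker_exchange _ _).symm
  rw [basisElement, Category.assoc, Category.assoc, h, coactFree, Category.assoc, reassoc_of% e]
  monoidal

end Basis

/-- The morphism `a ⊗ b ↦ a q(b)` on the relative tensor product. -/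
def relMul (q : A ⟶ coinv H A)
    (hq : (A ◁ incl H A ≫ mu A) ▷ A ≫ A ◁ (q ≫ incl H A) ≫ mu A =
      (α_ A (coinv H A) A).hom ≫ A ◁ (incl H A ▷ A ≫ mu A) ≫ A ◁ (q ≫ incl H A) ≫ mu A) :
    relTensor H A ⟶ A :=
  coequalizer.desc (A ◁ (q ≫ incl H A) ≫ mu A) (by simpa only [Category.assoc] using hq)

lemma proj_relMul (q : A ⟶ coinv H A) (hq) :
    relProj H A ≫ relMul q hq = A ◁ (q ≫ incl H A) ≫ mu A :=
  coequalizer.π_desc _ _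

/-- By `AssocRight`, (a b) q(c) = a (b q(c)). It suffices to test on A ⊗ n, an epimorphism since A ⊗
- preserves the coequalizer. -/
lemma relAct_relMul [PreservesColimitsOfShape WalkingParallelPair (tensorLeft A)]
    (hr : AssocRight H A) (q : A ⟶ coinv H A) (hq) :
    relAct hr ≫ relMul q hq = A ◁ relMul q hq ≫ mu A := by
  rw [← cancel_epi (A ◁ relProj H A), ← Category.assoc, proj_relAct, ← whiskerLeft_comp_assoc,
    proj_relMul, Category.assoc, Category.assoc, proj_relMul]
  have h := congrArg (fun t => A ◁ (A ◁ q) ≫ t) (show A ◁ (A ◁ incl H A ≫ mu A) ≫ mu A = _ from hr)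
  have e : (A ⊗ A) ◁ q ≫ (mu A ⊗ₘ incl H A) = mu A ▷ A ≫ A ◁ (q ≫ incl H A) := by
    rw [MonoidalCategory.tensorHom_def, whisker_exchange_assoc, whiskerLeft_comp]
  have h' : A ◁ (A ◁ q) ≫ (α_ A A (coinv H A)).inv ≫ (mu A ⊗ₘ incl H A) ≫ mu A =
      (α_ A A A).inv ≫ mu A ▷ A ≫ A ◁ (q ≫ incl H A) ≫ mu A := by
    rw [← reassoc_of% e]
    monoidal
  refine h'.symm.trans (h.symm.trans ?_)
  monoidal

lemma isWeakCleft [PreservesColimitsOfShape WalkingParallelPair (tensorLeft A)]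
    (hm : AssocMiddle H A) (hr : AssocRight H A) (S : Splitting (nabla H A))
    (hG : IsWeakGalois hm S) (hL : InverseAlmostLineal hm hr S hG) (hB : HasNormalBasis H A) :
    IsWeakCleft H A := by
  have : IsIso (gamma hm S) := hG
  obtain ⟨s, r, hsr, hs, hr', cs, cr⟩ := hB.exists_maps
  let h := basisElement r
  let q := basisFst s
  have hlin : (incl H A ▷ A ≫ mu A) ≫ q ≫ incl H A =
      coinv H A ◁ q ≫ (incl H A ⊗ₘ incl H A) ≫ mu A := by
    have e := congrArg (fun t => t ≫ incl H A) (basisFst_linear hs)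
    simp only [Category.assoc, coinvMul_incl] at e
    exact e
  let E₀ : Env H A (coinv H A) := ⟨h, h, incl H A, q⟩
  have hb := mul_prj_balanced E₀ (isCoinv_of_incl E₀ rfl hm) (E₀.linear hlin)
  let m := relMul q hb
  -- Forced by the aim m γ⁻¹ p(a ⊗ x) = a k(x), evaluated at a = 1.
  let k : H ⟶ A := (λ_ H).inv ≫ un A ▷ H ≫ S.p ≫ inv (gamma hm S) ≫ m
  -- Almost lineality of γ⁻¹ followed by left linearity of m.
  have hk : S.p ≫ inv (gamma hm S) ≫ m = A ◁ k ≫ mu A := by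
    have e := congrArg (fun t => t ≫ m) hL
    simp only [Category.assoc, m, relAct_relMul] at e
    rw [e, ← whiskerLeft_comp_assoc]
    simp only [k, m, Category.assoc]
  let E : Env H A (coinv H A) := ⟨h, k, incl H A, q⟩
  have hj : E.IsCoinv := isCoinv_of_incl E rfl hm
  have hE : E.IsGalois := by
    refine E.isGalois (basisElement_colinear cr) ?_ ?_ ?_
    · have e₁ : E.sectionMap = s := eq_of_colinear cs
      have e₂ : E.retractionMap = r := eq_of_linear hr'
      rw [e₁, e₂, hsr]
    · refine (congrArg (fun t => canonical H A ≫ t) hk).symm.trans ?_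
      rw [← Category.assoc, ← proj_comp_gamma hm S, Category.assoc, IsIso.hom_inv_id_assoc]
      exact proj_relMul q hb
    · change nabla H A ≫ A ◁ k ≫ mu A = A ◁ k ≫ mu A
      rw [← hk, ← Category.assoc, nabla_comp_p]
  have hv : E.SndFst := E.sndFst_of (nabla_ext hG (nabla_comp_snd_fst E hE) nabla_comp_cleftUnit
    (canonical_comp_snd_fst E hj hE))
  have hn : ∀ {Z : C} (f : A ⊗ H ⟶ Z), nabla H A ≫ nabla H A ≫ f = nabla H A ≫ f := fun f => by
    rw [← Category.assoc, nabla_comp_nabla]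
  have hF : ∀ {Z : C} (f : A ⟶ Z), nabla H A ≫ (A ◁ E.k ≫ mu A) ≫ f = (A ◁ E.k ≫ mu A) ≫ f :=
    fun f => by
      change nabla H A ≫ (A ◁ k ≫ mu A) ≫ f = (A ◁ k ≫ mu A) ≫ f
      rw [← hk, ← Category.assoc, ← Category.assoc, nabla_comp_p]
  have hc : E.SndCoact := E.sndCoact_of (nabla_ext hG (hF _) (hn _)
    (canonical_comp_snd_coact E hj hE))
  have hcb : E.SndCoactBar := E.sndCoactBar_of (nabla_ext hG (hF _) (hn _)
    (canonical_comp_snd_coact_bar E hj hE))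
  have hconv : conv k h = cleftUnit H A := conv_snd_fst E hv
  refine ⟨h, k, basisElement_colinear cr, hconv, mul_snd_coact E hc hcb, ?_, mul_fst_snd_eq E hE⟩
  rw [hconv]
  exact nabla_ext hG (nabla_comp_snd_fst E hE) nabla_comp_cleftUnit
    (canonical_comp_snd_fst E hj hE)

end Galois

lemma exists_of_isWeakCleft [HasCoequalizers C]
    [PreservesColimitsOfShape WalkingParallelPair (tensorLeft A)]
    (hm : AssocMiddle H A) (hr : AssocRight H A) (S : Splitting (nabla H A))
    (h : IsWeakCleft H A) :
    ∃ hG : IsWeakGalois hm S, InverseAlmostLineal hm hr S hG ∧ HasNormalBasis H A := by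
  obtain ⟨h, k, h₀, h₁, h₂, h₃, h₄⟩ := h
  have h₁' : conv k h = cleftUnit H A := h₁
  rw [h₁'] at h₃
  -- The map q into the coinvariants exists only once a₀ k(a₁) is known to be coinvariant, so until
  -- then A and its identity stand in for them.
  let E₀ : Env H A A := ⟨h, k, 𝟙 A, 𝟙 A⟩
  have hq := rho_snd_coinv E₀ (E₀.isCleft h₀ h₂ h₃ h₄)
  let q : A ⟶ coinv H A := equalizer.lift (rho H A ≫ A ◁ k ≫ mu A) hq
  let E : Env H A (coinv H A) := ⟨h, k, incl H A, q⟩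
  have hE : E.IsCleft := E.isCleft h₀ h₂ h₃ h₄
  have hf : E.Factors := E.factors (equalizer.lift_ι _ _)
  have hj : E.IsCoinv := isCoinv_of_incl E rfl hm
  exact ⟨isWeakGalois E rfl hj hE hf hm S, inverseAlmostLineal E hE hm hr S _,
    hasNormalBasis E rfl hj hE hf⟩

end WeakHopfQuasi

end

open WeakHopfQuasi
theorem theorem4p1 {C : Type*} [Category C] [MonoidalCategory C] [SymmetricCategory C]
    [HasEqualizers C] [HasCoequalizers C]
    (H A : C) [WeakHopfQuasigroup H] [UnitalMagmaObj A] [RightComoduleMagma H A]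
    (hm : AssocMiddle H A) (hr : AssocRight H A)
    [PreservesColimitsOfShape WalkingParallelPair (tensorLeft A)] :
    Nonempty (Splitting (nabla H A)) ∧
      ∀ S : Splitting (nabla H A),
        (∃ hG : IsWeakGalois hm S, InverseAlmostLineal hm hr S hG ∧ HasNormalBasis H A) ↔
          IsWeakCleft H A :=
  ⟨⟨splittingOfIdempotent _ nabla_comp_nabla⟩, fun S =>
    ⟨fun ⟨hG, hL, hB⟩ => isWeakCleft hm hr S hG hL hB, exists_of_isWeakCleft hm hr S⟩⟩
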